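/- **Corollary (witness encryption with certified deletion).** Let $\lambda$ be the security parameter; "negligible" means smaller than every inverse polynomial in $\lambda$. Let $R$ be a witness relation for a family of languages: $(\ell,X,W)\in R$ says that $W$ is a witness for the statement $X$ in the language named $\ell$, and $X\in\mathcal L_\ell$ means that some witness exists (for example, an $\mathsf{NP}$ language, or all of them with $\ell$ describing the verifier). *Hypothesis.* $\mathsf{WE}=(\mathsf{Enc},\mathsf{Dec})$ is a post-quantum semantically-secure witness encryption scheme for $R$ with messages in $\{0,1\}^*$. That is, $\mathsf{Enc}(1^\lambda,\ell,X,m)$ and $\mathsf{Dec}(1^\lambda,W,\mathsf{ct})$ are classical probabilistic polynomial-time algorithms; for every polynomial $p$ there is a negligible $\nu$ such that $\Pr[\mathsf{Dec}(W,\mathsf{Enc}(\ell,X,m))=m]\ge 1-\nu(\lambda)$ for all $(\ell,X,W)\in R$ and all $m$ of total length at most $p(\lambda)$; and every non-uniform quantum polynomial-time (QPT) adversary $\{\mathcal A_\lambda,|\psi_\lambda\rangle\}_\lambda$ (polynomial-size quantum circuits with polynomial-size advice states) that chooses $\ell$, $X$ and two messages $m_0,m_1$ of equal length, and then receives $\mathsf{Enc}(\ell,X,m_b)$,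 outputs $1$ with probabilities that differ by a negligible amount for $b=0$ and $b=1$, where the experiment is aborted if $X\in\mathcal L_\ell$. *Construction.* For $x,\theta\in\{0,1\}^\lambda$ let $|x\rangle_\theta$ be the state of $\lambda$ qubits whose $i$-th qubit encodes $x_i$ in the computational basis if $\theta_i=0$ and in the Hadamard basis if $\theta_i=1$. Define $\mathsf{CD\text{-}WE}=(\mathsf{Enc}',\mathsf{Dec}',\mathsf{Del},\mathsf{Ver})$ for one-bit messages $m$ as follows. - $\mathsf{Enc}'(\ell,X,m)$: sample $x,\theta\leftarrow\{0,1\}^\lambda$ and output $\mathsf{ct}=\big(|x\rangle_\theta,\ \mathsf{Enc}(\ell,X,(\theta,\,m\oplus\bigoplus_{i:\theta_i=0}x_i))\big)$ and the verification key $\mathsf{vk}=(x,\theta)$. - $\mathsf{Dec}'(W,\mathsf{ct})$: decrypt the classical part to $(\theta,b')$ with $\mathsf{Dec}(W,\cdot)$ (output $\bot$ if this fails), measure the qubits in the $\theta$-basis to obtain $x$, output $b'\oplus\bigoplus_{i:\theta_i=0}x_i$. - $\mathsf{Del}(\mathsf{ct})$: measure all qubits in the Hadamard basis and output the resulting string $\mathsf{cert}=x'$.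 - $\mathsf{Ver}(\mathsf{vk},\mathsf{cert})$: output $\top$ if and only if $x_i=x'_i$ for all $i$ with $\theta_i=1$, and $\bot$ otherwise. *Conclusion.* $\mathsf{CD\text{-}WE}$ is a witness encryption scheme with certified deletion for $R$: 1. *Efficiency.* $\mathsf{Enc}',\mathsf{Dec}',\mathsf{Del},\mathsf{Ver}$ run in (uniform) quantum polynomial time. 2. *Correctness of decryption.* For every polynomial $p$ there is a negligible $\nu$ such that for all $(\ell,X,W)\in R$ of total length at most $p(\lambda)$ and all bits $m$, $\Pr[\mathsf{Dec}'(W,\mathsf{ct})=m]\ge1-\nu(\lambda)$, where $(\mathsf{ct},\mathsf{vk})\leftarrow\mathsf{Enc}'(\ell,X,m)$. 3. *Correctness of deletion.* There is a negligible $\nu$ such that for all $\ell,X,m$, $\Pr[\mathsf{Ver}(\mathsf{vk},\mathsf{Del}(\mathsf{ct}))=\top]\ge 1-\nu(\lambda)$, where $(\mathsf{ct},\mathsf{vk})\leftarrow\mathsf{Enc}'(\ell,X,m)$. 4. *Certified deletion security.* For every non-uniform QPT adversary $\mathcal A=\{\mathcal A_\lambda,|\psi_\lambda\rangle\}_\lambda$,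 both $$\mathsf{TD}\big(\mathsf{EV\text{-}EXP}^{\mathcal A}_\lambda(0),\mathsf{EV\text{-}EXP}^{\mathcal A}_\lambda(1)\big)\quad\text{and}\quad\big|\Pr[\mathsf{C\text{-}EXP}^{\mathcal A}_\lambda(0)=1]-\Pr[\mathsf{C\text{-}EXP}^{\mathcal A}_\lambda(1)=1]\big|$$ are negligible, where $\mathsf{TD}$ is the trace distance. In both experiments $\mathcal A_\lambda(|\psi_\lambda\rangle)$ outputs $\ell$, $X$ and bits $m_0,m_1$, and the experiment is aborted if $X\in\mathcal L_\ell$. Otherwise $(\mathsf{ct},\mathsf{vk})\leftarrow\mathsf{Enc}'(\ell,X,m_b)$ is sampled, $\mathcal A_\lambda$ receives $\mathsf{ct}$ and outputs a certificate $\mathsf{cert}$ and a residual state on a register $\mathsf A'$. $\mathsf{EV\text{-}EXP}(b)$ outputs $\mathsf A'$ if $\mathsf{Ver}(\mathsf{vk},\mathsf{cert})=\top$ and $\bot$ otherwise; $\mathsf{C\text{-}EXP}(b)$ outputs $\mathcal A_\lambda(\mathsf A',\mathsf{Ver}(\mathsf{vk},\mathsf{cert}))$. -/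

import Mathlib

open Matrix

noncomputable section

namespace CertDel

/-! ### Classical algorithms: programs over finitely many stacks, with a step count -/

/-- A store: every register is a stack of bits. -/
abbrev Store := ℕ → List Bool

/-- Multi-stack programs. -/
inductive Prog where
  /-- push the bit `b` on register `r` -/
  | push (b : Bool) (r : ℕ)
  /-- remove the top bit of register `r` (nothing happens if it is empty) -/
  | pop (r : ℕ)
  /-- sequential composition -/
  | seq (p q : Prog)
  /-- branch: register `r` empty / top bit `false` / top bit `true` -/
  | branch (r : ℕ) (pNil pFalse pTrue : Prog)
  /-- while register `r` is non-empty, run `p` -/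
  | loop (r : ℕ) (p : Prog)

/-- `Run p s s' t`: started on store `s`, the program `p` halts with store `s'` after `t` steps. -/
inductive Run : Prog → Store → Store → ℕ → Prop where
  | push (b : Bool) (r : ℕ) (s : Store) : Run (.push b r) s (Function.update s r (b :: s r)) 1
  | pop (r : ℕ) (s : Store) : Run (.pop r) s (Function.update s r (s r).tail) 1
  | seq {p q : Prog} {s s₁ s₂ : Store} {t₁ t₂ : ℕ} :
      Run p s s₁ t₁ → Run q s₁ s₂ t₂ → Run (.seq p q) s s₂ (t₁ + t₂)
  | branchNil {r : ℕ} {p q u : Prog} {s s' : Store} {t : ℕ} :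
      s r = [] → Run p s s' t → Run (.branch r p q u) s s' (t + 1)
  | branchFalse {r : ℕ} {p q u : Prog} {s s' : Store} {t : ℕ} {l : List Bool} :
      s r = false :: l → Run q s s' t → Run (.branch r p q u) s s' (t + 1)
  | branchTrue {r : ℕ} {p q u : Prog} {s s' : Store} {t : ℕ} {l : List Bool} :
      s r = true :: l → Run u s s' t → Run (.branch r p q u) s s' (t + 1)
  | loopDone {r : ℕ} {p : Prog} {s : Store} : s r = [] → Run (.loop r p) s s 1
  | loopStep {r : ℕ} {p : Prog} {s s₁ s₂ : Store} {t₁ t₂ : ℕ} :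
      s r ≠ [] → Run p s s₁ t₁ → Run (.loop r p) s₁ s₂ t₂ → Run (.loop r p) s s₂ (t₁ + t₂ + 1)

/-- Some program, started with the strings `input a` in registers `0, 1, 2, …` (and all other
registers empty), halts with the strings `output a` in registers `0, 1, 2, …`, in a number of steps
bounded by a fixed polynomial in the total input length. -/
def ComputesInPolyTime {α : Type} (input output : α → List (List Bool)) : Prop :=
  ∃ (p : Prog) (P : Polynomial ℕ), ∀ a : α, ∃ (s : Store) (t : ℕ),
    Run p (fun i => (input a).getD i []) s t ∧
    (∀ i < (output a).length, s i = (output a).getD i []) ∧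
    t ≤ P.eval ((input a).map List.length).sum

/-- The unary string `1ⁿ`. -/
def unary (n : ℕ) : List Bool := List.replicate n true

/-- A natural-number quantity is polynomially bounded in the security parameter. -/
def PolyBounded (f : ℕ → ℕ) : Prop := ∃ P : Polynomial ℕ, ∀ lam, f lam ≤ P.eval lam

/-- Negligible functions of the security parameter. -/
def Negligible (f : ℕ → ℝ) : Prop :=
  Asymptotics.SuperpolynomialDecay Filter.atTop (fun n : ℕ => (n : ℝ)) f

/-- The expectation of `f r` over a uniformly random string `r` of `n` bits. -/
def avg {M : Type*} [AddCommMonoid M] [Module ℝ M] (n : ℕ) (f : List Bool → M) : M :=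
  ((2 : ℝ) ^ n)⁻¹ • ∑ r : Fin n → Bool, f (List.ofFn r)

/-! ### Qubits and circuits -/

/-- Operators (in particular density matrices) on a register of qubits, one for each `i : ι`;
the computational basis is indexed by the bit assignments `ι → Bool`. -/
abbrev Op (ι : Type) := Matrix (ι → Bool) (ι → Bool) ℂ

/-- Elementary gates on qubits labelled by `ι`. -/
inductive Gate (ι : Type) where
  | X (i : ι)
  | H (i : ι)
  | T (i : ι)
  | CNOT (c t : ι) (h : c ≠ t)
  | Toffoli (c d t : ι) (hc : c ≠ t) (hd : d ≠ t) (hcd : c ≠ d)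

/-- A circuit is a list of gates, applied from left to right; its size is the length of the list. -/
abbrev Circuit (ι : Type) := List (Gate ι)

section
variable {ι κ : Type} [Fintype ι] [DecidableEq ι] [Fintype κ] [DecidableEq κ]

/-- The unitary of a gate. -/
def Gate.matrix : Gate ι → Op ι
  | .X i => Matrix.of fun s t => if s = Function.update t i (!t i) then 1 else 0
  | .H i => Matrix.of fun s t =>
      if ∀ j, j ≠ i → s j = t j then (if s i && t i then -1 else 1) / (Real.sqrt 2 : ℂ) else 0
  | .T i => Matrix.diagonal fun s => if s i then Complex.exp (Real.pi / 4 * Complex.I) else 1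
  | .CNOT c k _ => Matrix.of fun s t => if s = Function.update t k (t k ^^ t c) then 1 else 0
  | .Toffoli c d k _ _ _ => Matrix.of fun s t =>
      if s = Function.update t k (t k ^^ (t c && t d)) then 1 else 0

/-- The unitary of a circuit. -/
def Circuit.matrix : Circuit ι → Op ι
  | [] => 1
  | g :: c => Circuit.matrix c * g.matrix

/-- Running a circuit on a state. -/
def Circuit.apply (c : Circuit ι) (ρ : Op ι) : Op ι :=
  Circuit.matrix c * ρ * (Circuit.matrix c)ᴴ

/-- The basis state `|z⟩⟨z|`. -/
def basisState (z : ι → Bool) : Op ι := Matrix.of fun s t => if s = z ∧ t = z then 1 else 0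

/-- The state `|ψ⟩⟨ψ|`. -/
def pureState (ψ : (ι → Bool) → ℂ) : Op ι := Matrix.vecMulVec ψ (star ψ)

/-- The state `ρ ⊗ σ` of two registers side by side. -/
def tensor (ρ : Op ι) (σ : Op κ) : Op (ι ⊕ κ) :=
  Matrix.of fun s t => ρ (s ∘ Sum.inl) (t ∘ Sum.inl) * σ (s ∘ Sum.inr) (t ∘ Sum.inr)

/-- Measure the qubits `out k`, `k : κ`, in the computational basis: the unnormalised state
`P ρ P` after the outcome `z`. Its trace is the probability of this outcome. -/
def collapse (out : κ → ι) (z : κ → Bool) (ρ : Op ι) : Op ι :=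
  Matrix.of fun s t => if s ∘ out = z ∧ t ∘ out = z then ρ s t else 0

/-- The probability that measuring qubit `i` of `ρ` gives `1`. -/
def probOne (i : ι) (ρ : Op ι) : ℝ :=
  (collapse (fun _ : Unit => i) (fun _ => true) ρ).trace.re

/-- The state on a register extended by the symbol `⊥` (`none`) that equals `ρ` when the outcome is
not `⊥` (`ρ` is subnormalised), and `⊥` with the remaining probability. -/
def withBot (ρ : Op ι) : Matrix (Option (ι → Bool)) (Option (ι → Bool)) ℂ :=
  Matrix.of fun
    | some s, some t => ρ s t
    | none, none => 1 - ρ.trace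
    | _, _ => 0

end

/-- The trace norm `Tr √(A† A)`, the sum of the square roots of the eigenvalues of `A† A`. -/
def traceNorm {n : Type} [Fintype n] [DecidableEq n] (A : Matrix n n ℂ) : ℝ :=
  ∑ i, Real.sqrt ((Matrix.isHermitian_conjTranspose_mul_self A).eigenvalues i)

/-- Trace distance. -/
def traceDist {n : Type} [Fintype n] [DecidableEq n] (ρ σ : Matrix n n ℂ) : ℝ :=
  traceNorm (ρ - σ) / 2

/-- A gate on `n` qubits as a bit string: three bits for the kind, and the labels in unary. -/
def Gate.encode {n : ℕ} : Gate (Fin n) → List Bool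
  | .X i => [false, false, false] ++ unary i ++ [false]
  | .H i => [false, false, true] ++ unary i ++ [false]
  | .T i => [false, true, false] ++ unary i ++ [false]
  | .CNOT c t _ => [false, true, true] ++ unary c ++ [false] ++ unary t ++ [false]
  | .Toffoli c d t _ _ _ =>
      [true, false, false] ++ unary c ++ [false] ++ unary d ++ [false] ++ unary t ++ [false]

/-- A circuit as a bit string. -/
def Circuit.encode {n : ℕ} (c : Circuit (Fin n)) : List Bool := c.flatMap Gate.encode

/-! ### Strings on qubit registers

A tape with `k` cells consists of `2k` qubits: in cell `i`, the qubit `(i, false)` says whether the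
cell is used and the qubit `(i, true)` holds its bit. -/

/-- Write a string on a tape with `k` cells (only the first `k` bits, if it is longer). -/
def writeTape (k : ℕ) (l : List Bool) : Fin k × Bool → Bool := fun c =>
  if c.2 then l.getD c.1 false else decide ((c.1 : ℕ) < l.length)

/-- Read the string on a tape: the bits up to the first unused cell. -/
def readTape {k : ℕ} (z : Fin k × Bool → Bool) : List Bool :=
  ((List.finRange k).takeWhile fun i => z (i, false)).map fun i => z (i, true)

/-! ### Witness encryption

Languages have names `ℓ`. `R ℓ X W` means that `W` is a witness for the statement `X` in the
language named `ℓ`. -/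

/-- `X` belongs to the language `ℓ`. -/
def inLanguage (R : List Bool → List Bool → List Bool → Prop) (ℓ X : List Bool) : Prop :=
  ∃ W, R ℓ X W

/-- The syntax of witness encryption for messages in `{0,1}*`. Random coins are explicit: on
security parameter `lam`, `enc lam ℓ X m r` is the encryption of `m` under the statement `X` of
language `ℓ` with coins `r`, a uniformly random string of `encCoins lam ℓ X |m|` bits;
`dec lam W ct r` is the decryption of `ct` with witness `W` and `decCoins lam W ct` coins `r`. -/
structure WE where
  encCoins : (lam : ℕ) → (ℓ X : List Bool) → (msgLen : ℕ) → ℕ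
  enc : (lam : ℕ) → (ℓ X m r : List Bool) → List Bool
  decCoins : (lam : ℕ) → (W ct : List Bool) → ℕ
  dec : (lam : ℕ) → (W ct r : List Bool) → Option (List Bool)

namespace WE

/-- The algorithms run in (uniform, probabilistic) polynomial time. -/
def IsPPT (E : WE) : Prop :=
  ComputesInPolyTime (α := ℕ × List Bool × List Bool × ℕ)
    (fun (lam, ℓ, X, n) => [unary lam, ℓ, X, unary n])
    (fun (lam, ℓ, X, n) => [unary (E.encCoins lam ℓ X n)]) ∧
  ComputesInPolyTime (α := ℕ × List Bool × List Bool × List Bool × List Bool)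
    (fun (lam, ℓ, X, m, r) => [unary lam, ℓ, X, m, r])
    (fun (lam, ℓ, X, m, r) => [E.enc lam ℓ X m r]) ∧
  ComputesInPolyTime (α := ℕ × List Bool × List Bool)
    (fun (lam, W, ct) => [unary lam, W, ct])
    (fun (lam, W, ct) => [unary (E.decCoins lam W ct)]) ∧
  ComputesInPolyTime (α := ℕ × List Bool × List Bool × List Bool)
    (fun (lam, W, ct, r) => [unary lam, W, ct, r])
    (fun (lam, W, ct, r) => [((E.dec lam W ct r).map (List.cons true)).getD []])

/-- The probability that the encryption of `m` under `X` decrypts to `m` with witness `W`. -/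
def decProb (E : WE) (lam : ℕ) (ℓ X W m : List Bool) : ℝ :=
  avg (E.encCoins lam ℓ X m.length) fun r =>
    avg (E.decCoins lam W (E.enc lam ℓ X m r)) fun r' =>
      if E.dec lam W (E.enc lam ℓ X m r) r' = some m then (1 : ℝ) else 0

/-- Correctness of decryption: up to a negligible error, for all inputs of polynomial length. -/
def Correct (E : WE) (R : List Bool → List Bool → List Bool → Prop) : Prop :=
  ∀ P : Polynomial ℕ, ∃ ν : ℕ → ℝ, Negligible ν ∧
    ∀ (lam : ℕ) (ℓ X W m : List Bool), R ℓ X W →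
      ℓ.length + X.length + W.length + m.length ≤ P.eval lam →
      1 - ν lam ≤ E.decProb lam ℓ X W m

/-- A quantum machine (for one value of the security parameter) with an advice state that attacks
semantic security. It first runs `choose` on the advice and measures four tapes: the name of a
language, a statement, and two messages. It then receives a ciphertext on a tape with `ctCells`
cells, runs `guess`, and measures the qubit `result`. Ancillas are part of the advice. -/
structure Adversary where
  work : ℕ
  advice : (Fin work → Bool) → ℂ
  advice_unit : ∑ s, ‖advice s‖ ^ 2 = 1
  choose : Circuit (Fin work)
  outCells : ℕ
  out : Fin 4 × Fin outCells × Bool → Fin work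
  ctCells : ℕ
  guess : Circuit (Fin work ⊕ (Fin ctCells × Bool))
  result : Fin work ⊕ (Fin ctCells × Bool)

/-- Number of qubits and gates of the machine. -/
def Adversary.size (A : Adversary) : ℕ :=
  A.work + A.choose.length + A.outCells + A.ctCells + A.guess.length

open Classical in
/-- The probability that the machine outputs `1` when the message `m_b` is encrypted. The
experiment is aborted if the statement is in the language or the messages differ in length. -/
def Adversary.prob (A : Adversary) (E : WE) (R : List Bool → List Bool → List Bool → Prop)
    (lam : ℕ) (b : Bool) : ℝ :=
  ∑ z : Fin 4 × Fin A.outCells × Bool → Bool,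
    let ℓ := readTape fun c => z (0, c)
    let X := readTape fun c => z (1, c)
    let m₀ := readTape fun c => z (2, c)
    let m₁ := readTape fun c => z (3, c)
    let m := if b then m₁ else m₀
    if inLanguage R ℓ X ∨ m₀.length ≠ m₁.length then 0
    else avg (E.encCoins lam ℓ X m.length) fun r =>
      probOne A.result <| A.guess.apply <|
        tensor (collapse A.out z (A.choose.apply (pureState A.advice)))
          (basisState (writeTape A.ctCells (E.enc lam ℓ X m r)))

/-- Semantic security against non-uniform quantum polynomial-time adversaries. -/
def PostQuantumSecure (E : WE) (R : List Bool → List Bool → List Bool → Prop) : Prop :=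
  ∀ A : ℕ → Adversary, PolyBounded (fun lam => (A lam).size) →
    Negligible fun lam => |(A lam).prob E R lam false - (A lam).prob E R lam true|

/-- Post-quantum semantically-secure witness encryption for the languages given by `R`. -/
structure IsPostQuantumWE (E : WE) (R : List Bool → List Bool → List Bool → Prop) : Prop where
  ppt : E.IsPPT
  correct : E.Correct R
  secure : E.PostQuantumSecure R

end WE

/-! ### Witness encryption with certified deletion -/

/-- The syntax of witness encryption of one bit with certified deletion, with classical
verification keys and certificates. A ciphertext consists of a register of `qubits lam` qubits and
a classical string.
* `Enc`: with coins `r`, output the verification key `encVk`, the classical ciphertext `encCt`, and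
  the quantum register that results from running the circuit `encPrep` on `|0…0⟩`.
* `Dec`: with coins `r`, run the circuit `decPrep` on the quantum ciphertext, measure all qubits
  with outcome `y`, output `decOut` (`none` is `⊥`).
* `Del`: run `delPrep` on the quantum ciphertext, measure all qubits with outcome `y`, output the
  certificate `delOut`.
* `Ver`: accept (`true`) or reject a certificate. -/
structure CDWE where
  qubits : ℕ → ℕ
  certLen : ℕ → ℕ
  encCoins : (lam : ℕ) → (ℓ X : List Bool) → ℕ
  encVk : (lam : ℕ) → (ℓ X : List Bool) → (b : Bool) → (r : List Bool) → List Bool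
  encCt : (lam : ℕ) → (ℓ X : List Bool) → (b : Bool) → (r : List Bool) → List Bool
  encPrep : (lam : ℕ) → (ℓ X : List Bool) → (b : Bool) → (r : List Bool) →
    Circuit (Fin (qubits lam))
  decCoins : (lam : ℕ) → (W ct : List Bool) → ℕ
  decPrep : (lam : ℕ) → (W ct r : List Bool) → Circuit (Fin (qubits lam))
  decOut : (lam : ℕ) → (W ct r : List Bool) → (y : Fin (qubits lam) → Bool) → Option Bool
  delPrep : (lam : ℕ) → (ct : List Bool) → Circuit (Fin (qubits lam))
  delOut : (lam : ℕ) → (ct : List Bool) → (y : Fin (qubits lam) → Bool) →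
    (Fin (certLen lam) → Bool)
  ver : (lam : ℕ) → (vk : List Bool) → (cert : Fin (certLen lam) → Bool) → Bool

namespace CDWE

/-- All algorithms run in (uniform) quantum polynomial time: their classical computations and the
descriptions of their circuits are computed in polynomial time. -/
def IsQPT (S : CDWE) : Prop :=
  ComputesInPolyTime (α := ℕ × List Bool × List Bool)
    (fun (lam, ℓ, X) => [unary lam, ℓ, X])
    (fun (lam, ℓ, X) => [unary (S.qubits lam), unary (S.certLen lam),
      unary (S.encCoins lam ℓ X)]) ∧
  ComputesInPolyTime (α := ℕ × List Bool × List Bool × Bool × List Bool)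
    (fun (lam, ℓ, X, b, r) => [unary lam, ℓ, X, [b], r])
    (fun (lam, ℓ, X, b, r) => [S.encVk lam ℓ X b r, S.encCt lam ℓ X b r,
      (S.encPrep lam ℓ X b r).encode]) ∧
  ComputesInPolyTime (α := ℕ × List Bool × List Bool)
    (fun (lam, W, ct) => [unary lam, W, ct])
    (fun (lam, W, ct) => [unary (S.decCoins lam W ct)]) ∧
  ComputesInPolyTime (α := ℕ × List Bool × List Bool × List Bool)
    (fun (lam, W, ct, r) => [unary lam, W, ct, r])
    (fun (lam, W, ct, r) => [(S.decPrep lam W ct r).encode]) ∧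
  ComputesInPolyTime
    (α := (lam : ℕ) × (List Bool × List Bool × List Bool × (Fin (S.qubits lam) → Bool)))
    (fun ⟨lam, W, ct, r, y⟩ => [unary lam, W, ct, r, List.ofFn y])
    (fun ⟨lam, W, ct, r, y⟩ => [(S.decOut lam W ct r y).toList]) ∧
  ComputesInPolyTime (α := ℕ × List Bool)
    (fun (lam, ct) => [unary lam, ct])
    (fun (lam, ct) => [(S.delPrep lam ct).encode]) ∧
  ComputesInPolyTime (α := (lam : ℕ) × (List Bool × (Fin (S.qubits lam) → Bool)))
    (fun ⟨lam, ct, y⟩ => [unary lam, ct, List.ofFn y])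
    (fun ⟨lam, ct, y⟩ => [List.ofFn (S.delOut lam ct y)]) ∧
  ComputesInPolyTime (α := (lam : ℕ) × (List Bool × (Fin (S.certLen lam) → Bool)))
    (fun ⟨lam, vk, cert⟩ => [unary lam, vk, List.ofFn cert])
    (fun ⟨lam, vk, cert⟩ => [[S.ver lam vk cert]])

/-- The quantum part of an honestly generated ciphertext. -/
def encState (S : CDWE) (lam : ℕ) (ℓ X : List Bool) (b : Bool) (r : List Bool) :
    Op (Fin (S.qubits lam)) :=
  (S.encPrep lam ℓ X b r).apply (basisState fun _ => false)

/-- The probability that an honestly generated ciphertext decrypts to the encrypted bit. -/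
def decProb (S : CDWE) (lam : ℕ) (ℓ X W : List Bool) (b : Bool) : ℝ :=
  avg (S.encCoins lam ℓ X) fun r =>
    let ct := S.encCt lam ℓ X b r
    avg (S.decCoins lam W ct) fun r' =>
      ∑ y : Fin (S.qubits lam) → Bool,
        if S.decOut lam W ct r' y = some b then
          (((S.decPrep lam W ct r').apply (S.encState lam ℓ X b r)) y y).re
        else 0

/-- The probability that an honestly generated deletion certificate is accepted. -/
def delProb (S : CDWE) (lam : ℕ) (ℓ X : List Bool) (b : Bool) : ℝ :=
  avg (S.encCoins lam ℓ X) fun r =>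
    let ct := S.encCt lam ℓ X b r
    ∑ y : Fin (S.qubits lam) → Bool,
      if S.ver lam (S.encVk lam ℓ X b r) (S.delOut lam ct y) then
        (((S.delPrep lam ct).apply (S.encState lam ℓ X b r)) y y).re
      else 0

/-- Correctness of decryption. -/
def Correct (S : CDWE) (R : List Bool → List Bool → List Bool → Prop) : Prop :=
  ∀ P : Polynomial ℕ, ∃ ν : ℕ → ℝ, Negligible ν ∧
    ∀ (lam : ℕ) (ℓ X W : List Bool) (b : Bool), R ℓ X W →
      ℓ.length + X.length + W.length ≤ P.eval lam →
      1 - ν lam ≤ S.decProb lam ℓ X W b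

/-- Correctness of deletion. -/
def DeletionCorrect (S : CDWE) : Prop :=
  ∃ ν : ℕ → ℝ, Negligible ν ∧
    ∀ (lam : ℕ) (ℓ X : List Bool) (b : Bool), 1 - ν lam ≤ S.delProb lam ℓ X b

/-- A quantum machine (for the value `lam` of the security parameter) with an advice state that
attacks certified deletion. It first runs `choose` on the advice and measures the name of a
language and a statement (two tapes) and two messages (the qubits `msg false` and `msg true`). It
then receives a ciphertext (a quantum register, and a tape with `ctCells` cells for the classical
string), runs `delete`, and measures the certificate. All its qubits form the residual register.
In the computational experiment it then receives the outcome of the verification in one more qubit,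
runs `distinguish`, and measures the qubit `result`. Ancillas are part of the advice. -/
structure Adversary (S : CDWE) (lam : ℕ) where
  work : ℕ
  advice : (Fin work → Bool) → ℂ
  advice_unit : ∑ s, ‖advice s‖ ^ 2 = 1
  choose : Circuit (Fin work)
  outCells : ℕ
  out : Fin 2 × Fin outCells × Bool → Fin work
  msg : Bool → Fin work
  ctCells : ℕ
  delete : Circuit (Fin work ⊕ (Fin (S.qubits lam) ⊕ (Fin ctCells × Bool)))
  cert : Fin (S.certLen lam) → Fin work ⊕ (Fin (S.qubits lam) ⊕ (Fin ctCells × Bool))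
  distinguish : Circuit ((Fin work ⊕ (Fin (S.qubits lam) ⊕ (Fin ctCells × Bool))) ⊕ Unit)
  result : (Fin work ⊕ (Fin (S.qubits lam) ⊕ (Fin ctCells × Bool))) ⊕ Unit

namespace Adversary

variable {S : CDWE} {lam : ℕ}

/-- Number of qubits and gates of the machine. -/
def size (A : Adversary S lam) : ℕ :=
  A.work + A.choose.length + A.outCells + A.ctCells + A.delete.length + A.distinguish.length

/-- The residual register. -/
abbrev Residual (A : Adversary S lam) : Type :=
  Fin A.work ⊕ (Fin (S.qubits lam) ⊕ (Fin A.ctCells × Bool))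

open Classical in
/-- The part common to both experiments, when `m_b` is encrypted: the unnormalised state of the
residual register on the event that the experiment is not aborted and the certificate is accepted
(`v = true`) or rejected (`v = false`). The experiment is aborted if the statement is in the
language. -/
def afterDeletion (A : Adversary S lam) (R : List Bool → List Bool → List Bool → Prop)
    (b v : Bool) : Op A.Residual :=
  ∑ z : (Fin 2 × Fin A.outCells × Bool) ⊕ Bool → Bool,
    let ℓ := readTape fun c => z (.inl (0, c))
    let X := readTape fun c => z (.inl (1, c))
    let m := z (.inr b)
    if inLanguage R ℓ X then 0
    else avg (S.encCoins lam ℓ X) fun r =>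
      let σ : Op A.Residual := A.delete.apply <|
        tensor (collapse (Sum.elim A.out A.msg) z (A.choose.apply (pureState A.advice)))
          (tensor (S.encState lam ℓ X m r)
            (basisState (writeTape A.ctCells (S.encCt lam ℓ X m r))))
      ∑ y : Fin (S.certLen lam) → Bool,
        if S.ver lam (S.encVk lam ℓ X m r) y = v then collapse A.cert y σ else 0

/-- The experiment `EV-EXP(b)`: output the residual register if the certificate is accepted, and
`⊥` otherwise (also if the experiment is aborted). -/
def evExp (A : Adversary S lam) (R : List Bool → List Bool → List Bool → Prop) (b : Bool) :
    Matrix (Option (A.Residual → Bool)) (Option (A.Residual → Bool)) ℂ :=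
  withBot (A.afterDeletion R b true)

/-- The probability that the experiment `C-EXP(b)` outputs `1`: the machine continues with the
residual register and the outcome of the verification. -/
def cProb (A : Adversary S lam) (R : List Bool → List Bool → List Bool → Prop) (b : Bool) : ℝ :=
  ∑ v : Bool, probOne A.result (A.distinguish.apply
    (tensor (A.afterDeletion R b v) (basisState fun _ : Unit => v)))

end Adversary

/-- Certified deletion security against non-uniform quantum polynomial-time adversaries. -/
def CertifiedDeletionSecure (S : CDWE) (R : List Bool → List Bool → List Bool → Prop) : Prop :=
  ∀ A : (lam : ℕ) → Adversary S lam, PolyBounded (fun lam => (A lam).size) →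
    Negligible (fun lam => traceDist ((A lam).evExp R false) ((A lam).evExp R true)) ∧
    Negligible fun lam => |(A lam).cProb R false - (A lam).cProb R true|

/-- Witness encryption with certified deletion for the languages given by `R`. -/
structure IsCDWE (S : CDWE) (R : List Bool → List Bool → List Bool → Prop) : Prop where
  qpt : S.IsQPT
  correct : S.Correct R
  deletionCorrect : S.DeletionCorrect
  secure : S.CertifiedDeletionSecure R

end CDWE

/-! ### The compiler -/

/-- The parity of the bits `x i` with `θ i = 0`. -/
def mask {n : ℕ} (x θ : Fin n → Bool) : Bool :=
  (Finset.univ.filter fun i => θ i = false ∧ x i = true).card.bodd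

/-- The circuit that applies `H` to the qubits `i` with `θ i = 1`. -/
def basisChange {n : ℕ} (θ : Fin n → Bool) : Circuit (Fin n) :=
  ((List.finRange n).filter fun i => θ i).map Gate.H

/-- The circuit that prepares the state `|x⟩_θ` from `|0…0⟩`. -/
def prepareBB84 {n : ℕ} (x θ : Fin n → Bool) : Circuit (Fin n) :=
  ((List.finRange n).filter fun i => x i).map Gate.X ++ basisChange θ

/-- The `n` bits of the string `l` from position `k` on. -/
def segment (n k : ℕ) (l : List Bool) : Fin n → Bool := fun i => l.getD (k + i) false

/-- Parse a decrypted message as a pair `(θ, b')`. -/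
def parsePair (n : ℕ) (m : Option (List Bool)) : Option ((Fin n → Bool) × Bool) :=
  m.bind fun l => if l.length = n + 1 then some (segment n 0 l, l.getD n false) else none

/-- The scheme `CD-WE` built from a witness encryption scheme. The coins are `x`, `θ` and the coins
of the underlying encryption. -/
def compile (E : WE) : CDWE where
  qubits lam := lam
  certLen lam := lam
  encCoins lam ℓ X := lam + lam + E.encCoins lam ℓ X (lam + 1)
  encVk lam _ _ _ r := List.ofFn (segment lam 0 r) ++ List.ofFn (segment lam lam r)
  encCt lam ℓ X b r :=
    let x := segment lam 0 r
    let θ := segment lam lam r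
    E.enc lam ℓ X (List.ofFn θ ++ [b ^^ mask x θ]) (r.drop (lam + lam))
  encPrep lam _ _ _ r := prepareBB84 (segment lam 0 r) (segment lam lam r)
  decCoins := E.decCoins
  decPrep lam W ct r :=
    match parsePair lam (E.dec lam W ct r) with
    | some (θ, _) => basisChange θ
    | none => []
  decOut lam W ct r y :=
    match parsePair lam (E.dec lam W ct r) with
    | some (θ, b') => some (b' ^^ mask y θ)
    | none => none
  delPrep _ _ := basisChange fun _ => true
  delOut _ _ y := y
  ver lam vk cert :=
    let x := segment lam 0 vk
    let θ := segment lam lam vk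
    decide (∀ i, θ i = true → x i = cert i)

end CertDel

end

/-! Security is the content of the theorem; it rests on one consequence of semantic security and one
computation with Pauli operators.

Replacing the message. Fix the quantum part of the ciphertext, the string `keyMsg θ c` that is
encrypted, and an efficiently decidable test of the certificate. Encrypting zeros instead changes
the probability of the result `1` negligibly, and uniformly in all these choices
(`exists_gameProb_bound`). The reduction gets the quantum part and the constants as advice; since
adversaries are non-uniform, the worst choice for every security parameter can be hardwired, which
gives the uniformity (`exists_negligible_bound`). Two features of the machine model need care. After
the ciphertext has arrived, the machine only runs a unitary circuit and measures one qubit, so the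
test is done coherently: a finite automaton, written as a reversible circuit, reads the certificate
(`run_autCircuit`), and its garbage, which determines the certificate, takes the place of the
measurement (`probVec_sum_tensVec`). And the machine outputs its messages by measuring fixed qubits,
so it cannot compute them from the bit chosen by the attack. This bit is therefore fixed to a guess
`μ`, and for the other value the two messages get different lengths, so that the experiment aborts
(`redSrc`, `prob_reduction`). Summing over `μ` recovers the whole experiment.

The computational experiment. The attack learns only one bit about the verification key, and the
reduction can compute it, for `x` and `θ` are among its constants. Once zeros are encrypted, nothing
depends on the challenge bit (`cExp_secure`).

The residual state. Take the encrypted bit `c = m ⊕ mask` as the variable. For fixed `θ`, `c`, coins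
and certificate `y`, the message then enters only as a sign, and the difference of the two states
is, up to this sign, the image of the sum of `(-1)^mask |x⟩⟨x|_θ` over the `x` that agree with `y`
on `θ = 1`. On a qubit with `θ = 0` this sum is the Pauli operator `Z = |+⟩⟨-| + |-⟩⟨+|`. In the
Hadamard basis it becomes a sum of operators `|v⟩⟨v'|`, where `v'` is `v` flipped on all positions
with `θ = 0` (`sum_masked_pureState`). The trace norm of the image of such a term is at most the
product of two norms, whose squares are the probabilities of `y` when the register holds `v` or `v'`
in the Hadamard basis. As `v` and `v'` are complementary on `θ = 0`, one of them disagrees with `y`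
on at least half of these positions while agreeing on `θ = 1` (`certTest_threshold_or`).

The total probability of this bad event is small: after the message is replaced, the certificate is
independent of `θ`, and for given `v` and `y` at most a fraction `(5/6)^λ` of all `θ` is bad
(`sum_certTest_threshold_le`). The weighted inequality of the means turns a bad probability of at
most `η` into a trace distance of at most `4√η` (`evExp_secure`).

Efficiency is proved by assembling stack programs around the given ones for the underlying scheme.
Decryption errs only if the underlying decryption errs, and honest certificates are always accepted.
-/

noncomputable section
namespace CertDel

/-! ### Stores given by lists -/

/-- The store whose first registers are given by a list, followed by the registers of `s`. -/
def cat : List (List Bool) → Store → Store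
  | [], s => s
  | x :: L, s => fun i => match i with
    | 0 => x
    | i + 1 => cat L s i

/-- The store with all registers empty. -/
def emptyStore : Store := fun _ => []

theorem cat_append (L M : List (List Bool)) (s : Store) : cat (L ++ M) s = cat L (cat M s) := by
  induction L with
  | nil => rfl
  | cons x L ih => funext i; cases i <;> simp [cat, ih]

theorem cat_of_lt {L : List (List Bool)} {s : Store} {i : ℕ} (h : i < L.length) :
    cat L s i = L.getD i [] := by
  induction L generalizing i with
  | nil => simp at h
  | cons x L ih =>
    cases i with
    | zero => simp [cat]
    | succ i => simpa [cat] using ih (by simpa using h)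

theorem cat_add (L : List (List Bool)) (s : Store) (i : ℕ) : cat L s (L.length + i) = s i := by
  induction L with
  | nil => simp [cat]
  | cons x L ih =>
    rw [List.length_cons, Nat.add_right_comm]
    exact ih

theorem update_cat {L : List (List Bool)} {s : Store} {i : ℕ} {v : List Bool}
    (h : i < L.length) : Function.update (cat L s) i v = cat (L.set i v) s := by
  induction L generalizing i with
  | nil => simp at h
  | cons x L ih =>
    cases i with
    | zero => funext j; cases j <;> simp [cat]
    | succ i =>
      have h' : i < L.length := by simpa using h
      funext j
      cases j with
      | zero => simp [cat]
      | succ j =>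
        have := congrFun (ih h') j
        simp only [Function.update_apply, List.set_cons_succ, cat, Nat.add_right_cancel_iff]
          at this ⊢
        exact this

theorem cat_replicate_empty (n : ℕ) : cat (List.replicate n []) emptyStore = emptyStore := by
  induction n with
  | zero => rfl
  | succ n ih =>
    funext i
    cases i
    · rfl
    · simp [List.replicate_succ, cat, ih]; rfl

theorem getD_eq_cat (L : List (List Bool)) : (fun i => L.getD i []) = cat L emptyStore := by
  induction L with
  | nil => funext i; simp [cat, emptyStore]
  | cons x L ih =>
    funext i
    cases i with
    | zero => simp [cat]
    | succ i => simpa [cat] using congrFun ih i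

theorem eq_cat_of_forall {L : List (List Bool)} {s : Store}
    (h : ∀ i < L.length, s i = L.getD i []) : s = cat L (fun i => s (L.length + i)) := by
  funext i
  by_cases hi : i < L.length
  · rw [cat_of_lt hi, h i hi]
  · obtain ⟨j, rfl⟩ := Nat.exists_eq_add_of_le (not_lt.mp hi)
    rw [cat_add]

/-! ### Running programs -/

/-- The program that does nothing. -/
def Prog.skip : Prog := .seq (.push true 0) (.pop 0)

theorem Run.skip (s : Store) : Run .skip s s 2 := by
  have h := Run.seq (Run.push true 0 s) (Run.pop 0 _)
  simpa [Prog.skip] using h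

/-- A step adds at most one bit, so time bounds also bound the lengths of outputs, as is needed when
these are processed further. -/
theorem Run.length_le {p : Prog} {s s' : Store} {t : ℕ} (h : Run p s s' t) (i : ℕ) :
    (s' i).length ≤ (s i).length + t := by
  induction h with
  | push b r s => by_cases hi : i = r <;> simp [hi]
  | pop r s => by_cases hi : i = r <;> simp [hi]; omega
  | seq _ _ h₁ h₂ => omega
  | branchNil _ _ h => omega
  | branchFalse _ _ h => omega
  | branchTrue _ _ h => omega
  | loopDone _ => omega
  | loopStep _ _ _ h₁ h₂ => omega

/-- The program with all registers shifted by `k`. -/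
def Prog.shift (k : ℕ) : Prog → Prog
  | .push b r => .push b (k + r)
  | .pop r => .pop (k + r)
  | .seq p q => .seq (p.shift k) (q.shift k)
  | .branch r p q u => .branch (k + r) (p.shift k) (q.shift k) (u.shift k)
  | .loop r p => .loop (k + r) (p.shift k)

theorem update_cat_add (L : List (List Bool)) (s : Store) (i : ℕ) (v : List Bool) :
    Function.update (cat L s) (L.length + i) v = cat L (Function.update s i v) := by
  funext j
  by_cases hj : j < L.length
  · rw [Function.update_of_ne (by omega), cat_of_lt hj, cat_of_lt hj]
  · obtain ⟨j, rfl⟩ := Nat.exists_eq_add_of_le (not_lt.mp hj)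
    simp [Function.update_apply, cat_add]

/-- A shifted program never touches the registers in `L`. This allows a program about which nothing
is known to be called as a subroutine without losing the caller's data. -/
theorem Run.shift {p : Prog} {s s' : Store} {t : ℕ} (h : Run p s s' t) (L : List (List Bool)) :
    Run (p.shift L.length) (cat L s) (cat L s') t := by
  induction h with
  | push b r s =>
    have := Run.push b (L.length + r) (cat L s)
    rwa [update_cat_add, cat_add] at this
  | pop r s =>
    have := Run.pop (L.length + r) (cat L s)
    rwa [update_cat_add, cat_add] at this
  | seq _ _ h₁ h₂ => exact .seq h₁ h₂
  | branchNil hr _ h => exact .branchNil (by rw [cat_add, hr]) h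
  | branchFalse hr _ h => exact .branchFalse (by rw [cat_add, hr]) h
  | branchTrue hr _ h => exact .branchTrue (by rw [cat_add, hr]) h
  | loopDone hr => exact .loopDone (by rw [cat_add, hr])
  | loopStep hr _ _ h₁ h₂ => exact .loopStep (by rwa [cat_add]) h₁ h₂

/-- Pop the bits of register `r` one after the other, and run `p b` for every bit `b`. -/
def Prog.forEach (r : ℕ) (p : Bool → Prog) : Prog :=
  .loop r (.branch r .skip (.seq (.pop r) (p false)) (.seq (.pop r) (p true)))

/-- By `hr` the body leaves register `r` alone, so the loop reads exactly the original string. The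
invariant `I` is what the body needs for its effect `F` and its cost bound `B`; the extra `3` pays
for the loop test, the branch and the pop. -/
theorem Run.forEach {r : ℕ} {p : Bool → Prog} {F : Bool → Store → Store} {I : Store → Prop}
    {B : ℕ} (hI : ∀ s l b, I s → I (F b (Function.update s r l)))
    (hr : ∀ s b, F b s r = s r)
    (hp : ∀ s l b, I s → ∃ t ≤ B,
      Run (p b) (Function.update s r l) (F b (Function.update s r l)) t)
    (l : List Bool) (s : Store) (hl : s r = l) (hs : I s) :
    ∃ t ≤ (B + 3) * l.length + 1, Run (.forEach r p) s
      (l.foldl (fun s b => F b (Function.update s r (s r).tail)) s) t := by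
  induction l generalizing s with
  | nil => exact ⟨1, by simp, .loopDone hl⟩
  | cons b l ih =>
    have htail : (s r).tail = l := by rw [hl]; rfl
    obtain ⟨t₁, ht₁, h₁⟩ := hp s l b hs
    obtain ⟨t₂, ht₂, h₂⟩ := ih (F b (Function.update s r l)) (by rw [hr]; simp) (hI _ _ _ hs)
    have h₀ := Run.pop r s
    rw [htail] at h₀
    refine ⟨(1 + t₁) + 1 + t₂ + 1, ?_, ?_⟩
    · rw [List.length_cons, Nat.mul_succ]; omega
    · rw [List.foldl_cons, htail]
      refine .loopStep (by rw [hl]; simp) ?_ h₂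
      cases b
      · exact .branchFalse hl (.seq h₀ h₁)
      · exact .branchTrue hl (.seq h₀ h₁)

/-- The store in which the string `w` is put on top of the registers in `ds`. -/
def pushes (ds : List ℕ) (w : List Bool) (s : Store) : Store :=
  fun i => if i ∈ ds then w ++ s i else s i

theorem pushes_nil (w : List Bool) (s : Store) : pushes [] w s = s := by
  funext i; simp [pushes]

theorem pushes_cons {d : ℕ} {ds : List ℕ} (h : d ∉ ds) (w : List Bool) (s : Store) :
    pushes (d :: ds) w s = pushes ds w (Function.update s d (w ++ s d)) := by
  funext i
  by_cases hi : i = d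
  · subst hi; simp [pushes, h]
  · simp [pushes, hi]

/-- Push the bit `b` on all registers in `ds`. -/
def Prog.pushAll (b : Bool) : List ℕ → Prog
  | [] => .skip
  | d :: ds => .seq (.push b d) (Prog.pushAll b ds)

theorem Run.pushAll (b : Bool) {ds : List ℕ} (h : ds.Nodup) (s : Store) :
    Run (.pushAll b ds) s (pushes ds [b] s) (ds.length + 2) := by
  induction ds generalizing s with
  | nil => rw [pushes_nil]; exact .skip s
  | cons d ds ih =>
    rw [List.nodup_cons] at h
    rw [pushes_cons h.1, List.length_cons, Nat.add_right_comm, Nat.add_comm _ 1]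
    exact .seq (.push b d s) (ih h.2 _)

/-- Move the contents of register `r`, reversed, to the top of all registers in `ds`. -/
def Prog.drain (r : ℕ) (ds : List ℕ) : Prog := .forEach r fun b => .pushAll b ds

/-- Emptying one stack onto others reverses the string. So two drains move a string in its own
order, one is enough for a unary string, and several targets give copies. -/
theorem Run.drain {r : ℕ} {ds : List ℕ} (h : ds.Nodup) (hr : r ∉ ds) (s : Store) :
    ∃ t ≤ (ds.length + 5) * (s r).length + 1, Run (.drain r ds) s
      (Function.update (pushes ds (s r).reverse s) r []) t := by
  have key := Run.forEach (r := r) (p := fun b => .pushAll b ds) (F := fun b => pushes ds [b])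
    (I := fun _ => True) (B := ds.length + 2) (fun _ _ _ _ => trivial)
    (fun s b => by simp [pushes, hr])
    (fun s l b _ => ⟨_, le_rfl, Run.pushAll b h _⟩) (s r) s rfl trivial
  have : ∀ (l : List Bool) (s : Store), s r = l →
      l.foldl (fun s b => pushes ds [b] (Function.update s r (s r).tail)) s =
        Function.update (pushes ds l.reverse s) r [] := by
    intro l
    induction l with
    | nil =>
      intro s hl
      funext i
      by_cases hi : i = r
      · subst hi; simp [hl]
      · simp [pushes, hi]
    | cons b l ih =>
      intro s hl
      rw [List.foldl_cons, ih _ (by simp [pushes, hr, hl])]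
      funext i
      by_cases hi : i = r
      · subst hi; simp
      · by_cases hd : i ∈ ds <;> simp [pushes, hi, hd]
  rw [this _ s rfl] at key
  exact key

/-- The first `n` bits of a string, padded with `false`. -/
def padTake : ℕ → List Bool → List Bool
  | 0, _ => []
  | n + 1, l => l.headD false :: padTake n l.tail

/-- Pop as many bits from register `r` as the register `u` has, and push them on `d`. -/
def Prog.take (u r d : ℕ) : Prog :=
  .forEach u fun _ => .branch r (.push false d) (.seq (.pop r) (.push false d))
    (.seq (.pop r) (.push true d))

/-- An exhausted register `r` delivers `false`. This matches the default value in `segment`, so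
strings that are too short are treated as in `compile`. -/
theorem Run.take {u r d : ℕ} (hur : u ≠ r) (hud : u ≠ d) (hrd : r ≠ d) (s : Store) :
    ∃ t ≤ 6 * (s u).length + 1, Run (.take u r d) s
      (Function.update (Function.update (Function.update s u []) r ((s r).drop (s u).length)) d
        ((padTake (s u).length (s r)).reverse ++ s d)) t := by
  have key := Run.forEach (r := u)
    (p := fun _ => .branch r (.push false d) (.seq (.pop r) (.push false d))
      (.seq (.pop r) (.push true d)))
    (F := fun _ s => Function.update (Function.update s r (s r).tail) d
      ((s r).headD false :: s d))
    (I := fun _ => True) (B := 3) (fun _ _ _ _ => trivial)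
    (fun s b => by simp [hur, hud])
    (fun s l b _ => by
      set s' := Function.update s u l
      rcases h : s' r with _ | ⟨_ | _, l'⟩
      · refine ⟨2, by omega, .branchNil h ?_⟩
        have := Run.push false d s'
        convert this using 1
        congr 1
        funext i; by_cases hi : i = r <;> simp [hi, h]
      · refine ⟨3, by omega, .branchFalse h ?_⟩
        have := Run.seq (Run.pop r s') (Run.push false d _)
        simpa [h, hrd.symm] using this
      · refine ⟨3, by omega, .branchTrue h ?_⟩
        have := Run.seq (Run.pop r s') (Run.push true d _)
        simpa [h, hrd.symm] using this)
    (s u) s rfl trivial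
  have : ∀ (l : List Bool) (s : Store), s u = l →
      l.foldl (fun s _ => Function.update (Function.update (Function.update s u (s u).tail) r
          ((Function.update s u (s u).tail) r).tail) d
        (((Function.update s u (s u).tail) r).headD false ::
          (Function.update s u (s u).tail) d)) s =
        Function.update (Function.update (Function.update s u []) r ((s r).drop l.length)) d
          ((padTake l.length (s r)).reverse ++ s d) := by
    intro l
    induction l with
    | nil =>
      intro s hl
      funext i
      simp only [Function.update_apply, List.foldl_nil, padTake, List.length_nil, List.drop_zero,
        List.reverse_nil, List.nil_append]
      split_ifs with h₁ h₂ h₃ <;> simp [*]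
    | cons b l ih =>
      intro s hl
      rw [List.foldl_cons, ih _ (by simp [hur, hud, hl])]
      funext i
      have h₁ := hur.symm
      have h₂ := hud.symm
      simp only [Function.update_apply, hrd, h₁, h₂, hrd.symm, if_false, if_true,
        List.length_cons, padTake, List.reverse_cons, List.append_assoc, List.singleton_append,
        List.drop_tail]
      split_ifs <;> rfl
  rw [this _ s rfl] at key
  exact key

/-! ### Families of runs in polynomial time -/

section
variable {α : Type} {sz : α → ℕ} {C : α → Prop}

/-- The function `f` is bounded by a polynomial in `sz` where `C` holds. -/
def PolyIn (sz : α → ℕ) (C : α → Prop) (f : α → ℕ) : Prop :=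
  ∃ P : Polynomial ℕ, ∀ a, C a → f a ≤ P.eval (sz a)

theorem PolyIn.of_le {f g : α → ℕ} (hg : PolyIn sz C g) (h : ∀ a, C a → f a ≤ g a) :
    PolyIn sz C f :=
  hg.imp fun _ hP a ha => (h a ha).trans (hP a ha)

theorem PolyIn.const (n : ℕ) : PolyIn sz C fun _ => n := ⟨Polynomial.C n, by simp⟩

theorem PolyIn.size : PolyIn sz C sz := ⟨Polynomial.X, by simp⟩

theorem PolyIn.add {f g : α → ℕ} (hf : PolyIn sz C f) (hg : PolyIn sz C g) :
    PolyIn sz C fun a => f a + g a := by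
  obtain ⟨P, hP⟩ := hf
  obtain ⟨Q, hQ⟩ := hg
  exact ⟨P + Q, fun a ha => by simpa using add_le_add (hP a ha) (hQ a ha)⟩

theorem PolyIn.mul {f g : α → ℕ} (hf : PolyIn sz C f) (hg : PolyIn sz C g) :
    PolyIn sz C fun a => f a * g a := by
  obtain ⟨P, hP⟩ := hf
  obtain ⟨Q, hQ⟩ := hg
  exact ⟨P * Q, fun a ha => by simpa using Nat.mul_le_mul (hP a ha) (hQ a ha)⟩

theorem PolyIn.mono {C' : α → Prop} {f : α → ℕ} (hf : PolyIn sz C f) (h : ∀ a, C' a → C a) :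
    PolyIn sz C' f :=
  hf.imp fun _ hP a ha => hP a (h a ha)

/-- The coefficients are natural numbers, so every polynomial is monotone and time bounds may be
composed. -/
theorem eval_monotone (P : Polynomial ℕ) : Monotone fun n : ℕ => P.eval n := by
  intro m n h
  simp only [Polynomial.eval_eq_sum_range]
  exact Finset.sum_le_sum fun i _ => Nat.mul_le_mul_left _ (Nat.pow_le_pow_left h i)

theorem PolyIn.eval {f : α → ℕ} (hf : PolyIn sz C f) (P : Polynomial ℕ) :
    PolyIn sz C fun a => P.eval (f a) := by
  obtain ⟨Q, hQ⟩ := hf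
  exact ⟨P.comp Q, fun a ha => by
    simpa [Polynomial.eval_comp] using eval_monotone P (hQ a ha)⟩

/-- The program `p` runs from `S a` to `S' a` in time polynomial in `sz a`, where `C a` holds. -/
def Exec (sz : α → ℕ) (C : α → Prop) (p : Prog) (S S' : α → Store) : Prop :=
  ∃ T : α → ℕ, PolyIn sz C T ∧ ∀ a, C a → ∃ t ≤ T a, Run p (S a) (S' a) t

theorem Exec.seq {p q : Prog} {S₁ S₂ S₃ : α → Store} (hp : Exec sz C p S₁ S₂)
    (hq : Exec sz C q S₂ S₃) : Exec sz C (.seq p q) S₁ S₃ := by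
  obtain ⟨T, hT, h⟩ := hp
  obtain ⟨T', hT', h'⟩ := hq
  refine ⟨_, hT.add hT', fun a ha => ?_⟩
  obtain ⟨t, ht, hr⟩ := h a ha
  obtain ⟨t', ht', hr'⟩ := h' a ha
  exact ⟨_, add_le_add ht ht', .seq hr hr'⟩

theorem Exec.congr {p : Prog} {S S' S'' : α → Store} (hp : Exec sz C p S S')
    (h : ∀ a, C a → S' a = S'' a) : Exec sz C p S S'' := by
  obtain ⟨T, hT, hr⟩ := hp
  exact ⟨T, hT, fun a ha => h a ha ▸ hr a ha⟩

theorem Exec.skip (S : α → Store) : Exec sz C .skip S S :=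
  ⟨_, .const 2, fun _ _ => ⟨2, le_rfl, .skip _⟩⟩

theorem Exec.push (b : Bool) (r : ℕ) (S : α → Store) :
    Exec sz C (.push b r) S fun a => Function.update (S a) r (b :: S a r) :=
  ⟨_, .const 1, fun _ _ => ⟨1, le_rfl, .push _ _ _⟩⟩

theorem Exec.pop (r : ℕ) (S : α → Store) :
    Exec sz C (.pop r) S fun a => Function.update (S a) r (S a r).tail :=
  ⟨_, .const 1, fun _ _ => ⟨1, le_rfl, .pop _ _⟩⟩

/-- Each branch has a bound that is valid only on its own inputs; the sum of the three polynomials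
serves for all. -/
theorem Exec.branch {r : ℕ} {p q u : Prog} {S S' : α → Store}
    (hp : Exec sz (fun a => C a ∧ S a r = []) p S S')
    (hq : Exec sz (fun a => C a ∧ ∃ l, S a r = false :: l) q S S')
    (hu : Exec sz (fun a => C a ∧ ∃ l, S a r = true :: l) u S S') :
    Exec sz C (.branch r p q u) S S' := by
  obtain ⟨T₁, ⟨P₁, hP₁⟩, h₁⟩ := hp
  obtain ⟨T₂, ⟨P₂, hP₂⟩, h₂⟩ := hq
  obtain ⟨T₃, ⟨P₃, hP₃⟩, h₃⟩ := hu
  refine ⟨fun a => (P₁ + P₂ + P₃ + 1).eval (sz a), ⟨_, fun a _ => le_rfl⟩, fun a ha => ?_⟩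
  simp only [Polynomial.eval_add, Polynomial.eval_one]
  rcases h : S a r with _ | ⟨_ | _, l⟩
  · obtain ⟨t, ht, hr⟩ := h₁ a ⟨ha, h⟩
    have := hP₁ a ⟨ha, h⟩
    exact ⟨t + 1, by omega, .branchNil h hr⟩
  · obtain ⟨t, ht, hr⟩ := h₂ a ⟨ha, _, h⟩
    have := hP₂ a ⟨ha, _, h⟩
    exact ⟨t + 1, by omega, .branchFalse h hr⟩
  · obtain ⟨t, ht, hr⟩ := h₃ a ⟨ha, _, h⟩
    have := hP₃ a ⟨ha, _, h⟩
    exact ⟨t + 1, by omega, .branchTrue h hr⟩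

theorem Exec.drain {r : ℕ} {ds : List ℕ} (h : ds.Nodup) (hr : r ∉ ds) (S : α → Store)
    (hS : PolyIn sz C fun a => (S a r).length) :
    Exec sz C (.drain r ds) S
      fun a => Function.update (pushes ds (S a r).reverse (S a)) r [] :=
  ⟨_, ((PolyIn.const _).mul hS).add (.const 1), fun a _ => Run.drain h hr (S a)⟩

theorem Exec.take {u r d : ℕ} (hur : u ≠ r) (hud : u ≠ d) (hrd : r ≠ d) (S : α → Store)
    (hS : PolyIn sz C fun a => (S a u).length) :
    Exec sz C (.take u r d) S fun a =>
      Function.update (Function.update (Function.update (S a) u []) r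
        ((S a r).drop (S a u).length)) d ((padTake (S a u).length (S a r)).reverse ++ S a d) :=
  ⟨_, ((PolyIn.const _).mul hS).add (.const 1), fun a _ => Run.take hur hud hrd (S a)⟩

/-- The subroutine call. The program is chosen before the family of inputs, hence is uniform. Above
its arguments all registers have to be empty, because the hypothesis speaks only of such stores;
data that must survive lie in the `k` registers below. Afterwards the registers above the outputs
have unknown contents `s`. -/
theorem ComputesInPolyTime.exec {β : Type} {input output : β → List (List Bool)}
    (h : ComputesInPolyTime input output) (k : ℕ) : ∃ p : Prog,
    ∀ {α : Type} {sz : α → ℕ} {C : α → Prop} (g : α → β) (L : α → List (List Bool)),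
      (∀ a, (L a).length = k) →
      (PolyIn sz C fun a => ((input (g a)).map List.length).sum) →
      ∃ s : α → Store,
        Exec sz C p (fun a => cat (L a ++ input (g a)) emptyStore)
          (fun a => cat (L a ++ output (g a)) (s a)) ∧
        ∀ i, PolyIn sz C fun a => ((output (g a)).getD i []).length := by
  obtain ⟨p, P, h⟩ := h
  choose s t hrun hout ht using h
  refine ⟨p.shift k, fun g L hL hsz => ⟨fun a i => s (g a) ((output (g a)).length + i),
    ⟨fun a => t (g a), (hsz.eval P).of_le fun a _ => ht _, fun a _ => ⟨_, le_rfl, ?_⟩⟩,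
    fun i => (hsz.add (hsz.eval P)).of_le fun a _ => ?_⟩⟩
  · have := (hrun (g a)).shift (L a)
    rw [hL, getD_eq_cat, ← cat_append, eq_cat_of_forall (hout (g a)), ← cat_append] at this
    exact this
  · by_cases hi : i < (output (g a)).length
    · rw [← hout _ i hi]
      refine ((hrun (g a)).length_le i).trans (add_le_add ?_ (ht _))
      by_cases hj : i < (input (g a)).length
      · rw [List.getD_eq_getElem _ _ hj]
        exact List.le_sum_of_mem (List.mem_map_of_mem (List.getElem_mem hj))
      · rw [List.getD_eq_default _ _ (not_lt.mp hj)]; simp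
    · rw [List.getD_eq_default _ _ (not_lt.mp hi)]; simp

theorem Exec.computesInPolyTime {input output : α → List (List Bool)} {p : Prog}
    {S : α → Store} (n : ℕ)
    (h : Exec (fun a => ((input a).map List.length).sum) (fun _ => True) p
      (fun a => cat (input a ++ List.replicate n []) emptyStore) S)
    (hS : ∀ a, ∀ i < (output a).length, S a i = (output a).getD i []) :
    ComputesInPolyTime input output := by
  obtain ⟨T, ⟨P, hP⟩, hr⟩ := h
  refine ⟨p, P, fun a => ?_⟩
  obtain ⟨t, ht, hrun⟩ := hr a trivial
  simp only [cat_append, cat_replicate_empty] at hrun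
  rw [← getD_eq_cat] at hrun
  exact ⟨_, t, hrun, hS a, ht.trans (hP a trivial)⟩

end

/-! ### Routines of the compiler -/

/-- The parity of the bits of `x` at the positions where `l` is `false`. -/
def parityOff : List Bool → List Bool → Bool
  | [], _ => false
  | b :: l, x => (!b && x.headD false) ^^ parityOff l x.tail

/-- Flip the bit in register `p` if register `x` has a `true` where register `u` has a `false`. -/
def Prog.parity (u x p : ℕ) : Prog :=
  .forEach u fun b =>
    if b then .pop x else
      .branch x (.pop x) (.pop x)
        (.seq (.pop x) (.branch p .skip (.seq (.pop p) (.push true p))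
          (.seq (.pop p) (.push false p))))

theorem Run.parity {u x p : ℕ} (hux : u ≠ x) (hup : u ≠ p) (hxp : x ≠ p) (s : Store) (b₀ : Bool)
    (hs : s p = [b₀]) :
    ∃ t ≤ 8 * (s u).length + 1, Run (.parity u x p) s
      (Function.update (Function.update (Function.update s u []) x ((s x).drop (s u).length)) p
        [b₀ ^^ parityOff (s u) (s x)]) t := by
  have key := Run.forEach (r := u)
    (p := fun b => if b then .pop x else
      .branch x (.pop x) (.pop x)
        (.seq (.pop x) (.branch p .skip (.seq (.pop p) (.push true p))
          (.seq (.pop p) (.push false p)))))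
    (F := fun b s => Function.update (Function.update s x (s x).tail) p
      [(s p).headD false ^^ (!b && (s x).headD false)])
    (I := fun s => ∃ b, s p = [b]) (B := 5)
    (fun _ _ _ _ => by simp)
    (fun s b => by simp [hux, hup])
    (fun s l b hp => by
      obtain ⟨c, hc⟩ := hp
      replace hc : Function.update s u l p = [c] := by simp [hup.symm, hc]
      generalize Function.update s u l = s' at hc ⊢
      -- In the cases without a flip the program does not touch `p`, whereas `F` writes the old
      -- value back.
      have hupd : Function.update (Function.update s' x (s' x).tail) p [c] =
          Function.update s' x (s' x).tail := by
        funext i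
        by_cases hi : i = p
        · subst hi; simp [hxp.symm, hc]
        · simp [hi]
      cases b with
      | true =>
        refine ⟨1, by omega, ?_⟩
        have := Run.pop x s'
        simpa [hc, hupd] using this
      | false =>
        rcases h : s' x with _ | ⟨_ | _, l'⟩
        · refine ⟨2, by omega, .branchNil h ?_⟩
          have := Run.pop x s'
          rw [h] at hupd this
          simp only [List.tail_nil] at hupd this
          simp only [hc, hupd, List.tail_nil, List.headD_cons, List.headD_nil,
            Bool.and_false, Bool.xor_false]
          exact this
        · refine ⟨2, by omega, .branchFalse h ?_⟩
          have := Run.pop x s'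
          rw [h] at hupd this
          simp only [List.tail_cons] at hupd this
          simp only [hc, hupd, List.tail_cons, List.headD_cons, Bool.and_false, Bool.xor_false]
          exact this
        · refine ⟨5, by omega, .branchTrue h ?_⟩
          have h₀ := Run.pop x s'
          have h₁ := Run.seq (Run.pop p (Function.update s' x (s' x).tail)) (Run.push (!c) p _)
          simp only [h, List.tail_cons, Function.update_of_ne hxp.symm, hc,
            Function.update_self, Function.update_idem] at h₀ h₁
          simp only [hc, List.tail_cons, List.headD_cons, Bool.not_false, Bool.true_and,
            Bool.xor_true]
          refine .seq (t₂ := 3) h₀ ?_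
          cases c
          · exact .branchFalse (l := []) (by simp [hxp.symm, hc]) h₁
          · exact .branchTrue (l := []) (by simp [hxp.symm, hc]) h₁)
    (s u) s rfl ⟨b₀, hs⟩
  -- The accumulated parity `b₀` has to vary in the induction.
  have : ∀ (l : List Bool) (s : Store) (b₀ : Bool), s u = l → s p = [b₀] →
      l.foldl (fun s b => Function.update (Function.update (Function.update s u (s u).tail) x
          ((Function.update s u (s u).tail) x).tail) p
        [((Function.update s u (s u).tail) p).headD false ^^
          (!b && ((Function.update s u (s u).tail) x).headD false)]) s =
        Function.update (Function.update (Function.update s u []) x ((s x).drop l.length)) p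
          [b₀ ^^ parityOff l (s x)] := by
    intro l
    induction l with
    | nil =>
      intro s b₀ hl hp
      funext i
      simp only [Function.update_apply, List.foldl_nil, parityOff, List.length_nil,
        List.drop_zero, Bool.xor_false]
      split_ifs with h₁ h₂ h₃ <;> simp [*]
    | cons b l ih =>
      intro s b₀ hl hp
      rw [List.foldl_cons, ih _ (b₀ ^^ (!b && (s x).headD false)) (by simp [hux, hup, hl])
        (by simp [hup.symm, hp, hux.symm])]
      funext i
      simp only [Function.update_apply, hxp, hux.symm, if_false, if_true,
        List.length_cons, parityOff, List.drop_tail, Bool.xor_assoc]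
      split_ifs <;> rfl
  rw [this _ s b₀ rfl hs] at key
  exact key

/-- The codes of one-qubit gates of one kind, applied to the qubits `n - 1, n - 2, …` for which the
bits of `l` are `true`, in the order of the labels. -/
def gateCodes (k₀ k₁ k₂ : Bool) : List Bool → ℕ → List Bool
  | [], _ => []
  | b :: l, n => gateCodes k₀ k₁ k₂ l (n - 1) ++
      (if b then [k₀, k₁, k₂] ++ unary (n - 1) ++ [false] else [])

/-- Push the codes of gates on the register `o`; the bits are read from register `u`, and register
`c` counts down the labels. -/
def Prog.gateCodes (k₀ k₁ k₂ : Bool) (u c o d : ℕ) : Prog :=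
  .forEach u fun b =>
    if b then
      .seq (.pop c) (.seq (.push false o) (.seq (.drain c [o, d]) (.seq (.drain d [c])
        (.seq (.push k₂ o) (.seq (.push k₁ o) (.push k₀ o))))))
    else .pop c

theorem length_unary (n : ℕ) : (unary n).length = n := by simp [unary]

theorem reverse_unary (n : ℕ) : (unary n).reverse = unary n := by simp [unary]

theorem tail_unary (n : ℕ) : (unary n).tail = unary (n - 1) := by simp [unary]

theorem unary_append (m n : ℕ) : unary m ++ unary n = unary (m + n) := by simp [unary]

/-- A stack is filled from the bottom, so the last gate is written first and every code from its
last bit to its first. Therefore the bits arrive in reverse order and the labels count down.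
Printing a label destroys the counter `c`, which is restored from its copy in `d`. -/
theorem Run.gateCodes (k₀ k₁ k₂ : Bool) {u c o d : ℕ} (h : [u, c, o, d].Nodup)
    (s : Store) (m : ℕ) (hc : s c = unary m) (hd : s d = []) :
    ∃ t ≤ (13 * m + 10) * (s u).length + 1, Run (.gateCodes k₀ k₁ k₂ u c o d) s
      (Function.update (Function.update (Function.update s u []) c (unary (m - (s u).length))) o
        (CertDel.gateCodes k₀ k₁ k₂ (s u) m ++ s o)) t := by
  simp only [List.nodup_cons, List.mem_cons, List.not_mem_nil, or_false, not_or,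
    List.nodup_nil, and_true, not_false_eq_true] at h
  obtain ⟨⟨huc, huo, hud⟩, ⟨hco, hcd⟩, hod⟩ := h
  have key := Run.forEach (r := u)
    (p := fun b => if b then
      .seq (.pop c) (.seq (.push false o) (.seq (.drain c [o, d]) (.seq (.drain d [c])
        (.seq (.push k₂ o) (.seq (.push k₁ o) (.push k₀ o))))))
      else .pop c)
    (F := fun b s => Function.update (Function.update s c (s c).tail) o
      (if b then [k₀, k₁, k₂] ++ (s c).tail ++ [false] ++ s o else s o))
    -- The drain to two targets costs `7` per bit, the drain back `6`; five single steps and the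
    -- ends of the two loops give the `7`.
    (I := fun s => (∃ n ≤ m, s c = unary n) ∧ s d = []) (B := 13 * m + 7)
    (fun s l b hI => by
      obtain ⟨⟨n, hn, hc⟩, hd⟩ := hI
      refine ⟨⟨n - 1, by omega, ?_⟩, ?_⟩
      · simp [hco, Ne.symm huc, hc, tail_unary]
      · simp [Ne.symm hcd, Ne.symm hod, Ne.symm hud, hd])
    (fun s b => by simp [huc, huo])
    (fun s l b hI => by
      obtain ⟨⟨n, hn, hc⟩, hd⟩ := hI
      replace hc : Function.update s u l c = unary n := by simp [Ne.symm huc, hc]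
      replace hd : Function.update s u l d = [] := by simp [Ne.symm hud, hd]
      generalize Function.update s u l = s' at hc hd ⊢
      cases b with
      | false =>
        refine ⟨1, by omega, ?_⟩
        have := Run.pop c s'
        have hupd : Function.update (Function.update s' c (s' c).tail) o (s' o) =
            Function.update s' c (s' c).tail := by
          funext i
          by_cases hi : i = o
          · subst hi; simp [Ne.symm hco]
          · simp [hi]
        simpa [hupd] using this
      | true =>
        have h₁ := Run.pop c s'
        rw [hc, tail_unary] at h₁
        have h₂ := Run.push false o (Function.update s' c (unary (n - 1)))
        obtain ⟨t₃, ht₃, h₃⟩ := Run.drain (r := c) (ds := [o, d]) (by simp [hod])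
          (by simp [hco, hcd]) (Function.update (Function.update s' c (unary (n - 1))) o
            (false :: Function.update s' c (unary (n - 1)) o))
        obtain ⟨t₄, ht₄, h₄⟩ := Run.drain (r := d) (ds := [c]) (by simp)
          (by simp [Ne.symm hcd]) (Function.update s' o (unary (n - 1) ++ false :: s' o) |>
            fun s => Function.update (Function.update s d (unary (n - 1))) c [])
        have h₅ := Run.push k₂ o (Function.update (Function.update s' c (unary (n - 1))) o
            (unary (n - 1) ++ false :: s' o))
        have h₆ := Run.push k₁ o (Function.update (Function.update s' c (unary (n - 1))) o
            (k₂ :: (unary (n - 1) ++ false :: s' o)))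
        have h₇ := Run.push k₀ o (Function.update (Function.update s' c (unary (n - 1))) o
            (k₁ :: k₂ :: (unary (n - 1) ++ false :: s' o)))
        simp only [Function.update_self, Function.update_idem] at h₅ h₆ h₇
        have e₃ : Function.update (pushes [o, d] (Function.update (Function.update s' c
            (unary (n - 1))) o (false :: Function.update s' c (unary (n - 1)) o) c).reverse
            (Function.update (Function.update s' c (unary (n - 1))) o
            (false :: Function.update s' c (unary (n - 1)) o))) c [] =
            Function.update (Function.update (Function.update s' o
              (unary (n - 1) ++ false :: s' o)) d (unary (n - 1))) c [] := by
          funext i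
          simp only [pushes, Function.update_apply, List.mem_cons, List.not_mem_nil, or_false,
            hco, if_false, if_true, reverse_unary]
          split_ifs <;> simp_all
        have e₄ : Function.update (pushes [c] ((Function.update (Function.update
            (Function.update s' o (unary (n - 1) ++ false :: s' o)) d (unary (n - 1))) c []) d).reverse
            (Function.update (Function.update
            (Function.update s' o (unary (n - 1) ++ false :: s' o)) d (unary (n - 1))) c [])) d [] =
            Function.update (Function.update s' c (unary (n - 1))) o
              (unary (n - 1) ++ false :: s' o) := by
          funext i
          simp only [pushes, Function.update_apply, List.mem_cons, List.not_mem_nil, or_false,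
            Ne.symm hcd, if_false, if_true, reverse_unary]
          split_ifs <;> simp_all
        rw [e₃] at h₃
        rw [e₄] at h₄
        refine ⟨_, ?_, .seq h₁ (.seq h₂ (.seq h₃ (.seq h₄ (.seq h₅ (.seq h₆ (t₂ := 1) ?_)))))⟩
        · have hl₃ : (Function.update (Function.update s' c (unary (n - 1))) o
            (false :: Function.update s' c (unary (n - 1)) o) c).length = n - 1 := by
            simp [hco, length_unary]
          have hl₄ : ((Function.update (Function.update (Function.update s' o
              (unary (n - 1) ++ false :: s' o)) d (unary (n - 1))) c []) d).length = n - 1 := by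
            simp [Ne.symm hcd, length_unary]
          rw [hl₃] at ht₃
          rw [hl₄] at ht₄
          simp only [List.length_cons, List.length_nil] at ht₃ ht₄
          omega
        · convert h₇ using 1
          simp [hc, tail_unary])
    (s u) s rfl ⟨⟨m, le_rfl, hc⟩, hd⟩
  have : ∀ (l : List Bool) (s : Store) (m : ℕ), s u = l → s c = unary m →
      l.foldl (fun s b => Function.update (Function.update (Function.update s u (s u).tail) c
          ((Function.update s u (s u).tail) c).tail) o
        (if b then [k₀, k₁, k₂] ++ ((Function.update s u (s u).tail) c).tail ++ [false] ++
          (Function.update s u (s u).tail) o else (Function.update s u (s u).tail) o)) s =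
        Function.update (Function.update (Function.update s u []) c (unary (m - l.length))) o
          (CertDel.gateCodes k₀ k₁ k₂ l m ++ s o) := by
    intro l
    induction l with
    | nil =>
      intro s m hl hp
      funext i
      simp only [Function.update_apply, List.foldl_nil, CertDel.gateCodes, List.length_nil,
        Nat.sub_zero, List.nil_append]
      split_ifs with h₁ h₂ h₃ <;> simp [*]
    | cons b l ih =>
      intro s m hl hp
      rw [List.foldl_cons, ih _ (m - 1) (by simp [huc, huo, hl])
        (by simp [hco, Ne.symm huc, hp, tail_unary])]
      funext i
      simp only [Function.update_apply, Ne.symm huo, Ne.symm huc, hp, if_false, if_true,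
        List.length_cons, CertDel.gateCodes, tail_unary, Nat.sub_sub, Nat.add_comm 1]
      split_ifs <;> simp
  rw [this _ s m rfl hc] at key
  exact key

/-- Whether `x` and `y` agree at the positions where `l` is `true`. -/
def agreeOn : List Bool → List Bool → List Bool → Bool
  | [], _, _ => true
  | b :: l, x, y => !(b && (x.headD false ^^ y.headD false)) && agreeOn l x.tail y.tail

/-- Put `false` in the register `f` if registers `x` and `y` differ where register `u` has a
`true`. -/
def Prog.agreeOn (u x y f : ℕ) : Prog :=
  .forEach u fun b =>
    if b then
      .seq (.branch x (.branch y .skip .skip (.seq (.pop f) (.push false f)))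
        (.branch y .skip .skip (.seq (.pop f) (.push false f)))
        (.branch y (.seq (.pop f) (.push false f)) (.seq (.pop f) (.push false f)) .skip))
        (.seq (.pop x) (.pop y))
    else .seq (.pop x) (.pop y)

theorem Run.agreeOn {u x y f : ℕ} (h : [u, x, y, f].Nodup) (s : Store) (b₀ : Bool)
    (hs : s f = [b₀]) :
    ∃ t ≤ 9 * (s u).length + 1, Run (.agreeOn u x y f) s
      (Function.update (Function.update (Function.update (Function.update s u []) x
        ((s x).drop (s u).length)) y ((s y).drop (s u).length)) f
        [b₀ && CertDel.agreeOn (s u) (s x) (s y)]) t := by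
  simp only [List.nodup_cons, List.mem_cons, List.not_mem_nil, or_false, not_or,
    List.nodup_nil, and_true, not_false_eq_true] at h
  obtain ⟨⟨hux, huy, huf⟩, ⟨hxy, hxf⟩, hyf⟩ := h
  have key := Run.forEach (r := u)
    (p := fun b => if b then
      .seq (.branch x (.branch y .skip .skip (.seq (.pop f) (.push false f)))
        (.branch y .skip .skip (.seq (.pop f) (.push false f)))
        (.branch y (.seq (.pop f) (.push false f)) (.seq (.pop f) (.push false f)) .skip))
        (.seq (.pop x) (.pop y))
      else .seq (.pop x) (.pop y))
    (F := fun b s => Function.update (Function.update (Function.update s x (s x).tail) y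
      (s y).tail) f [(s f).headD false && !(b && ((s x).headD false ^^ (s y).headD false))])
    (I := fun s => ∃ b, s f = [b]) (B := 6)
    (fun _ _ _ _ => by simp)
    (fun s b => by simp [hux, huy, huf])
    (fun s l b hp => by
      obtain ⟨c, hc⟩ := hp
      replace hc : Function.update s u l f = [c] := by simp [Ne.symm huf, hc]
      generalize Function.update s u l = s' at hc ⊢
      have hpops : ∀ c' : Bool, Run (.seq (.pop x) (.pop y)) (Function.update s' f [c'])
          (Function.update (Function.update (Function.update s' x (s' x).tail) y
            (s' y).tail) f [c']) 2 := by
        intro c'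
        have := Run.seq (Run.pop x (Function.update s' f [c'])) (Run.pop y _)
        convert this using 1
        funext i
        simp only [Function.update_apply, Ne.symm hxy, hxf, hyf, if_false]
        split_ifs <;> simp_all
      have hskip : Run .skip s' (Function.update s' f [c]) 2 := by
        rw [← hc, Function.update_eq_self]; exact .skip s'
      have hmis : Run (.seq (.pop f) (.push false f)) s' (Function.update s' f [false]) 2 := by
        have := Run.seq (Run.pop f s') (Run.push false f _)
        simpa [hc] using this
      cases b with
      | false =>
        refine ⟨2, by omega, ?_⟩
        have := hpops c
        rw [← hc, Function.update_eq_self] at this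
        simpa [hc] using this
      | true =>
        refine ⟨2 + 1 + 1 + 2, by omega, .seq ?_ (hpops _)⟩
        simp only [hc, List.headD_cons, Bool.true_and]
        rcases hx : s' x with _ | ⟨_ | _, l₁⟩
        · refine .branchNil hx ?_
          rcases hy : s' y with _ | ⟨_ | _, l₂⟩
          · exact .branchNil hy (by simpa using hskip)
          · exact .branchFalse hy (by simpa using hskip)
          · exact .branchTrue hy (by simpa using hmis)
        · refine .branchFalse hx ?_
          rcases hy : s' y with _ | ⟨_ | _, l₂⟩
          · exact .branchNil hy (by simpa using hskip)
          · exact .branchFalse hy (by simpa using hskip)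
          · exact .branchTrue hy (by simpa using hmis)
        · refine .branchTrue hx ?_
          rcases hy : s' y with _ | ⟨_ | _, l₂⟩
          · exact .branchNil hy (by simpa using hmis)
          · exact .branchFalse hy (by simpa using hmis)
          · exact .branchTrue hy (by simpa using hskip))
    (s u) s rfl ⟨b₀, hs⟩
  have : ∀ (l : List Bool) (s : Store) (b₀ : Bool), s u = l → s f = [b₀] →
      l.foldl (fun s b => Function.update (Function.update (Function.update
          (Function.update s u (s u).tail) x ((Function.update s u (s u).tail) x).tail) y
          ((Function.update s u (s u).tail) y).tail) f
        [((Function.update s u (s u).tail) f).headD false &&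
          !(b && (((Function.update s u (s u).tail) x).headD false ^^
            ((Function.update s u (s u).tail) y).headD false))]) s =
        Function.update (Function.update (Function.update (Function.update s u []) x
          ((s x).drop l.length)) y ((s y).drop l.length)) f
          [b₀ && CertDel.agreeOn l (s x) (s y)] := by
    intro l
    induction l with
    | nil =>
      intro s b₀ hl hp
      funext i
      simp only [Function.update_apply, List.foldl_nil, CertDel.agreeOn, List.length_nil,
        List.drop_zero, Bool.and_true]
      split_ifs with h₁ h₂ h₃ <;> simp [*]
    | cons b l ih =>
      intro s b₀ hl hp
      rw [List.foldl_cons, ih _ (b₀ && !(b && ((s x).headD false ^^ (s y).headD false)))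
        (by simp [hux, huy, huf, hl])
        (by simp [Ne.symm huf, Ne.symm huy, Ne.symm hux, hp])]
      funext i
      simp only [Function.update_apply, hxf, hxy, hyf, Ne.symm hux, Ne.symm huy, if_false, if_true,
        List.length_cons, CertDel.agreeOn, List.drop_tail, Bool.and_assoc]
      split_ifs <;> rfl
  rw [this _ s b₀ rfl hs] at key
  exact key

/-! ### Building programs on explicit register contents -/

/-- Registers `ds` of a list of registers with the string `w` put on top. -/
def pushesList : List ℕ → List Bool → List (List Bool) → List (List Bool)
  | [], _, L => L
  | d :: ds, w, L => pushesList ds w (L.set d (w ++ L.getD d []))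

theorem length_pushesList (ds : List ℕ) (w : List Bool) (L : List (List Bool)) :
    (pushesList ds w L).length = L.length := by
  induction ds generalizing L with
  | nil => rfl
  | cons d ds ih => simp [pushesList, ih]

theorem pushes_cat {ds : List ℕ} (hnd : ds.Nodup) (w : List Bool) {L : List (List Bool)}
    (h : ∀ d ∈ ds, d < L.length) (s : Store) : pushes ds w (cat L s) = cat (pushesList ds w L) s := by
  induction ds generalizing L with
  | nil => rw [pushes_nil]; rfl
  | cons d ds ih =>
    rw [List.nodup_cons] at hnd
    have hd := h d (by simp)
    rw [pushes_cons hnd.1, cat_of_lt hd, update_cat hd,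
      ih hnd.2 fun e he => by simpa using h e (by simp [he])]
    rfl

section
variable {α : Type} {sz : α → ℕ} {C : α → Prop}

/-- Some program, started on `S a`, halts with a store that satisfies `Q a`, in time polynomial
in `sz a`, where `C a` holds. -/
def ExecTo (sz : α → ℕ) (C : α → Prop) (S : α → Store) (Q : α → Store → Prop) : Prop :=
  ∃ (p : Prog) (S' : α → Store), Exec sz C p S S' ∧ ∀ a, C a → Q a (S' a)

variable {p : Prog} {S : α → Store} {Q : α → Store → Prop}
  {L : α → List (List Bool)} {s : α → Store}

/-- Symbolic execution: a goal `ExecTo` is reduced to the goal after one more instruction. As the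
program is existentially quantified, it is never written down; it is assembled by the sequence of
lemmas applied. -/
theorem Exec.to {S' : α → Store} (h : Exec sz C p S S') (hq : ExecTo sz C S' Q) :
    ExecTo sz C S Q := by
  obtain ⟨q, S'', h', hQ⟩ := hq
  exact ⟨.seq p q, S'', h.seq h', hQ⟩

theorem ExecTo.done (h : ∀ a, C a → Q a (S a)) : ExecTo sz C S Q := ⟨.skip, S, .skip S, h⟩

theorem ExecTo.push (b : Bool) (r n : ℕ) (hL : ∀ a, (L a).length = n) (hr : r < n)
    (h : ExecTo sz C (fun a => cat ((L a).set r (b :: (L a).getD r [])) (s a)) Q) :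
    ExecTo sz C (fun a => cat (L a) (s a)) Q :=
  ((Exec.push b r _).congr fun a _ => by
    rw [update_cat (by rw [hL]; exact hr), cat_of_lt (by rw [hL]; exact hr)]).to h

theorem ExecTo.pop (r n : ℕ) (hL : ∀ a, (L a).length = n) (hr : r < n)
    (h : ExecTo sz C (fun a => cat ((L a).set r ((L a).getD r []).tail) (s a)) Q) :
    ExecTo sz C (fun a => cat (L a) (s a)) Q :=
  ((Exec.pop r _).congr fun a _ => by
    rw [update_cat (by rw [hL]; exact hr), cat_of_lt (by rw [hL]; exact hr)]).to h

theorem ExecTo.drain (r : ℕ) (ds : List ℕ) (n : ℕ) (hL : ∀ a, (L a).length = n)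
    (hds : ds.Nodup ∧ r ∉ ds ∧ r < n ∧ ∀ d ∈ ds, d < n)
    (hS : PolyIn sz C fun a => ((L a).getD r []).length)
    (h : ExecTo sz C (fun a => cat ((pushesList ds ((L a).getD r []).reverse (L a)).set r [])
      (s a)) Q) :
    ExecTo sz C (fun a => cat (L a) (s a)) Q := by
  obtain ⟨hnd, hr, hrn, hdn⟩ := hds
  refine ((Exec.drain hnd hr _ (hS.of_le fun a _ => ?_)).congr fun a _ => ?_).to h
  · rw [cat_of_lt (by rw [hL]; exact hrn)]
  · rw [cat_of_lt (by rw [hL]; exact hrn), pushes_cat hnd _ (by rw [hL]; exact hdn),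
      update_cat (by rw [length_pushesList, hL]; exact hrn)]

theorem ExecTo.take (u r d : ℕ) (n : ℕ) (hL : ∀ a, (L a).length = n)
    (hds : (u ≠ r ∧ u ≠ d ∧ r ≠ d) ∧ u < n ∧ r < n ∧ d < n)
    (hS : PolyIn sz C fun a => ((L a).getD u []).length)
    (h : ExecTo sz C (fun a => cat ((((L a).set u []).set r
        (((L a).getD r []).drop ((L a).getD u []).length)).set d
        ((padTake ((L a).getD u []).length ((L a).getD r [])).reverse ++ (L a).getD d []))
      (s a)) Q) :
    ExecTo sz C (fun a => cat (L a) (s a)) Q := by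
  obtain ⟨⟨hur, hud, hrd⟩, hu, hr, hd⟩ := hds
  refine ((Exec.take hur hud hrd _ (hS.of_le fun a _ => ?_)).congr fun a _ => ?_).to h
  · rw [cat_of_lt (by rw [hL]; exact hu)]
  · rw [cat_of_lt (by rw [hL]; exact hu), cat_of_lt (by rw [hL]; exact hr),
      cat_of_lt (by rw [hL]; exact hd), update_cat (by rw [hL]; exact hu),
      update_cat (by simpa [hL] using hr), update_cat (by simpa [hL] using hd)]

theorem ExecTo.parity (u x p : ℕ) (n : ℕ) (b : α → Bool) (hL : ∀ a, (L a).length = n)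
    (hds : (u ≠ x ∧ u ≠ p ∧ x ≠ p) ∧ u < n ∧ x < n ∧ p < n)
    (hS : PolyIn sz C fun a => ((L a).getD u []).length)
    (hb : ∀ a, C a → (L a).getD p [] = [b a])
    (h : ExecTo sz C (fun a => cat ((((L a).set u []).set x
        (((L a).getD x []).drop ((L a).getD u []).length)).set p
        [b a ^^ parityOff ((L a).getD u []) ((L a).getD x [])])
      (s a)) Q) :
    ExecTo sz C (fun a => cat (L a) (s a)) Q := by
  obtain ⟨⟨hux, hup, hxp⟩, hu, hx, hp⟩ := hds
  refine Exec.to (p := .parity u x p) ⟨_, ((PolyIn.const 8).mul hS).add (.const 1), fun a ha => ?_⟩ h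
  obtain ⟨t, ht, hr⟩ := Run.parity hux hup hxp (cat (L a) (s a)) (b a)
    (by rw [cat_of_lt (by rw [hL]; exact hp), hb a ha])
  rw [cat_of_lt (by rw [hL]; exact hu)] at ht hr
  rw [cat_of_lt (by rw [hL]; exact hx), update_cat (by rw [hL]; exact hu),
      update_cat (by simpa [hL] using hx), update_cat (by simpa [hL] using hp)] at hr
  exact ⟨t, ht, hr⟩

theorem ExecTo.agreeOn (u x y f : ℕ) (n : ℕ) (b : α → Bool) (hL : ∀ a, (L a).length = n)
    (hds : [u, x, y, f].Nodup ∧ u < n ∧ x < n ∧ y < n ∧ f < n)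
    (hS : PolyIn sz C fun a => ((L a).getD u []).length)
    (hb : ∀ a, C a → (L a).getD f [] = [b a])
    (h : ExecTo sz C (fun a => cat (((((L a).set u []).set x
        (((L a).getD x []).drop ((L a).getD u []).length)).set y
        (((L a).getD y []).drop ((L a).getD u []).length)).set f
        [b a && CertDel.agreeOn ((L a).getD u []) ((L a).getD x []) ((L a).getD y [])])
      (s a)) Q) :
    ExecTo sz C (fun a => cat (L a) (s a)) Q := by
  obtain ⟨hnd, hu, hx, hy, hf⟩ := hds
  refine Exec.to (p := .agreeOn u x y f) ⟨_, ((PolyIn.const 9).mul hS).add (.const 1), fun a ha => ?_⟩ h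
  obtain ⟨t, ht, hr⟩ := Run.agreeOn hnd (cat (L a) (s a)) (b a)
    (by rw [cat_of_lt (by rw [hL]; exact hf), hb a ha])
  rw [cat_of_lt (by rw [hL]; exact hu)] at ht hr
  rw [cat_of_lt (by rw [hL]; exact hx), cat_of_lt (by rw [hL]; exact hy),
      update_cat (by rw [hL]; exact hu), update_cat (by simpa [hL] using hx),
      update_cat (by simpa [hL] using hy), update_cat (by simpa [hL] using hf)] at hr
  exact ⟨t, ht, hr⟩

theorem ExecTo.gateCodes (k₀ k₁ k₂ : Bool) (u c o d : ℕ) (n : ℕ) (m : α → ℕ)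
    (hL : ∀ a, (L a).length = n)
    (hds : [u, c, o, d].Nodup ∧ u < n ∧ c < n ∧ o < n ∧ d < n)
    (hS : PolyIn sz C fun a => ((L a).getD u []).length) (hm : PolyIn sz C m)
    (hc : ∀ a, C a → (L a).getD c [] = unary (m a)) (hd : ∀ a, C a → (L a).getD d [] = [])
    (h : ExecTo sz C (fun a => cat ((((L a).set u []).set c
        (unary (m a - ((L a).getD u []).length))).set o
        (CertDel.gateCodes k₀ k₁ k₂ ((L a).getD u []) (m a) ++ (L a).getD o []))
      (s a)) Q) :
    ExecTo sz C (fun a => cat (L a) (s a)) Q := by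
  obtain ⟨hnd, hu, hc', ho, hd'⟩ := hds
  refine Exec.to (p := .gateCodes k₀ k₁ k₂ u c o d) ⟨_, ((((PolyIn.const 13).mul hm).add (.const 10)).mul hS).add (.const 1),
    fun a ha => ?_⟩ h
  obtain ⟨t, ht, hr⟩ := Run.gateCodes k₀ k₁ k₂ hnd (cat (L a) (s a)) (m a)
    (by rw [cat_of_lt (by rw [hL]; exact hc'), hc a ha])
    (by rw [cat_of_lt (by rw [hL]; exact hd'), hd a ha])
  rw [cat_of_lt (by rw [hL]; exact hu)] at ht hr
  rw [cat_of_lt (by rw [hL]; exact ho), update_cat (by rw [hL]; exact hu),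
      update_cat (by simpa [hL] using hc'), update_cat (by simpa [hL] using ho)] at hr
  exact ⟨t, ht, hr⟩

theorem ExecTo.branch (r n : ℕ) (hL : ∀ a, (L a).length = n) (hr : r < n)
    (hp : ExecTo sz (fun a => C a ∧ (L a).getD r [] = []) (fun a => cat (L a) (s a)) Q)
    (hq : ExecTo sz (fun a => C a ∧ ∃ l, (L a).getD r [] = false :: l)
      (fun a => cat (L a) (s a)) Q)
    (hu : ExecTo sz (fun a => C a ∧ ∃ l, (L a).getD r [] = true :: l)
      (fun a => cat (L a) (s a)) Q) :
    ExecTo sz C (fun a => cat (L a) (s a)) Q := by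
  obtain ⟨p, S₁, h₁, hQ₁⟩ := hp
  obtain ⟨q, S₂, h₂, hQ₂⟩ := hq
  obtain ⟨u, S₃, h₃, hQ₃⟩ := hu
  have hcat : ∀ a, cat (L a) (s a) r = (L a).getD r [] := fun a =>
    cat_of_lt (by rw [hL]; exact hr)
  refine ⟨.branch r p q u, fun a => match (L a).getD r [] with
    | [] => S₁ a
    | false :: _ => S₂ a
    | true :: _ => S₃ a, Exec.branch ?_ ?_ ?_, fun a ha => ?_⟩
  · simp only [hcat]
    exact h₁.congr fun a ha => by simp only [ha.2]
  · simp only [hcat]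
    exact h₂.congr fun a ha => by obtain ⟨_, l, hl⟩ := ha; simp only [hl]
  · simp only [hcat]
    exact h₃.congr fun a ha => by obtain ⟨_, l, hl⟩ := ha; simp only [hl]
  · rcases h : (L a).getD r [] with _ | ⟨_ | _, l⟩
    · simpa only [h] using hQ₁ a ⟨ha, h⟩
    · simpa only [h] using hQ₂ a ⟨ha, l, h⟩
    · simpa only [h] using hQ₃ a ⟨ha, l, h⟩

end

/-! ### The strings computed by the compiler -/

theorem padTake_eq (n k : ℕ) (l : List Bool) :
    padTake n (l.drop k) = List.ofFn (segment n k l) := by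
  induction n generalizing k with
  | zero => rfl
  | succ n ih =>
    rw [padTake, List.ofFn_succ, List.tail_drop, ih]
    congr 1
    · simp [segment, List.getD_eq_getElem?_getD]
    · congr 1
      funext i
      simp [segment, Nat.add_assoc, Nat.add_comm 1]

theorem padTake_eq_zero (n : ℕ) (l : List Bool) :
    padTake n l = List.ofFn (segment n 0 l) := padTake_eq n 0 l

theorem mask_succ {n : ℕ} (x θ : Fin (n + 1) → Bool) :
    mask x θ = ((!θ 0 && x 0) ^^ mask (fun i => x i.succ) (fun i => θ i.succ)) := by
  unfold mask
  rw [Fin.card_filter_univ_succ]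
  cases θ 0 <;> cases x 0 <;> simp [Nat.bodd_succ]

theorem parityOff_ofFn {n : ℕ} (x θ : Fin n → Bool) :
    parityOff (List.ofFn θ) (List.ofFn x) = mask x θ := by
  induction n with
  | zero => simp [parityOff, mask]
  | succ n ih => rw [List.ofFn_succ, List.ofFn_succ, parityOff, mask_succ, ← ih]; rfl

theorem agreeOn_ofFn {n : ℕ} (x y θ : Fin n → Bool) :
    agreeOn (List.ofFn θ) (List.ofFn x) (List.ofFn y) =
      decide (∀ i, θ i = true → x i = y i) := by
  induction n with
  | zero => simp [agreeOn]
  | succ n ih =>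
    rw [List.ofFn_succ, List.ofFn_succ, List.ofFn_succ, agreeOn, Bool.eq_iff_iff]
    simp only [List.tail_cons, ih, List.headD_cons, Bool.and_eq_true, decide_eq_true_eq,
      Fin.forall_fin_succ]
    refine and_congr_left fun _ => ?_
    cases θ 0 <;> cases x 0 <;> cases y 0 <;> simp

/-- The induction splits off the last qubit, since the reversed string begins with the bit of label
`n - 1`. -/
theorem gateCodes_ofFn (k₀ k₁ k₂ : Bool) {n : ℕ} (x : Fin n → Bool) :
    gateCodes k₀ k₁ k₂ (List.ofFn x).reverse n = ((List.finRange n).filter fun i => x i).flatMap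
      fun i : Fin n => [k₀, k₁, k₂] ++ unary i ++ [false] := by
  induction n with
  | zero => simp [gateCodes]
  | succ n ih =>
    rw [List.ofFn_succ', List.concat_eq_append, List.reverse_append, List.reverse_singleton,
      List.singleton_append, gateCodes, List.finRange_succ_last, Nat.add_sub_cancel, ih,
      List.filter_append, List.flatMap_append, List.filter_map, List.flatMap_map]
    congr 1
    cases h : x (Fin.last n) <;> simp [h]

theorem encode_basisChange {n : ℕ} (θ : Fin n → Bool) :
    (basisChange θ).encode = gateCodes false false true (List.ofFn θ).reverse n := by
  rw [gateCodes_ofFn, basisChange, Circuit.encode, List.flatMap_map]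
  rfl

theorem encode_prepareBB84 {n : ℕ} (x θ : Fin n → Bool) :
    (prepareBB84 x θ).encode = gateCodes false false false (List.ofFn x).reverse n ++
      gateCodes false false true (List.ofFn θ).reverse n := by
  rw [← encode_basisChange, gateCodes_ofFn, prepareBB84, Circuit.encode, List.flatMap_append,
    List.flatMap_map]
  rfl

theorem ExecTo.computesInPolyTime {α : Type} {input output : α → List (List Bool)}
    {sz : α → ℕ} (n : ℕ) (hsz : ∀ a, sz a ≤ ((input a).map List.length).sum)
    (h : ExecTo sz (fun _ => True)
      (fun a => cat (input a ++ List.replicate n []) emptyStore)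
      fun a s => ∀ i < (output a).length, s i = (output a).getD i []) :
    ComputesInPolyTime input output := by
  obtain ⟨p, S, ⟨T, ⟨P, hP⟩, hr⟩, hS⟩ := h
  exact Exec.computesInPolyTime (S := S) n
    ⟨T, ⟨P, fun a ha => (hP a ha).trans (eval_monotone P (hsz a))⟩, hr⟩ fun a => hS a trivial

/-! ### The algorithms of the compiled scheme in polynomial time -/

section
variable {E : WE} {R : List Bool → List Bool → List Bool → Prop}

theorem compile_coins_polyTime (hE : E.IsPPT) :
    ComputesInPolyTime (α := ℕ × List Bool × List Bool)
    (fun (lam, ℓ, X) => [unary lam, ℓ, X])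
    (fun (lam, ℓ, X) => [unary ((compile E).qubits lam), unary ((compile E).certLen lam),
      unary ((compile E).encCoins lam ℓ X)]) := by
  -- Registers `0` to `7` belong to the caller and the arguments of the call start at register `8`;
  -- all values are moved to fit this layout.
  obtain ⟨pc, hc⟩ := hE.1.exec 8
  refine ExecTo.computesInPolyTime (sz := fun a => a.1 + a.2.1.length + a.2.2.length) 9 ?_ ?_
  · rintro ⟨lam, ℓ, X⟩
    simp [length_unary, Nat.add_assoc]
  · set sz : ℕ × List Bool × List Bool → ℕ := fun a => a.1 + a.2.1.length + a.2.2.length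
    have h₀ : PolyIn sz (fun _ => True) fun a => a.1 := PolyIn.size.of_le fun _ _ => by
      simp only [sz]; omega
    have h₁ : PolyIn sz (fun _ => True) fun a => a.2.1.length := PolyIn.size.of_le fun _ _ => by
      simp only [sz]; omega
    have h₂ : PolyIn sz (fun _ => True) fun a => a.2.2.length := PolyIn.size.of_le fun _ _ => by
      simp only [sz]; omega
    show ExecTo sz _ (fun a => cat [unary a.1, a.2.1, a.2.2, [], [], [], [], [], [], [], [], []]
      emptyStore) _
    -- Copies of `lam`: two outputs, two summands of the number of coins, and two arguments of the
    -- call.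
    refine .drain 0 [3, 4, 5, 6, 8, 11] 12 (fun _ => rfl) (by simp)
      (by simpa [length_unary] using h₀) ?_
    simp only [pushesList, List.set_cons_succ, List.set_cons_zero, List.getD_cons_succ,
      List.getD_cons_zero, reverse_unary, List.append_nil]
    -- The string that is encrypted has `lam + 1` bits.
    refine .push true 11 12 (fun _ => rfl) (by simp) ?_
    refine .drain 1 [7] 12 (fun _ => rfl) (by simp) (by simpa using h₁) ?_
    refine .drain 7 [9] 12 (fun _ => rfl) (by simp) (by simpa [pushesList] using h₁) ?_
    refine .drain 2 [7] 12 (fun _ => rfl) (by simp) (by simpa [pushesList] using h₂) ?_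
    refine .drain 7 [10] 12 (fun _ => rfl) (by simp) (by simpa [pushesList] using h₂) ?_
    simp only [pushesList, List.set_cons_succ, List.set_cons_zero, List.getD_cons_succ,
      List.getD_cons_zero, List.append_nil, List.reverse_reverse]
    obtain ⟨s, hs, hlen⟩ := hc (C := fun _ => True) (fun a => (a.1, a.2.1, a.2.2, a.1 + 1))
      (fun a => [[], [], [], unary a.1, unary a.1, unary a.1, unary a.1, []]) (fun _ => rfl)
      (PolyIn.of_le ((PolyIn.size (sz := sz)).add (h₀.add (.const 1))) (by
        rintro ⟨lam, ℓ, X⟩ _; simp [sz, length_unary]; omega))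
    refine hs.to ?_
    have h₃ := hlen 0
    simp only [List.getD_cons_zero, length_unary] at h₃
    show ExecTo sz _ (fun a => cat [[], [], [], unary a.1, unary a.1, unary a.1, unary a.1, [],
      unary (E.encCoins a.1 a.2.1 a.2.2 (a.1 + 1))] (s a)) _
    refine .drain 8 [2] 9 (fun _ => rfl) (by simp) (by simpa [length_unary] using h₃) ?_
    refine .drain 5 [2] 9 (fun _ => rfl) (by simp)
      (by simpa [pushesList, length_unary] using h₀) ?_
    refine .drain 6 [2] 9 (fun _ => rfl) (by simp)
      (by simpa [pushesList, length_unary] using h₀) ?_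
    refine .drain 3 [0] 9 (fun _ => rfl) (by simp)
      (by simpa [pushesList, length_unary] using h₀) ?_
    refine .drain 4 [1] 9 (fun _ => rfl) (by simp)
      (by simpa [pushesList, length_unary] using h₀) ?_
    simp only [pushesList, List.set_cons_succ, List.set_cons_zero, List.getD_cons_succ,
      List.getD_cons_zero, List.append_nil, reverse_unary, unary_append]
    refine .done fun a _ i hi => ?_
    obtain ⟨lam, ℓ, X⟩ := a
    change i < 3 at hi
    rw [cat_of_lt (by simp; omega)]
    interval_cases i <;> simp [compile, Nat.add_assoc]

end

theorem length_gateCodes_le (k₀ k₁ k₂ : Bool) (l : List Bool) (n : ℕ) :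
    (gateCodes k₀ k₁ k₂ l n).length ≤ l.length * (n + 4) := by
  induction l generalizing n with
  | nil => simp [gateCodes]
  | cons b l ih =>
    have h := (ih (n - 1)).trans (Nat.mul_le_mul_left l.length (by omega : n - 1 + 4 ≤ n + 4))
    have h' : (if b then [k₀, k₁, k₂] ++ unary (n - 1) ++ [false] else []).length ≤ n + 4 := by
      cases b <;> simp [length_unary]
    rw [gateCodes, List.length_append, List.length_cons, Nat.succ_mul]
    exact add_le_add h h'

section
variable {E : WE}

theorem compile_enc_polyTime (hE : E.IsPPT) :
    ComputesInPolyTime (α := ℕ × List Bool × List Bool × Bool × List Bool)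
    (fun (lam, ℓ, X, b, r) => [unary lam, ℓ, X, [b], r])
    (fun (lam, ℓ, X, b, r) => [(compile E).encVk lam ℓ X b r, (compile E).encCt lam ℓ X b r,
      ((compile E).encPrep lam ℓ X b r).encode]) := by
  obtain ⟨pc, hc⟩ := hE.2.1.exec 14
  refine ExecTo.computesInPolyTime
    (sz := fun a => a.1 + a.2.1.length + a.2.2.1.length + a.2.2.2.2.length) 14 ?_ ?_
  · rintro ⟨lam, ℓ, X, b, r⟩
    simp [length_unary]
    omega
  · set sz : ℕ × List Bool × List Bool × Bool × List Bool → ℕ :=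
      fun a => a.1 + a.2.1.length + a.2.2.1.length + a.2.2.2.2.length
    have h₀ : PolyIn sz (fun _ => True) fun a => a.1 := PolyIn.size.of_le fun _ _ => by
      simp only [sz]; omega
    have h₁ : PolyIn sz (fun _ => True) fun a => a.2.1.length := PolyIn.size.of_le fun _ _ => by
      simp only [sz]; omega
    have h₂ : PolyIn sz (fun _ => True) fun a => a.2.2.1.length := PolyIn.size.of_le fun _ _ => by
      simp only [sz]; omega
    have h₄ : PolyIn sz (fun _ => True) fun a => a.2.2.2.2.length - (a.1 + a.1) :=
      PolyIn.size.of_le fun _ _ => by simp only [sz]; omega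
    show ExecTo sz _ (fun a => cat [unary a.1, a.2.1, a.2.2.1, [a.2.2.2.1], a.2.2.2.2,
      [], [], [], [], [], [], [], [], [], [], [], [], [], []] emptyStore) _
    refine .drain 0 [5, 6, 7, 8, 14] 19 (fun _ => rfl) (by simp)
      (by simpa [length_unary] using h₀) ?_
    simp only [pushesList, List.set_cons_succ, List.set_cons_zero, List.getD_cons_succ,
      List.getD_cons_zero, reverse_unary, List.append_nil]
    refine .take 5 4 9 19 (fun _ => rfl) (by simp) (by simpa [length_unary] using h₀) ?_
    refine .take 6 4 10 19 (fun _ => rfl) (by simp) (by simpa [length_unary] using h₀) ?_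
    simp only [List.set_cons_succ, List.set_cons_zero, List.getD_cons_succ, length_unary,
      List.getD_cons_zero, List.append_nil, padTake_eq, List.drop_drop]
    simp only [padTake_eq_zero]
    refine .drain 1 [0] 19 (fun _ => rfl) (by simp) (by simpa using h₁) ?_
    refine .drain 0 [15] 19 (fun _ => rfl) (by simp) (by simpa [pushesList] using h₁) ?_
    refine .drain 2 [0] 19 (fun _ => rfl) (by simp) (by simpa [pushesList] using h₂) ?_
    refine .drain 0 [16] 19 (fun _ => rfl) (by simp) (by simpa [pushesList] using h₂) ?_
    refine .drain 4 [0] 19 (fun _ => rfl) (by simp) (by simpa [pushesList] using h₄) ?_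
    refine .drain 0 [18] 19 (fun _ => rfl) (by simp) (by simpa [pushesList] using h₄) ?_
    simp only [pushesList, List.set_cons_succ, List.set_cons_zero, List.getD_cons_succ,
      List.getD_cons_zero, List.append_nil, List.reverse_reverse]
    refine .drain 9 [0, 1, 2] 19 (fun _ => rfl) (by simp) (by simpa using h₀) ?_
    refine .drain 10 [4, 5, 6] 19 (fun _ => rfl) (by simp) (by simpa [pushesList] using h₀) ?_
    simp only [pushesList, List.set_cons_succ, List.set_cons_zero, List.getD_cons_succ,
      List.getD_cons_zero, List.append_nil, List.reverse_reverse]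
    refine .drain 0 [10] 19 (fun _ => rfl) (by simp) (by simpa using h₀) ?_
    refine .drain 10 [5] 19 (fun _ => rfl) (by simp) (by simpa [pushesList] using h₀) ?_
    refine .drain 6 [9, 10] 19 (fun _ => rfl) (by simp) (by simpa [pushesList] using h₀) ?_
    refine .drain 2 [13] 19 (fun _ => rfl) (by simp) (by simpa [pushesList] using h₀) ?_
    simp only [pushesList, List.set_cons_succ, List.set_cons_zero, List.getD_cons_succ,
      List.getD_cons_zero, List.append_nil, List.reverse_reverse]
    -- This turns the message bit into the masked bit. It uses up one copy of `x` and one of `θ`,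
    -- which is why several were made.
    refine .parity 4 1 3 19 (fun a => a.2.2.2.1) (fun _ => rfl) (by simp) (by simpa using h₀)
      (fun _ _ => rfl) ?_
    refine .drain 3 [17] 19 (fun _ => rfl) (by simp) (by simpa using .const 1) ?_
    refine .drain 10 [17] 19 (fun _ => rfl) (by simp) (by simpa [pushesList] using h₀) ?_
    simp only [pushesList, List.set_cons_succ, List.set_cons_zero, List.getD_cons_succ,
      List.getD_cons_zero, List.append_nil, List.reverse_reverse, parityOff_ofFn,
      List.reverse_singleton]
    -- The Hadamard gates come last in the circuit, hence first on the output stack.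
    refine .gateCodes false false true 9 7 11 12 19 (fun a => a.1) (fun _ => rfl) (by simp)
      (by simpa using h₀) h₀ (fun _ _ => rfl) (fun _ _ => rfl) ?_
    refine .gateCodes false false false 13 8 11 12 19 (fun a => a.1) (fun _ => rfl) (by simp)
      (by simpa using h₀) h₀ (fun _ _ => rfl) (fun _ _ => rfl) ?_
    simp only [List.set_cons_succ, List.set_cons_zero, List.getD_cons_succ, List.getD_cons_zero,
      List.append_nil, ← encode_prepareBB84]
    obtain ⟨s, hs, hlen⟩ := hc (sz := sz) (C := fun _ => True)
      (fun a => (a.1, a.2.1, a.2.2.1, List.ofFn (segment a.1 a.1 a.2.2.2.2) ++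
        [a.2.2.2.1 ^^ mask (segment a.1 0 a.2.2.2.2) (segment a.1 a.1 a.2.2.2.2)],
        a.2.2.2.2.drop (a.1 + a.1)))
      (fun a => [[], (List.ofFn (segment a.1 0 a.2.2.2.2)).drop
          (List.ofFn (segment a.1 a.1 a.2.2.2.2)).length, [], [], [],
        List.ofFn (segment a.1 0 a.2.2.2.2) ++ List.ofFn (segment a.1 a.1 a.2.2.2.2), [],
        unary (a.1 - (List.ofFn (segment a.1 a.1 a.2.2.2.2)).reverse.length),
        unary (a.1 - (List.ofFn (segment a.1 0 a.2.2.2.2)).reverse.length), [], [],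
        (prepareBB84 (segment a.1 0 a.2.2.2.2) (segment a.1 a.1 a.2.2.2.2)).encode, [], []])
      (fun _ => rfl)
      (PolyIn.of_le ((PolyIn.size (sz := sz)).add (h₀.add (.const 1))) (by
        rintro ⟨lam, ℓ, X, b, r⟩ _; simp [sz, length_unary]; omega))
    refine hs.to ?_
    have h₁₁ : PolyIn sz (fun _ => True) fun a =>
        (prepareBB84 (segment a.1 0 a.2.2.2.2) (segment a.1 a.1 a.2.2.2.2)).encode.length := by
      simp only [encode_prepareBB84, List.length_append]
      refine (((h₀.mul (h₀.add (.const 4))).add (h₀.mul (h₀.add (.const 4))))).of_le fun a _ =>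
        add_le_add ?_ ?_
      · simpa using length_gateCodes_le false false false
          (List.ofFn (segment a.1 0 a.2.2.2.2)).reverse a.1
      · simpa using length_gateCodes_le false false true
          (List.ofFn (segment a.1 a.1 a.2.2.2.2)).reverse a.1
    have h₃ : PolyIn sz (fun _ => True) fun a => ((compile E).encCt a.1 a.2.1 a.2.2.1 a.2.2.2.1
      a.2.2.2.2).length := hlen 0
    have h₅ : PolyIn sz (fun _ => True) fun a =>
        (List.ofFn (segment a.1 0 a.2.2.2.2) ++ List.ofFn (segment a.1 a.1 a.2.2.2.2)).length := by
      simpa using h₀.add h₀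
    show ExecTo sz _ (fun a => cat [[], (List.ofFn (segment a.1 0 a.2.2.2.2)).drop
          (List.ofFn (segment a.1 a.1 a.2.2.2.2)).length, [], [], [],
        List.ofFn (segment a.1 0 a.2.2.2.2) ++ List.ofFn (segment a.1 a.1 a.2.2.2.2), [],
        unary (a.1 - (List.ofFn (segment a.1 a.1 a.2.2.2.2)).reverse.length),
        unary (a.1 - (List.ofFn (segment a.1 0 a.2.2.2.2)).reverse.length), [], [],
        (prepareBB84 (segment a.1 0 a.2.2.2.2) (segment a.1 a.1 a.2.2.2.2)).encode, [], [],
        (compile E).encCt a.1 a.2.1 a.2.2.1 a.2.2.2.1 a.2.2.2.2] (s a)) _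
    simp only [List.length_reverse, List.length_ofFn, Nat.sub_self,
      List.drop_of_length_le (List.length_ofFn.le)]
    refine .drain 14 [3] 15 (fun _ => rfl) (by simp) h₃ ?_
    refine .drain 3 [1] 15 (fun _ => rfl) (by simp)
      (by simpa [pushesList] using h₃) ?_
    refine .drain 11 [3] 15 (fun _ => rfl) (by simp) (by simpa [pushesList] using h₁₁) ?_
    refine .drain 3 [2] 15 (fun _ => rfl) (by simp) (by simpa [pushesList] using h₁₁) ?_
    refine .drain 5 [3] 15 (fun _ => rfl) (by simp) (by simpa [pushesList] using h₅) ?_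
    refine .drain 3 [0] 15 (fun _ => rfl) (by simp) (by simpa [pushesList] using h₅) ?_
    simp only [pushesList, List.set_cons_succ, List.set_cons_zero, List.getD_cons_succ,
      List.getD_cons_zero, List.append_nil, List.reverse_reverse]
    refine .done fun a _ i hi => ?_
    obtain ⟨lam, ℓ, X, b, r⟩ := a
    change i < 3 at hi
    rw [cat_of_lt (by simp; omega)]
    interval_cases i <;> rfl

/-! ### Parsing the decrypted message -/

theorem getD_drop_zero (l : List Bool) (n : ℕ) (b : Bool) :
    (l.drop n).getD 0 b = l.getD n b := by
  simp [List.getD_eq_getElem?_getD]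

theorem parsePair_of_drop {n : ℕ} {l : List Bool} {b : Bool} (h : l.drop n = [b]) :
    parsePair n (some l) = some (segment n 0 l, b) := by
  have hlen : l.length = n + 1 := by
    have := congrArg List.length h
    rw [List.length_drop, List.length_singleton] at this
    omega
  have hb : l.getD n false = b := by rw [← getD_drop_zero, h]; rfl
  rw [parsePair, Option.bind_some, if_pos hlen, hb]

theorem parsePair_of_drop_ne {n : ℕ} {l : List Bool} (h : (l.drop n).length ≠ 1) :
    parsePair n (some l) = none := by
  rw [parsePair, Option.bind_some, if_neg]
  intro hl
  rw [List.length_drop] at h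
  omega

/-- The result of a decryption as a string. -/
def optCode (o : Option (List Bool)) : List Bool := (o.map (List.cons true)).getD []

theorem optCode_eq_nil {o : Option (List Bool)} (h : optCode o = []) : o = none := by
  cases o with
  | none => rfl
  | some l => simp [optCode] at h

theorem optCode_eq_true {o : Option (List Bool)} {l : List Bool} (h : optCode o = true :: l) :
    o = some l := by
  cases o with
  | none => simp [optCode] at h
  | some l' => simpa [optCode] using h

theorem optCode_ne_false {o : Option (List Bool)} {l : List Bool} :
    optCode o ≠ false :: l := by
  cases o <;> simp [optCode]

theorem ExecTo.mono {α : Type} {sz : α → ℕ} {C C' : α → Prop} {S S' : α → Store}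
    {Q : α → Store → Prop} (h : ExecTo sz C S Q) (hC : ∀ a, C' a → C a)
    (hS : ∀ a, C' a → S a = S' a) : ExecTo sz C' S' Q := by
  obtain ⟨p, S'', ⟨T, hT, h⟩, hQ⟩ := h
  exact ⟨p, S'', ⟨T, hT.mono hC, fun a ha => hS a ha ▸ h a (hC a ha)⟩, fun a ha => hQ a (hC a ha)⟩

/-- Register `8` holds the decrypted string behind a `true` that marks success. After `n` bits are
taken off, parsing succeeds if and only if exactly one bit is left; in particular a string too short
leaves none, and the padding added by `take` is irrelevant. A failing parse leaves arbitrary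
contents, hence the quantifiers over `y₁, y₄, y₆, y₈`. -/
theorem ExecTo.parsePair {α : Type} {sz : α → ℕ} {C : α → Prop} {Q : α → Store → Prop}
    {s : α → Store} (n : α → ℕ) (o : α → Option (List Bool)) (x₀ x₂ x₃ x₅ x₇ : α → List Bool)
    (hn : PolyIn sz C n)
    (hnone : ∀ a, C a → CertDel.parsePair (n a) (o a) = none → ∀ y₁ y₄ y₆ y₈,
      Q a (cat [x₀ a, y₁, x₂ a, x₃ a, y₄, x₅ a, y₆, x₇ a, y₈] (s a)))
    (hsome : ∀ (θ : ∀ a, Fin (n a) → Bool) (b : α → Bool),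
      ExecTo sz (fun a => C a ∧ CertDel.parsePair (n a) (o a) = some (θ a, b a))
        (fun a => cat [x₀ a, [b a], x₂ a, x₃ a, [], x₅ a, (List.ofFn (θ a)).reverse, x₇ a, []]
          (s a)) Q) :
    ExecTo sz C (fun a => cat [x₀ a, [], x₂ a, x₃ a, unary (n a), x₅ a, [], x₇ a,
      optCode (o a)] (s a)) Q := by
  -- The case in which a bit `b` follows the first `n` bits; it remains to test that nothing comes
  -- after it. The value of `b` is fixed, so that the program can push it as a constant.
  have key : ∀ (C' : α → Prop) (b : Bool), (∀ a, C' a → C a ∧ ∃ l, o a = some l ∧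
      ∃ l', l.drop (n a) = b :: l') → ExecTo sz C' (fun a => cat [x₀ a, [], x₂ a, x₃ a, [], x₅ a,
      (padTake (n a) (optCode (o a)).tail).reverse, x₇ a, (optCode (o a)).tail.drop (n a)] (s a))
      Q := by
    intro C' b hC'
    refine .pop 8 9 (fun _ => rfl) (by simp) ?_
    have hnone' : ∀ a, C' a → (∃ c l, ((optCode (o a)).tail.drop (n a)).tail = c :: l) →
        CertDel.parsePair (n a) (o a) = none := by
      rintro a ha ⟨c, l₂, h⟩
      obtain ⟨-, l, hl, l', hl'⟩ := hC' a ha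
      rw [hl] at h ⊢
      refine parsePair_of_drop_ne ?_
      change (l.drop (n a)).tail = _ at h
      rw [hl', List.tail_cons] at h
      rw [hl', h]
      simp
    refine .branch 8 9 (fun _ => rfl) (by simp) ?_ ?_ ?_
    · refine .push b 1 9 (fun _ => rfl) (by simp) ?_
      refine (hsome (fun a => segment (n a) 0 (optCode (o a)).tail) fun _ => b).mono ?_ ?_
      · rintro a ⟨ha, h⟩
        obtain ⟨hC, l, hl, l', hl'⟩ := hC' a ha
        refine ⟨hC, ?_⟩
        rw [hl] at h ⊢
        change (l.drop (n a)).tail = [] at h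
        rw [hl', List.tail_cons] at h
        exact parsePair_of_drop (hl'.trans (by rw [h]))
      · rintro a ⟨ha, h⟩
        simp only [List.set_cons_succ, List.set_cons_zero, List.getD_cons_succ,
          List.getD_cons_zero, padTake_eq_zero] at h ⊢
        rw [h]
    · exact .done fun a ha => hnone a (hC' a ha.1).1
        (hnone' a ha.1 ⟨_, ha.2⟩) _ _ _ _
    · exact .done fun a ha => hnone a (hC' a ha.1).1
        (hnone' a ha.1 ⟨_, ha.2⟩) _ _ _ _
  refine .branch 8 9 (fun _ => rfl) (by simp) ?_ ?_ ?_
  · refine .done fun a ha => hnone a ha.1 ?_ _ _ _ _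
    rw [optCode_eq_nil ha.2]
    rfl
  · exact .done fun a ha => absurd ha.2.choose_spec optCode_ne_false
  · refine .pop 8 9 (fun _ => rfl) (by simp) ?_
    refine .take 4 8 6 9 (fun _ => rfl) (by simp)
      ((hn.mono fun _ h => h.1).of_le fun a _ => (length_unary (n a)).le) ?_
    simp only [List.set_cons_succ, List.set_cons_zero, List.getD_cons_succ,
      List.getD_cons_zero, List.append_nil, length_unary]
    have key' : ∀ {b : Bool} (a : α), (C a ∧ ∃ l, optCode (o a) = true :: l) →
        (∃ l', (optCode (o a)).tail.drop (n a) = b :: l') →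
        C a ∧ ∃ l, o a = some l ∧ ∃ l', l.drop (n a) = b :: l' := by
      rintro b a ⟨hC, l, hl⟩ ⟨l', h⟩
      rw [hl, List.tail_cons] at h
      exact ⟨hC, l, optCode_eq_true hl, l', h⟩
    refine .branch 8 9 (fun _ => rfl) (by simp) ?_ ?_ ?_
    · refine .done fun a ha => hnone a ha.1.1 ?_ _ _ _ _
      obtain ⟨⟨hC, l, hl⟩, h⟩ := ha
      change optCode (o a) = _ at hl
      change (optCode (o a)).tail.drop (n a) = [] at h
      rw [hl, List.tail_cons] at h
      rw [optCode_eq_true hl]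
      exact parsePair_of_drop_ne (by rw [h]; simp)
    · exact key _ false fun a ha => key' a ha.1 ha.2
    · exact key _ true fun a ha => key' a ha.1 ha.2

theorem compile_decPrep_polyTime (hE : E.IsPPT) :
    ComputesInPolyTime (α := ℕ × List Bool × List Bool × List Bool)
    (fun (lam, W, ct, r) => [unary lam, W, ct, r])
    (fun (lam, W, ct, r) => [((compile E).decPrep lam W ct r).encode]) := by
  obtain ⟨pc, hc⟩ := hE.2.2.2.exec 8
  refine ExecTo.computesInPolyTime
    (sz := fun a => a.1 + a.2.1.length + a.2.2.1.length + a.2.2.2.length) 8 ?_ ?_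
  · rintro ⟨lam, W, ct, r⟩
    simp [length_unary]
    omega
  · set sz : ℕ × List Bool × List Bool × List Bool → ℕ :=
      fun a => a.1 + a.2.1.length + a.2.2.1.length + a.2.2.2.length
    have h₀ : ∀ C, PolyIn sz C fun a => a.1 := fun C => PolyIn.size.of_le fun _ _ => by
      simp only [sz]; omega
    have h₁ : PolyIn sz (fun _ => True) fun a => a.2.1.length := PolyIn.size.of_le fun _ _ => by
      simp only [sz]; omega
    have h₂ : PolyIn sz (fun _ => True) fun a => a.2.2.1.length := PolyIn.size.of_le fun _ _ => by
      simp only [sz]; omega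
    have h₃ : PolyIn sz (fun _ => True) fun a => a.2.2.2.length := PolyIn.size.of_le fun _ _ => by
      simp only [sz]; omega
    show ExecTo sz _ (fun a : ℕ × List Bool × List Bool × List Bool => cat [unary a.1, a.2.1, a.2.2.1, a.2.2.2,
      [], [], [], [], [], [], [], []] emptyStore) _
    refine .drain 0 [4, 5, 8] 12 (fun _ => rfl) (by simp)
      (by simpa [length_unary] using h₀ _) ?_
    refine .drain 1 [0] 12 (fun _ => rfl) (by simp) (by simpa [pushesList] using h₁) ?_
    refine .drain 0 [9] 12 (fun _ => rfl) (by simp) (by simpa [pushesList] using h₁) ?_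
    refine .drain 2 [0] 12 (fun _ => rfl) (by simp) (by simpa [pushesList] using h₂) ?_
    refine .drain 0 [10] 12 (fun _ => rfl) (by simp) (by simpa [pushesList] using h₂) ?_
    simp only [pushesList, List.set_cons_succ, List.set_cons_zero, List.getD_cons_succ,
      List.getD_cons_zero, reverse_unary, List.append_nil, List.reverse_reverse]
    refine .drain 3 [0] 12 (fun _ => rfl) (by simp) (by simpa using h₃) ?_
    refine .drain 0 [11] 12 (fun _ => rfl) (by simp) (by simpa [pushesList] using h₃) ?_
    simp only [pushesList, List.set_cons_succ, List.set_cons_zero, List.getD_cons_succ,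
      List.getD_cons_zero, List.append_nil, List.reverse_reverse]
    obtain ⟨s, hs, hlen⟩ := hc (sz := sz) (C := fun _ => True) id
      (fun a => [[], [], [], [], unary a.1, unary a.1, [], []]) (fun _ => rfl)
      (PolyIn.of_le (PolyIn.size (sz := sz)) (by
        rintro ⟨lam, W, ct, r⟩ _; simp [sz, length_unary]; omega))
    refine hs.to ?_
    show ExecTo sz _ (fun a : ℕ × List Bool × List Bool × List Bool => cat [[], [], [], [], unary a.1, unary a.1, [], [],
      optCode (E.dec a.1 a.2.1 a.2.2.1 a.2.2.2)] (s a)) (fun a t => ∀ i < 1, t i =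
        [((compile E).decPrep a.1 a.2.1 a.2.2.1 a.2.2.2).encode].getD i [])
    refine .parsePair (α := ℕ × List Bool × List Bool × List Bool) (fun a => a.1)
      (fun a => E.dec a.1 a.2.1 a.2.2.1 a.2.2.2) (fun _ => [])
      (fun _ => []) (fun _ => []) (fun a => unary a.1) (fun _ => []) (h₀ _) ?_ ?_
    · intro a _ h y₁ y₄ y₆ y₈ i hi
      rw [Nat.lt_one_iff.mp hi, cat_of_lt (by simp)]
      simp [compile, h, Circuit.encode]
    · intro θ b
      refine .gateCodes false false true 6 5 0 7 9 (fun a => a.1) (fun _ => rfl) (by simp)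
        ((h₀ _).of_le fun a _ => by simp) (h₀ _) (fun _ _ => rfl) (fun _ _ => rfl) ?_
      refine .done fun a ha i hi => ?_
      rw [Nat.lt_one_iff.mp hi, cat_of_lt (by simp)]
      simp [compile, ha.2, encode_basisChange]

theorem compile_decOut_polyTime (hE : E.IsPPT) :
    ComputesInPolyTime (α := (lam : ℕ) × (List Bool × List Bool × List Bool ×
        (Fin ((compile E).qubits lam) → Bool)))
    (fun ⟨lam, W, ct, r, y⟩ => [unary lam, W, ct, r, List.ofFn y])
    (fun ⟨lam, W, ct, r, y⟩ => [((compile E).decOut lam W ct r y).toList]) := by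
  obtain ⟨pc, hc⟩ := hE.2.2.2.exec 8
  refine ExecTo.computesInPolyTime
    (sz := fun a => a.1 + a.2.1.length + a.2.2.1.length + a.2.2.2.1.length) 7 ?_ ?_
  · rintro ⟨lam, W, ct, r, y⟩
    simp [length_unary]
    omega
  · set sz : ((lam : ℕ) × (List Bool × List Bool × List Bool ×
        (Fin ((compile E).qubits lam) → Bool))) → ℕ :=
      fun a => a.1 + a.2.1.length + a.2.2.1.length + a.2.2.2.1.length
    have h₀ : ∀ C, PolyIn sz C fun a => a.1 := fun C => PolyIn.size.of_le fun _ _ => by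
      simp only [sz]; omega
    have h₁ : PolyIn sz (fun _ => True) fun a => a.2.1.length := PolyIn.size.of_le fun _ _ => by
      simp only [sz]; omega
    have h₂ : PolyIn sz (fun _ => True) fun a => a.2.2.1.length := PolyIn.size.of_le fun _ _ => by
      simp only [sz]; omega
    have h₃ : PolyIn sz (fun _ => True) fun a => a.2.2.2.1.length :=
      PolyIn.size.of_le fun _ _ => by simp only [sz]; omega
    have h₅ : ∀ C, PolyIn sz C fun a => (List.ofFn a.2.2.2.2).length :=
      fun C => (h₀ C).of_le fun a _ => by simp [compile]
    show ExecTo sz _ (fun a => cat [unary a.1, a.2.1, a.2.2.1, a.2.2.2.1, List.ofFn a.2.2.2.2,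
      [], [], [], [], [], [], []] emptyStore) _
    refine .drain 4 [7] 12 (fun _ => rfl) (by simp) (h₅ _) ?_
    refine .drain 0 [4, 8] 12 (fun _ => rfl) (by simp)
      (by simpa [pushesList, length_unary] using h₀ _) ?_
    refine .drain 1 [0] 12 (fun _ => rfl) (by simp) (by simpa [pushesList] using h₁) ?_
    refine .drain 0 [9] 12 (fun _ => rfl) (by simp) (by simpa [pushesList] using h₁) ?_
    simp only [pushesList, List.set_cons_succ, List.set_cons_zero, List.getD_cons_succ,
      List.getD_cons_zero, reverse_unary, List.append_nil, List.reverse_reverse]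
    refine .drain 2 [0] 12 (fun _ => rfl) (by simp) (by simpa using h₂) ?_
    refine .drain 0 [10] 12 (fun _ => rfl) (by simp) (by simpa [pushesList] using h₂) ?_
    refine .drain 3 [0] 12 (fun _ => rfl) (by simp) (by simpa [pushesList] using h₃) ?_
    refine .drain 0 [11] 12 (fun _ => rfl) (by simp) (by simpa [pushesList] using h₃) ?_
    simp only [pushesList, List.set_cons_succ, List.set_cons_zero, List.getD_cons_succ,
      List.getD_cons_zero, List.append_nil, List.reverse_reverse]
    obtain ⟨s, hs, hlen⟩ := hc (sz := sz) (C := fun _ => True)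
      (fun a => (a.1, a.2.1, a.2.2.1, a.2.2.2.1))
      (fun a => [[], [], [], [], unary a.1, [], [], (List.ofFn a.2.2.2.2).reverse])
      (fun _ => rfl)
      (PolyIn.of_le (PolyIn.size (sz := sz)) (by
        rintro ⟨lam, W, ct, r, y⟩ _; simp [sz, length_unary]; omega))
    refine hs.to ?_
    show ExecTo sz _ (fun a => cat [[], [], [], [], unary a.1, [], [],
      (List.ofFn a.2.2.2.2).reverse,
      optCode (E.dec a.1 a.2.1 a.2.2.1 a.2.2.2.1)] (s a)) (fun a t => ∀ i < 1, t i =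
        [((compile E).decOut a.1 a.2.1 a.2.2.1 a.2.2.2.1 a.2.2.2.2).toList].getD i [])
    refine .parsePair (α := (lam : ℕ) × (List Bool × List Bool × List Bool ×
        (Fin ((compile E).qubits lam) → Bool))) (fun a => a.1)
      (fun a => E.dec a.1 a.2.1 a.2.2.1 a.2.2.2.1) (fun _ => [])
      (fun _ => []) (fun _ => []) (fun _ => []) (fun a => (List.ofFn a.2.2.2.2).reverse) (h₀ _)
      ?_ ?_
    · intro a _ h y₁ y₄ y₆ y₈ i hi
      rw [Nat.lt_one_iff.mp hi, cat_of_lt (by simp)]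
      simp [compile, h]
    · intro θ b
      refine .drain 7 [3] 9 (fun _ => rfl) (by simp)
        ((h₅ _).of_le fun a _ => (List.length_reverse).le) ?_
      refine .drain 6 [2] 9 (fun _ => rfl) (by simp) ((h₀ _).of_le fun a _ => by
        simp [pushesList]) ?_
      simp only [pushesList, List.set_cons_succ, List.set_cons_zero, List.getD_cons_succ,
        List.getD_cons_zero, List.append_nil, List.reverse_reverse]
      refine .parity 2 3 1 9 b (fun _ => rfl) (by simp) ((h₀ _).of_le fun a _ => by simp)
        (fun _ _ => rfl) ?_
      refine .drain 1 [0] 9 (fun _ => rfl) (by simp) (by simpa using .const 1) ?_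
      refine .done fun a ha i hi => ?_
      rw [Nat.lt_one_iff.mp hi, cat_of_lt (by simp [pushesList])]
      have h' := parityOff_ofFn (n := a.1) a.2.2.2.2 (θ a)
      simp only [compile] at h'
      simp [compile, ha.2, pushesList, h']

theorem compile_delPrep_polyTime :
    ComputesInPolyTime (α := ℕ × List Bool)
    (fun (lam, ct) => [unary lam, ct])
    (fun (lam, ct) => [((compile E).delPrep lam ct).encode]) := by
  refine ExecTo.computesInPolyTime (sz := fun a => a.1) 3 ?_ ?_
  · rintro ⟨lam, ct⟩
    simp [length_unary]
  · have h₀ : PolyIn (fun a : ℕ × List Bool => a.1) (fun _ => True) fun a => a.1 := PolyIn.size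
    show ExecTo _ _ (fun a : ℕ × List Bool => cat [unary a.1, a.2, [], [], []] emptyStore) _
    refine .drain 0 [2, 3] 5 (fun _ => rfl) (by simp) (by simpa [length_unary] using h₀) ?_
    simp only [pushesList, List.set_cons_succ, List.set_cons_zero, List.getD_cons_succ,
      List.getD_cons_zero, reverse_unary, List.append_nil]
    refine .gateCodes false false true 2 3 0 4 5 (fun a => a.1) (fun _ => rfl) (by simp)
      (by simpa [length_unary] using h₀) h₀ (fun _ _ => rfl) (fun _ _ => rfl) ?_
    refine .done fun a ha i hi => ?_
    obtain ⟨lam, ct⟩ := a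
    change i < 1 at hi
    rw [Nat.lt_one_iff.mp hi, cat_of_lt (by simp)]
    simp [compile, encode_basisChange, unary]

theorem compile_delOut_polyTime :
    ComputesInPolyTime (α := (lam : ℕ) × (List Bool × (Fin ((compile E).qubits lam) → Bool)))
    (fun ⟨lam, ct, y⟩ => [unary lam, ct, List.ofFn y])
    (fun ⟨lam, ct, y⟩ => [List.ofFn ((compile E).delOut lam ct y)]) := by
  refine ExecTo.computesInPolyTime (sz := fun a => a.1) 1 ?_ ?_
  · rintro ⟨lam, ct, y⟩
    simp [length_unary]
  · have h₀ : PolyIn (fun a : (lam : ℕ) × (List Bool × (Fin ((compile E).qubits lam) → Bool)) =>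
        a.1) (fun _ => True) fun a => a.1 := PolyIn.size
    have h₁ : PolyIn (fun a : (lam : ℕ) × (List Bool × (Fin ((compile E).qubits lam) → Bool)) =>
        a.1) (fun _ => True) fun a => (List.ofFn a.2.2).length :=
      h₀.of_le fun a _ => by simp [compile]
    show ExecTo _ _ (fun a : (lam : ℕ) × (List Bool × (Fin ((compile E).qubits lam) → Bool)) => cat [unary a.1, a.2.1, List.ofFn a.2.2, []] emptyStore) _
    -- A drain without targets just clears the register.
    refine .drain 0 [] 4 (fun _ => rfl) (by simp) (by simpa [length_unary] using h₀) ?_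
    refine .drain 2 [3] 4 (fun _ => rfl) (by simp) h₁ ?_
    refine .drain 3 [0] 4 (fun _ => rfl) (by simp) (by simpa [pushesList] using h₁) ?_
    refine .done fun a ha i hi => ?_
    obtain ⟨lam, ct, y⟩ := a
    change i < 1 at hi
    rw [Nat.lt_one_iff.mp hi, cat_of_lt (by simp [pushesList])]
    simp [pushesList, compile]

theorem compile_ver_polyTime :
    ComputesInPolyTime (α := (lam : ℕ) × (List Bool × (Fin ((compile E).certLen lam) → Bool)))
    (fun ⟨lam, vk, cert⟩ => [unary lam, vk, List.ofFn cert])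
    (fun ⟨lam, vk, cert⟩ => [[(compile E).ver lam vk cert]]) := by
  refine ExecTo.computesInPolyTime (sz := fun a => a.1) 6 ?_ ?_
  · rintro ⟨lam, ct, y⟩
    simp [length_unary]
  · have h₀ : PolyIn (fun a : (lam : ℕ) × (List Bool × (Fin ((compile E).certLen lam) → Bool)) =>
        a.1) (fun _ => True) fun a => a.1 := PolyIn.size
    show ExecTo _ _ (fun a : (lam : ℕ) × (List Bool × (Fin ((compile E).certLen lam) → Bool)) => cat [unary a.1, a.2.1, List.ofFn a.2.2, [], [], [], [], [], []]
      emptyStore) _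
    refine .drain 0 [3, 4] 9 (fun _ => rfl) (by simp) (by simpa [length_unary] using h₀) ?_
    simp only [pushesList, List.set_cons_succ, List.set_cons_zero, List.getD_cons_succ,
      List.getD_cons_zero, reverse_unary, List.append_nil]
    refine .take 3 1 5 9 (fun _ => rfl) (by simp) (by simpa [length_unary] using h₀) ?_
    refine .take 4 1 6 9 (fun _ => rfl) (by simp) (by simpa [length_unary] using h₀) ?_
    simp only [List.set_cons_succ, List.set_cons_zero, List.getD_cons_succ, length_unary,
      List.getD_cons_zero, List.append_nil, padTake_eq, List.drop_drop]
    simp only [padTake_eq_zero]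
    refine .drain 5 [7] 9 (fun _ => rfl) (by simp) (by simpa using h₀) ?_
    refine .drain 6 [8] 9 (fun _ => rfl) (by simp) (by simpa [pushesList] using h₀) ?_
    simp only [pushesList, List.set_cons_succ, List.set_cons_zero, List.getD_cons_succ,
      List.getD_cons_zero, List.append_nil, List.reverse_reverse]
    refine .push true 0 9 (fun _ => rfl) (by simp) ?_
    refine .agreeOn 8 7 2 0 9 (fun _ => true) (fun _ => rfl) (by simp) (by simpa using h₀)
      (fun _ _ => rfl) ?_
    refine .done fun a ha i hi => ?_
    obtain ⟨lam, vk, y⟩ := a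
    change i < 1 at hi
    rw [Nat.lt_one_iff.mp hi, cat_of_lt (by simp)]
    have h' := agreeOn_ofFn (n := lam) (segment lam 0 vk) y (segment lam lam vk)
    simp only [List.getD_cons_zero, List.set_cons_zero, List.set_cons_succ, Bool.true_and]
    exact congrArg (fun b => [b]) h'

theorem compile_isQPT (hE : E.IsPPT) : (compile E).IsQPT :=
  ⟨compile_coins_polyTime hE, compile_enc_polyTime hE, hE.2.2.1, compile_decPrep_polyTime hE,
    compile_decOut_polyTime hE, compile_delPrep_polyTime, compile_delOut_polyTime,
    compile_ver_polyTime⟩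

end

set_option linter.unusedSectionVars false

/-! ### State vectors -/

/-- State vectors of a register of qubits. -/
abbrev Vec (ι : Type) := (ι → Bool) → ℂ

section
variable {ι κ : Type} [Fintype ι] [DecidableEq ι] [Fintype κ] [DecidableEq κ]

/-- The action of a gate on state vectors. -/
def Gate.act : Gate ι → Vec ι → Vec ι
  | .X i, φ => fun s => φ (Function.update s i (!s i))
  | .H i, φ => fun s => (φ (Function.update s i false) +
      (if s i then -1 else 1) * φ (Function.update s i true)) / (Real.sqrt 2 : ℂ)
  | .T i, φ => fun s => (if s i then Complex.exp (Real.pi / 4 * Complex.I) else 1) * φ s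
  | .CNOT c k _, φ => fun s => φ (Function.update s k (s k ^^ s c))
  | .Toffoli c d k _ _ _, φ => fun s => φ (Function.update s k (s k ^^ (s c && s d)))

/-- The action of a circuit on state vectors. -/
def Circuit.run : Circuit ι → Vec ι → Vec ι
  | [], φ => φ
  | g :: c, φ => Circuit.run c (g.act φ)

/-- Adding to bit `k` a function of the other bits is an involution; `hf` says that `f` ignores bit
`k`. This covers the gates `X`, `CNOT` and `Toffoli`. -/
theorem eq_update_iff {s t : ι → Bool} {k : ι} {f : (ι → Bool) → Bool}
    (hf : ∀ s b, f (Function.update s k b) = f s) :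
    s = Function.update t k (t k ^^ f t) ↔ t = Function.update s k (s k ^^ f s) := by
  constructor <;> rintro rfl <;> simp [hf]

theorem Gate.matrix_mulVec (g : Gate ι) (φ : Vec ι) : g.matrix *ᵥ φ = g.act φ := by
  funext s
  cases g with
  | X i =>
    have : ∀ t : ι → Bool, s = Function.update t i (!t i) ↔ t = Function.update s i (!s i) := by
      intro t
      simpa using eq_update_iff (s := s) (t := t) (k := i) (f := fun _ => true) (by simp)
    simp [Gate.matrix, Gate.act, Matrix.mulVec, dotProduct, this]
  | H i =>
    have h : ∀ t : ι → Bool, (∀ j, j ≠ i → s j = t j) ↔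
        t = Function.update s i false ∨ t = Function.update s i true := by
      intro t
      constructor
      · intro h
        cases ht : t i
        · left
          funext j
          by_cases hj : j = i
          · subst hj; simp [ht]
          · simp [hj, h j hj]
        · right
          funext j
          by_cases hj : j = i
          · subst hj; simp [ht]
          · simp [hj, h j hj]
      · rintro (rfl | rfl) j hj <;> simp [hj]
    have hne : Function.update s i false ≠ Function.update s i true := by
      intro h
      simpa using congrFun h i
    simp only [Gate.matrix, Gate.act, Matrix.mulVec, dotProduct, Matrix.of_apply, ite_mul,
      zero_mul, h]
    rw [← Finset.sum_filter]
    have : (Finset.univ.filter fun t => t = Function.update s i false ∨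
        t = Function.update s i true) =
        {Function.update s i false, Function.update s i true} := by
      ext t; simp
    rw [this, Finset.sum_pair hne]
    simp only [Function.update_self, Bool.and_false, Bool.and_true]
    cases s i <;> simp <;> ring
  | T i => simp [Gate.matrix, Gate.act, Matrix.mulVec_diagonal]
  | CNOT c k h =>
    have := fun t : ι → Bool => eq_update_iff (s := s) (t := t) (k := k) (f := fun s => s c)
      (by simp [h])
    simp [Gate.matrix, Gate.act, Matrix.mulVec, dotProduct, this]
  | Toffoli c d k hc hd _ =>
    have := fun t : ι → Bool => eq_update_iff (s := s) (t := t) (k := k)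
      (f := fun s => s c && s d) (by simp [hc, hd])
    simp [Gate.matrix, Gate.act, Matrix.mulVec, dotProduct, this]

theorem Circuit.matrix_mulVec (c : Circuit ι) (φ : Vec ι) : c.matrix *ᵥ φ = c.run φ := by
  induction c generalizing φ with
  | nil => simp [Circuit.matrix, Circuit.run]
  | cons g c ih =>
    rw [Circuit.matrix, Circuit.run, ← Matrix.mulVec_mulVec, Gate.matrix_mulVec, ih]

theorem Circuit.run_append (c d : Circuit ι) (φ : Vec ι) : (c ++ d).run φ = d.run (c.run φ) := by
  induction c generalizing φ with
  | nil => rfl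
  | cons g c ih => exact ih _

theorem Circuit.run_smul (c : Circuit ι) (a : ℂ) (φ : Vec ι) : c.run (a • φ) = a • c.run φ := by
  simp only [← Circuit.matrix_mulVec, Matrix.mulVec_smul]

theorem Circuit.run_zero (c : Circuit ι) : c.run 0 = 0 := by
  simp only [← Circuit.matrix_mulVec, Matrix.mulVec_zero]

theorem Circuit.run_sum {α : Type*} (c : Circuit ι) (A : Finset α) (φ : α → Vec ι) :
    c.run (∑ a ∈ A, φ a) = ∑ a ∈ A, c.run (φ a) := by
  simp only [← Circuit.matrix_mulVec, ← Matrix.mulVecLin_apply, map_sum]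

/-- The squared norm of a vector. -/
def normSq (φ : Vec ι) : ℝ := ∑ s, ‖φ s‖ ^ 2

theorem normSq_nonneg (φ : Vec ι) : 0 ≤ normSq φ := Finset.sum_nonneg fun _ _ => by positivity

theorem update_involutive {k : ι} {f : (ι → Bool) → Bool}
    (hf : ∀ s b, f (Function.update s k b) = f s) :
    Function.Involutive fun s : ι → Bool => Function.update s k (s k ^^ f s) :=
  fun _ => ((eq_update_iff hf).1 rfl).symm

theorem normSq_comp_update {k : ι} {f : (ι → Bool) → Bool}
    (hf : ∀ s b, f (Function.update s k b) = f s) (φ : Vec ι) :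
    (∑ s, ‖φ (Function.update s k (s k ^^ f s))‖ ^ 2) = ∑ s, ‖φ s‖ ^ 2 :=
  Equiv.sum_comp (update_involutive hf).toPerm fun s => ‖φ s‖ ^ 2

/-- `T` multiplies amplitudes by phases, and the other gates except `H` permute them. `H` mixes the
amplitudes at `s` and at `s` with bit `i` flipped, and the parallelogram law preserves their joint
weight. Summing `key` over all `s` counts each amplitude twice. -/
theorem Gate.normSq_act (g : Gate ι) (φ : Vec ι) : normSq (g.act φ) = normSq φ := by
  unfold normSq
  cases g with
  | X i =>
    have := normSq_comp_update (k := i) (f := fun _ => true) (by simp) φ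
    simp only [Bool.xor_true] at this
    exact this
  | H i =>
    have h₁ := normSq_comp_update (k := i) (f := fun _ => true) (by simp) φ
    have h₂ := normSq_comp_update (k := i) (f := fun _ => true) (by simp) ((Gate.H i).act φ)
    have key : ∀ s : ι → Bool, ‖(Gate.H i).act φ s‖ ^ 2 +
        ‖(Gate.H i).act φ (Function.update s i (s i ^^ true))‖ ^ 2 =
        ‖φ s‖ ^ 2 + ‖φ (Function.update s i (s i ^^ true))‖ ^ 2 := by
      intro s
      have e : ∀ a b : ℂ, ‖(a + b) / (Real.sqrt 2 : ℂ)‖ ^ 2 + ‖(a - b) / (Real.sqrt 2 : ℂ)‖ ^ 2 =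
          ‖a‖ ^ 2 + ‖b‖ ^ 2 := by
        intro a b
        have h := parallelogram_law_with_norm ℝ a b
        rw [norm_div, norm_div, div_pow, div_pow]
        have : ‖(Real.sqrt 2 : ℂ)‖ ^ 2 = 2 := by
          rw [Complex.norm_real, Real.norm_eq_abs, sq_abs, Real.sq_sqrt (by norm_num)]
        rw [this]
        nlinarith
      cases hs : s i
      · have h0 : Function.update s i false = s := by rw [← hs, Function.update_eq_self]
        have a₁ : (Gate.H i).act φ s =
            (φ s + φ (Function.update s i true)) / (Real.sqrt 2 : ℂ) := by
          simp [Gate.act, hs, h0]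
        have a₂ : (Gate.H i).act φ (Function.update s i (false ^^ true)) =
            (φ s - φ (Function.update s i true)) / (Real.sqrt 2 : ℂ) := by
          simp [Gate.act, h0, sub_eq_add_neg]
        rw [a₁, a₂, e]
        rfl
      · have h0 : Function.update s i true = s := by rw [← hs, Function.update_eq_self]
        have a₁ : (Gate.H i).act φ s =
            (φ (Function.update s i false) - φ s) / (Real.sqrt 2 : ℂ) := by
          simp [Gate.act, hs, h0, sub_eq_add_neg]
        have a₂ : (Gate.H i).act φ (Function.update s i (true ^^ true)) =
            (φ (Function.update s i false) + φ s) / (Real.sqrt 2 : ℂ) := by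
          simp [Gate.act, h0]
        rw [a₁, a₂, add_comm, e, add_comm]
        rfl
    have := Finset.sum_congr rfl fun s (_ : s ∈ (Finset.univ : Finset (ι → Bool))) => key s
    rw [Finset.sum_add_distrib, Finset.sum_add_distrib, h₁, h₂] at this
    linarith
  | T i =>
    refine Finset.sum_congr rfl fun s _ => ?_
    have : ‖Complex.exp (Real.pi / 4 * Complex.I)‖ = 1 := by
      have := Complex.norm_exp_ofReal_mul_I (Real.pi / 4)
      push_cast at this
      exact this
    cases hs : s i <;> simp [Gate.act, hs, this]
  | CNOT c k h => exact normSq_comp_update (f := fun s => s c) (by simp [h]) φ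
  | Toffoli c d k hc hd _ =>
    exact normSq_comp_update (f := fun s => s c && s d) (by simp [hc, hd]) φ

theorem Circuit.normSq_run (c : Circuit ι) (φ : Vec ι) : normSq (c.run φ) = normSq φ := by
  induction c generalizing φ with
  | nil => rfl
  | cons g c ih => rw [Circuit.run, ih, Gate.normSq_act]

/-! ### Pure states -/

/-- The tensor product of vectors. -/
def tensVec (φ : Vec ι) (ψ : Vec κ) : Vec (ι ⊕ κ) :=
  fun s => φ (s ∘ Sum.inl) * ψ (s ∘ Sum.inr)

/-- The basis vector `|z⟩`. -/
def basisVec (z : ι → Bool) : Vec ι := Pi.single z 1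

/-- The projection to the outcome `z` of a measurement. -/
def projVec (out : κ → ι) (z : κ → Bool) (φ : Vec ι) : Vec ι :=
  fun s => if s ∘ out = z then φ s else 0

/-- The probability to measure `1` on qubit `i`. -/
def probVec (i : ι) (φ : Vec ι) : ℝ := ∑ s, if s i then ‖φ s‖ ^ 2 else 0

/-- This and the next lemmas reduce density matrices to vectors: for fixed outcomes and coins, all
states of the experiments before discarding are pure. -/
theorem Circuit.apply_pureState (c : Circuit ι) (φ : Vec ι) :
    c.apply (pureState φ) = pureState (c.run φ) := by
  rw [Circuit.apply, pureState, pureState, Matrix.mul_vecMulVec, Matrix.vecMulVec_mul,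
    Circuit.matrix_mulVec, Matrix.vecMul_conjTranspose, star_star, Circuit.matrix_mulVec]

theorem tensor_pureState (φ : Vec ι) (ψ : Vec κ) :
    tensor (pureState φ) (pureState ψ) = pureState (tensVec φ ψ) := by
  ext s t
  simp [tensor, pureState, tensVec, Matrix.vecMulVec_apply]
  ring

theorem basisState_eq (z : ι → Bool) : basisState z = pureState (basisVec z) := by
  ext s t
  simp only [basisState, pureState, basisVec, Matrix.of_apply, Matrix.vecMulVec_apply,
    Pi.star_apply, Pi.single_apply]
  by_cases hs : s = z <;> by_cases ht : t = z <;> simp [hs, ht]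

theorem collapse_pureState (out : κ → ι) (z : κ → Bool) (φ : Vec ι) :
    collapse out z (pureState φ) = pureState (projVec out z φ) := by
  ext s t
  simp only [collapse, pureState, projVec, Matrix.of_apply, Matrix.vecMulVec_apply,
    Pi.star_apply]
  by_cases hs : s ∘ out = z <;> by_cases ht : t ∘ out = z <;> simp [hs, ht]

theorem trace_pureState (φ : Vec ι) : (pureState φ).trace = (normSq φ : ℂ) := by
  simp [pureState, Matrix.trace, Matrix.vecMulVec_apply, normSq, Complex.mul_conj,
    Complex.normSq_eq_norm_sq]

theorem probOne_pureState (i : ι) (φ : Vec ι) : probOne i (pureState φ) = probVec i φ := by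
  rw [probOne, collapse_pureState, trace_pureState, Complex.ofReal_re, normSq, probVec]
  refine Finset.sum_congr rfl fun s _ => ?_
  have : (s ∘ (fun _ : Unit => i) = fun _ => true) ↔ s i = true := by
    rw [funext_iff]; simp
  by_cases hs : s i <;> simp [projVec, this, hs]

theorem normSq_tensVec (φ : Vec ι) (ψ : Vec κ) :
    normSq (tensVec φ ψ) = normSq φ * normSq ψ := by
  unfold normSq
  rw [Finset.sum_mul_sum, ← Fintype.sum_prod_type',
    ← Equiv.sum_comp (Equiv.sumArrowEquivProdArrow ι κ Bool)]
  refine Finset.sum_congr rfl fun s _ => ?_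
  rw [tensVec, norm_mul, mul_pow]
  rfl

theorem normSq_basisVec (z : ι → Bool) : normSq (basisVec z) = 1 := by
  rw [normSq, Finset.sum_eq_single z]
  · simp [basisVec]
  · intro s _ hs; simp [basisVec, hs]
  · simp

theorem sum_normSq_projVec (out : κ → ι) (φ : Vec ι) :
    ∑ z, normSq (projVec out z φ) = normSq φ := by
  unfold normSq
  rw [Finset.sum_comm]
  refine Finset.sum_congr rfl fun s _ => ?_
  rw [Finset.sum_eq_single (s ∘ out)]
  · simp [projVec]
  · intro z _ hz; simp [projVec, hz.symm]
  · simp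

/-! ### Circuits on part of the qubits -/

/-- Relabel the qubits of a gate. -/
def Gate.map (f : ι ↪ κ) : Gate ι → Gate κ
  | .X i => .X (f i)
  | .H i => .H (f i)
  | .T i => .T (f i)
  | .CNOT c t h => .CNOT (f c) (f t) (f.injective.ne h)
  | .Toffoli c d t hc hd hcd =>
      .Toffoli (f c) (f d) (f t) (f.injective.ne hc) (f.injective.ne hd) (f.injective.ne hcd)

/-- Relabel the qubits of a circuit. -/
def Circuit.map (f : ι ↪ κ) (c : Circuit ι) : Circuit κ := List.map (Gate.map f) c

theorem Circuit.length_map (f : ι ↪ κ) (c : Circuit ι) : (c.map f).length = c.length :=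
  List.length_map _

theorem extend_update (f : ι ↪ κ) (s : κ → Bool) (i : ι) (b : Bool) :
    Function.extend f (Function.update (s ∘ f) i b) s = Function.update s (f i) b := by
  funext j
  by_cases hj : ∃ i, f i = j
  · obtain ⟨i', rfl⟩ := hj
    rw [f.injective.extend_apply]
    by_cases hi : i' = i
    · subst hi; simp
    · rw [Function.update_of_ne hi, Function.update_of_ne (f.injective.ne hi)]; rfl
  · rw [Function.extend_apply' _ _ _ hj, Function.update_of_ne]
    rintro rfl
    exact hj ⟨i, rfl⟩

theorem extend_comp (f : ι ↪ κ) (u : ι → Bool) (s : κ → Bool) :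
    Function.extend f u s ∘ f = u := by
  funext i; simp [f.injective.extend_apply]

theorem extend_extend (f : ι ↪ κ) (u u' : ι → Bool) (s : κ → Bool) :
    Function.extend f u (Function.extend f u' s) = Function.extend f u s := by
  funext j
  by_cases hj : ∃ i, f i = j
  · obtain ⟨i', rfl⟩ := hj
    rw [f.injective.extend_apply, f.injective.extend_apply]
  · simp [Function.extend_apply' _ _ _ hj]

theorem extend_self (f : ι ↪ κ) (s : κ → Bool) : Function.extend f (s ∘ f) s = s := by
  funext j
  by_cases hj : ∃ i, f i = j
  · obtain ⟨i', rfl⟩ := hj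
    rw [f.injective.extend_apply]; rfl
  · simp [Function.extend_apply' _ _ _ hj]

theorem Gate.act_map (f : ι ↪ κ) (g : Gate ι) (φ : Vec κ) :
    (g.map f).act φ = fun s => g.act (fun u => φ (Function.extend f u s)) (s ∘ f) := by
  funext s
  cases g <;> simp only [Gate.map, Gate.act, extend_update, extend_self, Function.comp_apply]

/-- For each assignment of the qubits outside the image of `f`, the circuit acts on the amplitudes
as a function of the qubits inside. -/
theorem Circuit.run_map (f : ι ↪ κ) (c : Circuit ι) (φ : Vec κ) :
    (c.map f).run φ = fun s => c.run (fun u => φ (Function.extend f u s)) (s ∘ f) := by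
  induction c generalizing φ with
  | nil => funext s; exact (congrArg φ (extend_self f s)).symm
  | cons g c ih =>
    change (Circuit.map f c).run ((g.map f).act φ) = _
    rw [ih]
    funext s
    simp only [Circuit.run, Gate.act_map, extend_extend, extend_comp]

/-! ### Reversible circuits -/

/-- The action of a controlled-not or Toffoli gate on bit assignments. -/
def Gate.flip : Gate ι → (ι → Bool) → (ι → Bool)
  | .CNOT c k _, s => Function.update s k (s k ^^ s c)
  | .Toffoli c d k _ _ _, s => Function.update s k (s k ^^ (s c && s d))
  | _, s => s

/-- Controlled-not and Toffoli gates. -/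
def Gate.IsReversible : Gate ι → Prop
  | .CNOT _ _ _ => True
  | .Toffoli _ _ _ _ _ _ => True
  | _ => False

/-- The action of a reversible circuit on bit assignments. -/
def Circuit.flip (c : Circuit ι) (s : ι → Bool) : ι → Bool := c.foldl (fun s g => g.flip s) s

theorem Gate.flip_flip (g : Gate ι) (s : ι → Bool) : g.flip (g.flip s) = s := by
  cases g with
  | CNOT c k h => exact update_involutive (f := fun s => s c) (by simp [h]) s
  | Toffoli c d k hc hd _ =>
    exact update_involutive (f := fun s => s c && s d) (by simp [hc, hd]) s
  | _ => rfl

theorem Circuit.flip_append (c d : Circuit ι) (s : ι → Bool) :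
    (c ++ d).flip s = d.flip (c.flip s) := List.foldl_append

theorem Circuit.flip_surjective (c : Circuit ι) : Function.Surjective c.flip := by
  induction c with
  | nil => exact fun s => ⟨s, rfl⟩
  | cons g c ih =>
    intro s
    obtain ⟨t, rfl⟩ := ih s
    exact ⟨g.flip t, by simp [Circuit.flip, Gate.flip_flip]⟩

theorem Circuit.run_flip (c : Circuit ι) (hc : ∀ g ∈ c, g.IsReversible) (φ : Vec ι)
    (s : ι → Bool) : c.run φ (c.flip s) = φ s := by
  induction c generalizing φ s with
  | nil => rfl
  | cons g c ih =>
    have h : g.act φ (g.flip s) = φ s := by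
      have h₀ := hc g (by simp)
      have h₁ : g.act φ (g.flip s) = φ (g.flip (g.flip s)) := by
        cases g <;> first | rfl | exact h₀.elim
      rw [h₁, Gate.flip_flip]
    exact (ih (fun g' hg' => hc g' (by simp [hg'])) (g.act φ) (g.flip s)).trans h

end

/-! ### Evaluating a finite automaton with a reversible circuit -/

section
variable {n : ℕ} {Q : Type} (δ : Fin n → Q → Bool → Q) (q₀ : Q)

/-- The state of an automaton after reading `m` bits. -/
def autState (e : Fin n → Bool) : ℕ → Q
  | 0 => q₀
  | m + 1 => if h : m < n then δ ⟨m, h⟩ (autState e m) (e ⟨m, h⟩) else autState e m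

variable {ρ : Type} [Fintype ρ] [DecidableEq ρ] [Fintype Q] [DecidableEq Q] (cert : Fin n → ρ)
  (acc : Q → Bool)

/-- The ancillas of the automaton: the two constants, the bits that are read, and the states. -/
abbrev Anc (n : ℕ) (Q : Type) : Type := Bool ⊕ (Fin n ⊕ (Fin (n + 1) × Q))

/-- A bit assignment of the register, the qubit for the result, and the ancillas. -/
def asg (r : ρ → Bool) (v : Bool) (k : Bool → Bool) (e : Fin n → Bool)
    (c : Fin (n + 1) × Q → Bool) : (ρ ⊕ Unit) ⊕ Anc n Q → Bool :=
  Sum.elim (Sum.elim r fun _ => v) (Sum.elim k (Sum.elim e c))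

/-- Add the bits to be read to the ancillas. -/
def copyBits (l : List (Fin n)) : Circuit ((ρ ⊕ Unit) ⊕ Anc n Q) :=
  l.map fun i => .CNOT (.inl (.inl (cert i))) (.inr (.inr (.inl i))) (by simp)

theorem flip_copyBits {l : List (Fin n)} (hl : l.Nodup) (r : ρ → Bool) (v : Bool)
    (k : Bool → Bool) (e : Fin n → Bool) (c : Fin (n + 1) × Q → Bool) :
    (copyBits cert l).flip (asg r v k e c) =
      asg r v k (fun i => if i ∈ l then e i ^^ r (cert i) else e i) c := by
  induction l generalizing e with
  | nil => simp [copyBits, Circuit.flip]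
  | cons i l ih =>
    rw [List.nodup_cons] at hl
    have h₁ : (copyBits (Q := Q) cert (i :: l)).flip (asg r v k e c) =
        (copyBits cert l).flip (asg r v k (Function.update e i (e i ^^ r (cert i))) c) := by
      simp only [copyBits, Circuit.flip, List.map_cons, List.foldl_cons, Gate.flip, asg,
        Sum.elim_inl, Sum.elim_inr, Sum.update_elim_inr, Sum.update_elim_inl]
    rw [h₁, ih hl.2]
    congr 1
    funext j
    by_cases hj : j = i
    · subst hj; simp [hl.1]
    · simp [hj]

/-- One transition of the automaton, for the old states in a list. -/
def transition (i : Fin n) (l : List Q) : Circuit ((ρ ⊕ Unit) ⊕ Anc n Q) :=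
  l.flatMap fun q => [
    .CNOT (.inr (.inr (.inr (i.castSucc, q)))) (.inr (.inr (.inr (i.succ, δ i q false))))
      (by simp [Fin.castSucc_lt_succ.ne]),
    .Toffoli (.inr (.inr (.inl i))) (.inr (.inr (.inr (i.castSucc, q))))
      (.inr (.inr (.inr (i.succ, δ i q false)))) (by simp) (by simp [Fin.castSucc_lt_succ.ne])
      (by simp),
    .Toffoli (.inr (.inr (.inl i))) (.inr (.inr (.inr (i.castSucc, q))))
      (.inr (.inr (.inr (i.succ, δ i q true)))) (by simp) (by simp [Fin.castSucc_lt_succ.ne])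
      (by simp)]

/-- States are stored with one qubit for each state, and only the qubit of the current state `p`
acts as a control. If the bit read is `0`, only the `CNOT` fires. If it is `1`, the first `Toffoli`
cancels the `CNOT` and the second one marks the other successor; this stays correct if the
successors coincide. -/
theorem flip_transition {l : List Q} (hl : l.Nodup) (i : Fin n) (r : ρ → Bool) (v : Bool)
    (k : Bool → Bool) (e : Fin n → Bool) (c : Fin (n + 1) × Q → Bool) (p : Q)
    (hp : ∀ q, c (i.castSucc, q) = decide (q = p)) :
    (transition δ i l).flip (asg r v k e c) =
      asg r v k e (if p ∈ l then Function.update c (i.succ, δ i p (e i))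
        (!c (i.succ, δ i p (e i))) else c) := by
  induction l generalizing c with
  | nil => simp [transition, Circuit.flip]
  | cons q l ih =>
    rw [List.nodup_cons] at hl
    have hne : ∀ q q' : Q, (i.castSucc, q) ≠ (i.succ, q') := fun q q' h =>
      Fin.castSucc_lt_succ.ne (Prod.ext_iff.1 h).1
    have h₁ : (transition (ρ := ρ) δ i (q :: l)).flip (asg r v k e c) =
        (transition δ i l).flip (asg r v k e (if q = p then
          Function.update c (i.succ, δ i p (e i)) (!c (i.succ, δ i p (e i))) else c)) := by
      rw [transition, List.flatMap_cons]
      refine (Circuit.flip_append _ _ _).trans ?_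
      refine congrArg (transition δ i l).flip ?_
      simp only [Circuit.flip, List.foldl_cons, List.foldl_nil, Gate.flip, asg, Sum.elim_inl,
        Sum.elim_inr, Sum.update_elim_inr, Function.update_of_ne (hne _ _), hp]
      congr 3
      by_cases hq : q = p
      · subst hq
        cases h : e i
        · simp
        · simp only [decide_true, Bool.xor_true, Bool.and_true, Function.update_self,
            Function.update_idem, Bool.not_not, Function.update_eq_self, if_true]
      · simp [hq]
    rw [h₁, ih hl.2]
    · by_cases hq : q = p
      · subst hq; simp [hl.1]
      · simp [hq, Ne.symm hq]
    · intro q'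
      split_ifs
      · rw [Function.update_of_ne (hne _ _), hp]
      · exact hp q'

/-- The first `m` transitions of the automaton. -/
def transitions : (m : ℕ) → m ≤ n → Circuit ((ρ ⊕ Unit) ⊕ Anc n Q)
  | 0, _ => []
  | m + 1, h => transitions m (by omega) ++ transition δ ⟨m, h⟩ Finset.univ.toList

/-- Every step has its own layer of state qubits, which is zero until it is written, so toggling
means setting. -/
theorem flip_transitions (m : ℕ) (hm : m ≤ n) (r : ρ → Bool) (v : Bool)
    (k : Bool → Bool) (e : Fin n → Bool) :
    (transitions δ m hm).flip (asg r v k e fun x => decide (x.1 = 0 ∧ x.2 = q₀)) =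
      asg r v k e fun x => decide (x.1 ≤ m ∧ x.2 = autState δ q₀ e x.1) := by
  induction m with
  | zero =>
    simp only [transitions, Circuit.flip, List.foldl_nil]
    congr 1
    funext ⟨j, q⟩
    refine decide_eq_decide.2 ?_
    by_cases hj : j = 0
    · subst hj; simp [autState]
    · have : ¬ (j : ℕ) ≤ 0 := fun h => hj (Fin.ext (by simpa using h))
      simp [hj]
  | succ m ih =>
    rw [transitions]
    refine (Circuit.flip_append _ _ _).trans ?_
    rw [ih (by omega), flip_transition δ (Finset.nodup_toList _) ⟨m, hm⟩ r v k e _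
      (autState δ q₀ e m) (fun q => by simp)]
    rw [if_pos (by simp)]
    congr 1
    funext ⟨j, q⟩
    have hst : δ ⟨m, hm⟩ (autState δ q₀ e m) (e ⟨m, hm⟩) = autState δ q₀ e (m + 1) := by
      rw [autState, dif_pos (show m < n by omega)]
    rw [hst]
    by_cases hj : (j : ℕ) = m + 1
    · have hj' : j = Fin.succ ⟨m, hm⟩ := Fin.ext hj
      subst hj'
      by_cases hq : q = autState δ q₀ e (m + 1)
      · simp [hq]
      · simp [hq]
    · have hj' : (j, q) ≠ (Fin.succ ⟨m, hm⟩, autState δ q₀ e (m + 1)) := fun h =>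
        hj (congrArg Fin.val (Prod.ext_iff.1 h).1)
      rw [Function.update_of_ne hj']
      refine decide_eq_decide.2 (and_congr_left fun _ => ?_)
      dsimp only
      omega

/-- Flip the result if the automaton is in one of the final states in a list. -/
def acceptance (l : List Q) : Circuit ((ρ ⊕ Unit) ⊕ Anc n Q) :=
  l.map fun q => .CNOT (.inr (.inr (.inr (Fin.last n, q)))) (.inl (.inr ())) (by simp)

theorem flip_acceptance {l : List Q} (hl : l.Nodup) (r : ρ → Bool) (v : Bool)
    (k : Bool → Bool) (e : Fin n → Bool) (c : Fin (n + 1) × Q → Bool) (p : Q)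
    (hp : ∀ q, c (Fin.last n, q) = decide (q = p)) :
    (acceptance l).flip (asg r v k e c) = asg r (v ^^ decide (p ∈ l)) k e c := by
  induction l generalizing v with
  | nil => simp [acceptance, Circuit.flip]
  | cons q l ih =>
    rw [List.nodup_cons] at hl
    have h₁ : (acceptance (q :: l)).flip (asg r v k e c) =
        (acceptance l).flip (asg r (v ^^ decide (q = p)) k e c) := by
      simp only [acceptance, Circuit.flip, List.map_cons, List.foldl_cons, Gate.flip, asg,
        Sum.elim_inl, Sum.elim_inr, Sum.update_elim_inl, hp, Sum.update_elim_inr]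
      congr 3
    rw [h₁, ih hl.2]
    congr 1
    by_cases hq : q = p
    · subst hq; simp [hl.1]
    · simp [hq, Ne.symm hq]

/-- The circuit that runs the automaton on the qubits `cert`. -/
def autCircuit : Circuit ((ρ ⊕ Unit) ⊕ Anc n Q) :=
  copyBits cert (List.finRange n) ++ (transitions δ n le_rfl ++
    acceptance (Finset.univ.filter fun q => acc q = true).toList)

/-- The ancillas before the run of the automaton. The bits to be read will be added to `ref`. -/
def ancInit (ref : Fin n → Bool) : Anc n Q → Bool :=
  Sum.elim id (Sum.elim ref fun x => decide (x.1 = 0 ∧ x.2 = q₀))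

/-- The ancillas after the run of the automaton on `e`. -/
def ancFinal (e : Fin n → Bool) : Anc n Q → Bool :=
  Sum.elim id (Sum.elim e fun x => decide (x.2 = autState δ q₀ e x.1))

/-- The ancillas are not uncomputed, on purpose: they keep `ref ⊕ y` for the certificate `y`, and
this record has the effect of measuring `y`. -/
theorem flip_autCircuit (r : ρ → Bool) (ref : Fin n → Bool) :
    (autCircuit δ cert acc).flip (Sum.elim (Sum.elim r fun _ => false) (ancInit q₀ ref)) =
      Sum.elim (Sum.elim r fun _ => acc (autState δ q₀ (fun i => ref i ^^ r (cert i)) n))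
        (ancFinal δ q₀ fun i => ref i ^^ r (cert i)) := by
  have h₀ := flip_copyBits (Q := Q) cert (List.nodup_finRange n) r false id ref
    fun x => decide (x.1 = 0 ∧ x.2 = q₀)
  simp only [List.mem_finRange, if_true] at h₀
  have h₁ := flip_transitions δ q₀ n le_rfl r false id fun i => ref i ^^ r (cert i)
  have h₂ := flip_acceptance (Finset.nodup_toList (Finset.univ.filter fun q => acc q = true)) r
    false id (fun i => ref i ^^ r (cert i))
    (fun x => decide (x.1 ≤ n ∧ x.2 = autState δ q₀ (fun i => ref i ^^ r (cert i)) x.1))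
    (autState δ q₀ (fun i => ref i ^^ r (cert i)) n) (fun q => by simp)
  rw [autCircuit]
  refine (Circuit.flip_append _ _ _).trans ((Circuit.flip_append _ _ _).trans ?_)
  change (acceptance _).flip ((transitions δ n le_rfl).flip ((copyBits cert _).flip
    (asg r false id ref fun x => decide (x.1 = 0 ∧ x.2 = q₀)))) = _
  rw [h₀, h₁, h₂, asg, ancFinal]
  simp [Fin.is_le]

theorem isReversible_autCircuit : ∀ g ∈ autCircuit δ cert acc, g.IsReversible := by
  have ht : ∀ m (hm : m ≤ n), ∀ g ∈ transitions (ρ := ρ) δ m hm, g.IsReversible := by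
    intro m hm
    induction m with
    | zero => simp [transitions]
    | succ m ih =>
      intro g hg
      rcases List.mem_append.1 hg with hg | hg
      · exact ih _ g hg
      · obtain ⟨q, -, hq⟩ := List.mem_flatMap.1 hg
        simp only [List.mem_cons, List.not_mem_nil, or_false] at hq
        rcases hq with rfl | rfl | rfl <;> trivial
  intro g hg
  rcases List.mem_append.1 hg with hg | hg
  · obtain ⟨i, -, rfl⟩ := List.mem_map.1 hg; trivial
  rcases List.mem_append.1 hg with hg | hg
  · exact ht _ _ g hg
  · obtain ⟨i, -, rfl⟩ := List.mem_map.1 hg; trivial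

theorem length_autCircuit_le :
    (autCircuit δ cert acc).length ≤ n + (n * (3 * Fintype.card Q) + Fintype.card Q) := by
  have ht : ∀ m (hm : m ≤ n),
      (transitions (ρ := ρ) δ m hm).length = m * (3 * Fintype.card Q) := by
    intro m hm
    induction m with
    | zero => simp [transitions]
    | succ m ih =>
      refine List.length_append.trans ?_
      rw [ih, transition, List.length_flatMap]
      simp
      ring
  refine List.length_append.trans_le (add_le_add ?_ (List.length_append.trans_le
    (add_le_add (ht _ _).le ?_)))
  · simp [copyBits]
  · rw [acceptance, List.length_map, Finset.length_toList]
    exact Finset.card_filter_le _ _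

theorem Circuit.run_basisVec {ι : Type} [Fintype ι] [DecidableEq ι] (c : Circuit ι)
    (hc : ∀ g ∈ c, g.IsReversible) (z : ι → Bool) : c.run (basisVec z) = basisVec (c.flip z) := by
  funext s
  obtain ⟨t, rfl⟩ := c.flip_surjective s
  rw [Circuit.run_flip c hc, basisVec, basisVec, Pi.single_apply, Pi.single_apply]
  exact if_congr (Finite.injective_iff_surjective.2 c.flip_surjective).eq_iff.symm rfl rfl

theorem eq_sum_basisVec {ι : Type} [Fintype ι] [DecidableEq ι] (φ : Vec ι) : φ = ∑ z, φ z • basisVec z := by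
  funext s
  simp [basisVec, Pi.single_apply]

theorem tensVec_basisVec {ι κ : Type} [Fintype ι] [Fintype κ] (a : ι → Bool) (b : κ → Bool) :
    tensVec (basisVec a) (basisVec b) = basisVec (Sum.elim a b) := by
  funext s
  have h : s = Sum.elim a b ↔ s ∘ Sum.inl = a ∧ s ∘ Sum.inr = b := by
    rw [← Sum.elim_comp_inl_inr s, Sum.elim_eq_iff]
    simp
  by_cases h₁ : s ∘ Sum.inl = a <;> by_cases h₂ : s ∘ Sum.inr = b <;>
    simp [tensVec, basisVec, Pi.single_apply, h, h₁, h₂]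

theorem tensVec_sum_smul {ι κ α : Type} (A : Finset α) (w : α → ℂ) (φ : α → Vec ι)
    (ψ : Vec κ) : tensVec (∑ a ∈ A, w a • φ a) ψ = ∑ a ∈ A, w a • tensVec (φ a) ψ := by
  funext s
  simp [tensVec, Finset.sum_mul, mul_assoc]

/-- The effect of the circuit of the automaton on state vectors. -/
theorem run_autCircuit (Ψ : Vec ρ) (ref : Fin n → Bool) :
    (autCircuit δ cert acc).run (tensVec (tensVec Ψ (basisVec fun _ => false))
      (basisVec (ancInit q₀ ref))) =
    ∑ y : Fin n → Bool, tensVec (tensVec (projVec cert y Ψ)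
      (basisVec fun _ => acc (autState δ q₀ (fun i => ref i ^^ y i) n)))
      (basisVec (ancFinal δ q₀ fun i => ref i ^^ y i)) := by
  have hproj : ∀ y, projVec cert y Ψ =
      ∑ r : ρ → Bool, (if r ∘ cert = y then Ψ r else 0) • basisVec r := fun y =>
    eq_sum_basisVec _
  simp only [hproj, tensVec_sum_smul, tensVec_basisVec]
  rw [Finset.sum_comm]
  conv_lhs => rw [eq_sum_basisVec Ψ]
  simp only [tensVec_sum_smul, tensVec_basisVec, Circuit.run_sum, Circuit.run_smul,
    Circuit.run_basisVec _ (isReversible_autCircuit δ cert acc), flip_autCircuit]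
  refine Finset.sum_congr rfl fun r _ => ?_
  rw [Finset.sum_eq_single (r ∘ cert)]
  · rw [if_pos rfl]; rfl
  · intro y _ hy; rw [if_neg hy.symm, zero_smul]
  · simp

end

/-! ### Tapes -/

theorem readTape_succ {k : ℕ} (z : Fin (k + 1) × Bool → Bool) :
    readTape z = if z (0, false) then z (0, true) :: readTape fun c => z (c.1.succ, c.2)
      else [] := by
  rw [readTape, List.finRange_succ, List.takeWhile_cons]
  split_ifs with h
  · rw [List.map_cons, List.takeWhile_map, List.map_map]
    rfl
  · rfl

/-- Only the cells up to the first unused one matter. Hence a tape may be lengthened by cells with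
arbitrary data behind the end of its string. -/
theorem readTape_eq {k : ℕ} (z : Fin k × Bool → Bool) (l : List Bool) (hl : l.length ≤ k)
    (h₁ : ∀ i : Fin k, (i : ℕ) < l.length → z (i, false) = true ∧ z (i, true) = l.getD i false)
    (h₂ : ∀ i : Fin k, (i : ℕ) = l.length → z (i, false) = false) : readTape z = l := by
  induction k generalizing l with
  | zero =>
    rw [List.length_eq_zero_iff.mp (Nat.le_zero.mp hl)]
    simp [readTape]
  | succ k ih =>
    rw [readTape_succ]
    cases l with
    | nil => rw [h₂ 0 rfl]; rfl
    | cons b l =>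
      obtain ⟨ha, hb⟩ := h₁ 0 (by simp)
      rw [ha, if_pos rfl, hb, ih (fun c => z (c.1.succ, c.2)) l (by simpa using hl)]
      · rfl
      · intro i hi
        simpa using h₁ i.succ (by simpa using hi)
      · intro i hi
        exact h₂ i.succ (by simpa using hi)

theorem readTape_spec {k : ℕ} (z : Fin k × Bool → Bool) :
    (readTape z).length ≤ k ∧
    (∀ i : Fin k, (i : ℕ) < (readTape z).length →
      z (i, false) = true ∧ z (i, true) = (readTape z).getD i false) ∧
    (∀ i : Fin k, (i : ℕ) = (readTape z).length → z (i, false) = false) := by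
  induction k with
  | zero => exact ⟨by simp [readTape], fun i => i.elim0, fun i => i.elim0⟩
  | succ k ih =>
    obtain ⟨h₀, h₁, h₂⟩ := ih fun c => z (c.1.succ, c.2)
    rw [readTape_succ]
    by_cases h : z (0, false) = true
    · rw [if_pos h]
      refine ⟨by simpa using h₀, fun i hi => ?_, fun i hi => ?_⟩
      · cases i using Fin.cases with
        | zero => exact ⟨h, rfl⟩
        | succ i => simpa using h₁ i (by simpa using hi)
      · cases i using Fin.cases with
        | zero => simp at hi
        | succ i => exact h₂ i (by simpa using hi)
    · rw [if_neg h]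
      refine ⟨by simp, fun i hi => by simp at hi, fun i hi => ?_⟩
      have : i = 0 := Fin.ext (by simpa using hi)
      rw [this]
      simpa using h

/-! ### Relabelled registers -/

section
variable {ι κ : Type} [Fintype ι] [DecidableEq ι] [Fintype κ] [DecidableEq κ]

theorem Circuit.run_map_comp (f : ι ↪ κ) (c : Circuit ι) (φ : Vec ι) :
    (c.map f).run (fun s => φ (s ∘ f)) = fun s => c.run φ (s ∘ f) := by
  rw [Circuit.run_map]
  simp only [extend_comp]

theorem Circuit.run_map_inl (c : Circuit ι) (φ : Vec ι) (ψ : Vec κ) :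
    (c.map Function.Embedding.inl).run (tensVec φ ψ) = tensVec (c.run φ) ψ := by
  rw [Circuit.run_map]
  funext s
  have h : ∀ u : ι → Bool,
      tensVec φ ψ (Function.extend (Function.Embedding.inl : ι ↪ ι ⊕ κ) u s) =
      (ψ (s ∘ Sum.inr) • φ) u := by
    intro u
    have h₁ : Function.extend (Function.Embedding.inl : ι ↪ ι ⊕ κ) u s ∘ Sum.inl = u :=
      extend_comp (Function.Embedding.inl : ι ↪ ι ⊕ κ) u s
    have h₂ : Function.extend (Function.Embedding.inl : ι ↪ ι ⊕ κ) u s ∘ Sum.inr =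
        s ∘ Sum.inr := by
      funext j
      exact Function.extend_apply' _ _ _ (by simp)
    rw [tensVec, h₁, h₂, Pi.smul_apply, smul_eq_mul, mul_comm]
  simp only [h]
  change Circuit.run c (ψ (s ∘ Sum.inr) • φ) (s ∘ Sum.inl) = _
  rw [Circuit.run_smul, Pi.smul_apply, smul_eq_mul, mul_comm]
  rfl

theorem normSq_comp (e : ι ≃ κ) (φ : Vec ι) : normSq (fun s => φ (s ∘ e)) = normSq φ :=
  Equiv.sum_comp (e.symm.arrowCongr (Equiv.refl Bool)) fun s => ‖φ s‖ ^ 2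

theorem probVec_comp (e : ι ≃ κ) (i : ι) (φ : Vec ι) :
    probVec (e i) (fun s => φ (s ∘ e)) = probVec i φ :=
  Equiv.sum_comp (e.symm.arrowCongr (Equiv.refl Bool)) fun s => if s i then ‖φ s‖ ^ 2 else 0

/-- Deferred measurement: different labels in the second register make the summands orthogonal, so
there is no interference and probabilities add. -/
theorem probVec_sum_tensVec {α : Type} [Fintype α] (i : ι) (φ : α → Vec ι) (a : α → κ → Bool)
    (ha : Function.Injective a) :
    probVec (.inl i) (∑ y, tensVec (φ y) (basisVec (a y))) = ∑ y, probVec i (φ y) := by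
  classical
  unfold probVec
  rw [← Equiv.sum_comp (Equiv.sumArrowEquivProdArrow ι κ Bool).symm, Fintype.sum_prod_type,
    Finset.sum_comm (s := (Finset.univ : Finset α))]
  refine Finset.sum_congr rfl fun u _ => ?_
  have h : ∀ w : κ → Bool, (∑ y, tensVec (φ y) (basisVec (a y)))
      ((Equiv.sumArrowEquivProdArrow ι κ Bool).symm (u, w)) =
      ∑ y, if w = a y then φ y u else 0 := by
    intro w
    rw [Finset.sum_apply]
    refine Finset.sum_congr rfl fun y _ => ?_
    change φ y u * basisVec (a y) w = _
    simp [basisVec, Pi.single_apply]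
  have h' : ∀ w : κ → Bool, ‖∑ y, if w = a y then φ y u else 0‖ ^ 2 =
      ∑ y, if w = a y then ‖φ y u‖ ^ 2 else 0 := by
    intro w
    by_cases hw : ∃ y, w = a y
    · obtain ⟨y, rfl⟩ := hw
      simp [ha.eq_iff]
    · push Not at hw
      simp [hw]
  simp only [h, h']
  change (∑ w : κ → Bool, if u i = true then (∑ y, if w = a y then ‖φ y u‖ ^ 2 else 0) else 0) = _
  split_ifs
  · rw [Finset.sum_comm]
    simp
  · simp

end

/-! ### The reduction to semantic security -/

section
variable {S : CDWE} {lam : ℕ} (A : S.Adversary lam)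
  (R : List Bool → List Bool → List Bool → Prop) (E : WE)

/-- Outcomes of the first measurement of an attack on certified deletion. -/
abbrev Outcome : Type := (Fin 2 × Fin A.outCells × Bool) ⊕ Bool → Bool

/-- The name of the language that was chosen. -/
def langOf (z : Outcome A) : List Bool := readTape fun c => z (.inl (0, c))

/-- The statement that was chosen. -/
def stmtOf (z : Outcome A) : List Bool := readTape fun c => z (.inl (1, c))

/-- The unnormalised state after the first measurement. -/
def branchVec (z : Outcome A) : Vec (Fin A.work) :=
  projVec (Sum.elim A.out A.msg) z (A.choose.run A.advice)

/-- The unnormalised state before the certificate is measured, if the ciphertext consists of the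
state `χ` and the string `ct`. -/
def midVec (z : Outcome A) (χ : Vec (Fin (S.qubits lam))) (ct : List Bool) : Vec A.Residual :=
  A.delete.run (tensVec (branchVec A z) (tensVec χ (basisVec (writeTape A.ctCells ct))))

/-- The probability of the result `1` if the certificate is measured, the bit `f` of the certificate
is added as a qubit, and the circuit `D` is run. -/
def endProb (f : (Fin (S.certLen lam) → Bool) → Bool) (D : Circuit (A.Residual ⊕ Unit))
    (res : A.Residual ⊕ Unit) (Ψ : Vec A.Residual) : ℝ :=
  ∑ y, probVec res (D.run (tensVec (projVec A.cert y Ψ) (basisVec fun _ => f y)))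

open Classical in
/-- The probability that the attack, continued as in `endProb`, gives the result `1` and the message
bit `β` is `μ`, if the ciphertext consists of the state `χ` and an encryption of `m`. -/
def gameProb (χ : Vec (Fin (S.qubits lam))) (m : List Bool) (β μ : Bool)
    (f : (Fin (S.certLen lam) → Bool) → Bool) (D : Circuit (A.Residual ⊕ Unit))
    (res : A.Residual ⊕ Unit) : ℝ :=
  ∑ z : Outcome A, if inLanguage R (langOf A z) (stmtOf A z) ∨ z (.inr β) ≠ μ then 0
    else avg (E.encCoins lam (langOf A z) (stmtOf A z) m.length) fun r =>
      endProb A f D res (midVec A z χ (E.enc lam (langOf A z) (stmtOf A z) m r))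

variable (Q : Type) [Fintype Q] [DecidableEq Q]

/-- The qubits of the attack on semantic security, apart from the ciphertext. -/
abbrev RedWork : Type :=
  Fin A.work ⊕ (Fin (S.qubits lam) ⊕ (Unit ⊕ Anc (S.certLen lam) Q))

/-- The qubits of the attack on semantic security, arranged for the run of the automaton. -/
def arrange : ((A.Residual ⊕ Unit) ⊕ Anc (S.certLen lam) Q) ≃
    (RedWork A Q ⊕ (Fin A.ctCells × Bool)) where
  toFun
    | .inl (.inl (.inl w)) => .inl (.inl w)
    | .inl (.inl (.inr (.inl i))) => .inl (.inr (.inl i))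
    | .inl (.inl (.inr (.inr c))) => .inr c
    | .inl (.inr u) => .inl (.inr (.inr (.inl u)))
    | .inr a => .inl (.inr (.inr (.inr a)))
  invFun
    | .inl (.inl w) => .inl (.inl (.inl w))
    | .inl (.inr (.inl i)) => .inl (.inl (.inr (.inl i)))
    | .inr c => .inl (.inl (.inr (.inr c)))
    | .inl (.inr (.inr (.inl u))) => .inl (.inr u)
    | .inl (.inr (.inr (.inr a))) => .inr a
  left_inv := by rintro (((w | i | c) | u) | a) <;> rfl
  right_inv := by rintro ((w | i | u | a) | c) <;> rfl

/-- Numbers for the qubits of the attack on semantic security. -/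
def redEquiv : RedWork A Q ≃ Fin (Fintype.card (RedWork A Q)) := Fintype.equivFin _

/-- All qubits of the attack on semantic security. -/
def redAll : ((A.Residual ⊕ Unit) ⊕ Anc (S.certLen lam) Q) ≃
    (Fin (Fintype.card (RedWork A Q)) ⊕ (Fin A.ctCells × Bool)) :=
  (arrange A Q).trans ((redEquiv A Q).sumCongr (Equiv.refl _))

variable (δ : Fin (S.certLen lam) → Q → Bool → Q) (q₀ : Q) (acc : Q → Bool)
  (ref : Fin (S.certLen lam) → Bool) (χ : Vec (Fin (S.qubits lam)))
  (D : Circuit (A.Residual ⊕ Unit)) (res : A.Residual ⊕ Unit)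

/-- The ancillas of the attack on semantic security. -/
def redAnc : Vec (Fin (S.qubits lam) ⊕ (Unit ⊕ Anc (S.certLen lam) Q)) :=
  tensVec χ (tensVec (basisVec fun _ => false) (basisVec (ancInit q₀ ref)))

/-- The second part of the attack on semantic security. -/
def redGuess : Circuit ((A.Residual ⊕ Unit) ⊕ Anc (S.certLen lam) Q) :=
  (A.delete.map .inl).map .inl ++ (autCircuit δ A.cert acc ++ D.map .inl)

-- After the tensor factors are reordered, the three parts of `redGuess` act one after the other:
-- `delete`, the automaton, and `D`. The automaton produces one summand for each certificate `y`,
-- and its final ancillas determine `y`, so the probabilities of the summands add up to `endProb`.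
set_option synthInstance.maxHeartbeats 200000 in
set_option synthInstance.maxSize 1000 in
theorem probVec_redGuess (φ : Vec (Fin A.work)) (w : Fin A.ctCells × Bool → Bool) :
    probVec (redAll A Q (.inl res)) (((redGuess A Q δ acc D).map (redAll A Q).toEmbedding).run
      (tensVec (fun s => tensVec φ (redAnc Q q₀ ref χ) (s ∘ redEquiv A Q)) (basisVec w))) =
    endProb A (fun y => acc (autState δ q₀ (fun i => ref i ^^ y i) (S.certLen lam))) D res
      (A.delete.run (tensVec φ (tensVec χ (basisVec w)))) := by
  have h₁ : (tensVec (fun s => tensVec φ (redAnc Q q₀ ref χ) (s ∘ redEquiv A Q)) (basisVec w)) =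
      fun s => tensVec (tensVec (tensVec φ (tensVec χ (basisVec w))) (basisVec fun _ => false))
        (basisVec (ancInit q₀ ref)) (s ∘ redAll A Q) := by
    funext s
    simp only [tensVec, redAnc]
    have e₁ : (s ∘ redAll A Q) ∘ Sum.inl ∘ Sum.inl ∘ Sum.inr ∘ Sum.inr = s ∘ Sum.inr := rfl
    change φ (fun i => s (redAll A Q (.inl (.inl (.inl i))))) *
      (χ (fun i => s (redAll A Q (.inl (.inl (.inr (.inl i)))))) *
      (basisVec (fun _ : Unit => false) (fun i => s (redAll A Q (.inl (.inr i)))) *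
      basisVec (ancInit q₀ ref) (fun i => s (redAll A Q (.inr i))))) *
      basisVec w (fun i => s (redAll A Q (.inl (.inl (.inr (.inr i)))))) =
      φ (fun i => s (redAll A Q (.inl (.inl (.inl i))))) *
      (χ (fun i => s (redAll A Q (.inl (.inl (.inr (.inl i)))))) *
      basisVec w (fun i => s (redAll A Q (.inl (.inl (.inr (.inr i))))))) *
      (basisVec (fun _ : Unit => false) (fun i => s (redAll A Q (.inl (.inr i))))) *
      basisVec (ancInit q₀ ref) (fun i => s (redAll A Q (.inr i)))
    ring
  rw [h₁]
  have h₂ := Circuit.run_map_comp (redAll A Q).toEmbedding (redGuess A Q δ acc D)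
    (tensVec (tensVec (tensVec φ (tensVec χ (basisVec w))) (basisVec fun _ => false))
        (basisVec (ancInit q₀ ref)))
  refine (congrArg _ h₂).trans ?_
  refine (probVec_comp (redAll A Q) (.inl res) _).trans ?_
  rw [redGuess, Circuit.run_append, Circuit.run_append, Circuit.run_map_inl,
    Circuit.run_map_inl, run_autCircuit, Circuit.run_sum]
  simp only [Circuit.run_map_inl]
  rw [probVec_sum_tensVec]
  · rfl
  · intro y y' h
    funext i
    have := congrFun h (.inr (.inl i))
    simpa [ancFinal] using this

end

set_option synthInstance.maxSize 1000
set_option synthInstance.maxHeartbeats 200000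

/-- Measuring constants, or one qubit several times, yields nothing new: only outcomes of the form
`Sum.elim z id ∘ src` have non-zero amplitude. By `hφ` the constants have their values, and by
`hsrc` every original qubit is still measured, so that `z` can be recovered. -/
theorem sum_projVec_comp {ι κ o : Type} [Fintype ι] [DecidableEq ι] [Fintype κ] [DecidableEq κ]
    [Fintype o] [DecidableEq o] (src : o → κ ⊕ Bool) (place : κ ⊕ Bool → ι) (φ : Vec ι)
    (hφ : ∀ s b, s (place (.inr b)) ≠ b → φ s = 0) (hsrc : ∀ k, ∃ j, src j = .inl k)
    (F : (o → Bool) → Vec ι → ℝ) (hF : ∀ Z, F Z 0 = 0) :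
    ∑ Z, F Z (projVec (place ∘ src) Z φ) =
      ∑ z : κ → Bool, F (Sum.elim z id ∘ src) (projVec (place ∘ .inl) z φ) := by
  have hinj : Function.Injective fun z : κ → Bool => Sum.elim z (id : Bool → Bool) ∘ src := by
    intro z z' h
    funext k
    obtain ⟨j, hj⟩ := hsrc k
    simpa [hj] using congrFun h j
  have hs : ∀ s, φ s ≠ 0 → s ∘ place ∘ src = Sum.elim (s ∘ place ∘ .inl) id ∘ src := by
    intro s h
    funext j
    rcases hj : src j with k | b
    · simp [hj]
    · simp only [Function.comp_apply, hj, Sum.elim_inr, id]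
      by_contra hb
      exact h (hφ s b hb)
  symm
  refine Fintype.sum_of_injective _ hinj _ _ (fun Z hZ => ?_) fun z => ?_
  · have : projVec (place ∘ src) Z φ = 0 := by
      funext s
      by_cases h : φ s = 0
      · simp [projVec, h]
      · rw [projVec, if_neg]
        · rfl
        · rintro rfl
          exact hZ ⟨_, (hs s h).symm⟩
    rw [this, hF]
  · congr 1
    funext s
    by_cases h : φ s = 0
    · simp [projVec, h]
    · refine if_congr ?_ rfl rfl
      rw [hs s h]
      exact hinj.eq_iff.symm

theorem avg_zero (n : ℕ) : avg n (fun _ => (0 : ℝ)) = 0 := by simp [avg]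

section
variable {S : CDWE} {lam : ℕ} (A : S.Adversary lam)
  (R : List Bool → List Bool → List Bool → Prop) (E : WE)
variable (Q : Type) [Fintype Q] [DecidableEq Q]
variable (δ : Fin (S.certLen lam) → Q → Bool → Q) (q₀ : Q) (acc : Q → Bool)
  (ref : Fin (S.certLen lam) → Bool) (χ : Vec (Fin (S.qubits lam)))
  (D : Circuit (A.Residual ⊕ Unit)) (res : A.Residual ⊕ Unit) (m₀ m₁ : List Bool) (β μ : Bool)

/-- What is measured in the attack on semantic security: a qubit that is measured in the attack on
certified deletion, or a constant. The two messages have the same length if and only if the message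
bit `β` is `μ`. -/
def redSrc : Fin 4 × Fin (A.outCells + m₀.length + 2) × Bool →
    ((Fin 2 × Fin A.outCells × Bool) ⊕ Bool) ⊕ Bool
  | (0, j, fl) =>
      if h : (j : ℕ) < A.outCells then .inl (.inl (0, ⟨j, h⟩, fl))
      else if fl then .inl (.inr (decide ((j : ℕ) ≠ A.outCells))) else .inr false
  | (1, j, fl) => if h : (j : ℕ) < A.outCells then .inl (.inl (1, ⟨j, h⟩, fl)) else .inr false
  | (2, j, true) => .inr (m₀.getD j false)
  | (2, j, false) => .inr (decide ((j : ℕ) < m₀.length))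
  | (3, j, true) => .inr (m₁.getD j false)
  | (3, j, false) =>
      if (j : ℕ) < m₀.length then (if μ then .inl (.inr β) else .inr true)
      else if (j : ℕ) = m₀.length ∧ μ = false then .inl (.inr β) else .inr false

/-- The place of a measured qubit or constant. -/
def redPlace : ((Fin 2 × Fin A.outCells × Bool) ⊕ Bool) ⊕ Bool →
    Fin (Fintype.card (RedWork A Q))
  | .inl o => redEquiv A Q (.inl (Sum.elim A.out A.msg o))
  | .inr b => redEquiv A Q (.inr (.inr (.inr (.inl b))))

theorem normSq_redAnc (hχ : normSq χ = 1) : normSq (redAnc Q q₀ ref χ) = 1 := by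
  rw [redAnc, normSq_tensVec, normSq_tensVec, normSq_basisVec, normSq_basisVec, hχ]
  norm_num

/-- The attack on semantic security. -/
def reduction (hχ : normSq χ = 1) : WE.Adversary where
  work := Fintype.card (RedWork A Q)
  advice := fun s => tensVec A.advice (redAnc Q q₀ ref χ) (s ∘ redEquiv A Q)
  advice_unit := by
    refine (normSq_comp (redEquiv A Q) _).trans ?_
    rw [normSq_tensVec, normSq_redAnc Q q₀ ref χ hχ, mul_one]
    exact A.advice_unit
  choose := (A.choose.map .inl).map (redEquiv A Q).toEmbedding
  outCells := A.outCells + m₀.length + 2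
  out := redPlace A Q ∘ redSrc A m₀ m₁ β μ
  ctCells := A.ctCells
  guess := (redGuess A Q δ acc D).map (redAll A Q).toEmbedding
  result := redAll A Q (.inl res)

/-- Both message qubits have to be measured as in the original attack, even if their values are not
used. They are put into data qubits of the first tape behind `A.outCells`, in cells that are flagged
as unused. -/
theorem exists_redSrc (k : (Fin 2 × Fin A.outCells × Bool) ⊕ Bool) :
    ∃ j, redSrc A m₀ m₁ β μ j = .inl k := by
  rcases k with ⟨t, c, fl⟩ | b
  · fin_cases t
    · exact ⟨(0, ⟨c, by omega⟩, fl), by simp [redSrc]⟩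
    · exact ⟨(1, ⟨c, by omega⟩, fl), by simp [redSrc]⟩
  · cases b
    · exact ⟨(0, ⟨A.outCells, by omega⟩, true), by simp [redSrc]⟩
    · exact ⟨(0, ⟨A.outCells + 1, by omega⟩, true), by simp [redSrc]⟩

theorem readTape_redSrc_zero (z : Outcome A) :
    (readTape fun c => (Sum.elim z id ∘ redSrc A m₀ m₁ β μ) (0, c)) = langOf A z := by
  obtain ⟨h₀, h₁, h₂⟩ := readTape_spec fun c => z (.inl (0, c))
  rw [show (readTape fun c => z (.inl (0, c))) = langOf A z from rfl] at h₀ h₁ h₂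
  refine readTape_eq _ _ (h₀.trans (by omega)) (fun i hi => ?_) fun i hi => ?_
  · have hi' : (i : ℕ) < A.outCells := hi.trans_le h₀
    simpa [redSrc, hi'] using h₁ ⟨i, hi'⟩ hi
  · by_cases hi' : (i : ℕ) < A.outCells
    · simpa [redSrc, hi'] using h₂ ⟨i, hi'⟩ hi
    · simp [redSrc, hi']

theorem readTape_redSrc_one (z : Outcome A) :
    (readTape fun c => (Sum.elim z id ∘ redSrc A m₀ m₁ β μ) (1, c)) = stmtOf A z := by
  obtain ⟨h₀, h₁, h₂⟩ := readTape_spec fun c => z (.inl (1, c))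
  rw [show (readTape fun c => z (.inl (1, c))) = stmtOf A z from rfl] at h₀ h₁ h₂
  refine readTape_eq _ _ (h₀.trans (by omega)) (fun i hi => ?_) fun i hi => ?_
  · have hi' : (i : ℕ) < A.outCells := hi.trans_le h₀
    simpa [redSrc, hi'] using h₁ ⟨i, hi'⟩ hi
  · by_cases hi' : (i : ℕ) < A.outCells
    · simpa [redSrc, hi'] using h₂ ⟨i, hi'⟩ hi
    · simp [redSrc, hi']

theorem readTape_redSrc_two (z : Outcome A) :
    (readTape fun c => (Sum.elim z id ∘ redSrc A m₀ m₁ β μ) (2, c)) = m₀ :=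
  readTape_eq _ _ (by omega) (fun i hi => by simp [redSrc, hi]) fun i hi => by simp [redSrc, hi]

theorem readTape_redSrc_three (hm : m₁.length = m₀.length) (z : Outcome A) (hz : z (.inr β) = μ) :
    (readTape fun c => (Sum.elim z id ∘ redSrc A m₀ m₁ β μ) (3, c)) = m₁ := by
  refine readTape_eq _ _ (by omega) (fun i hi => ?_) fun i hi => ?_
  · rw [hm] at hi
    cases μ <;> simp [redSrc, hi, hz]
  · rw [hm] at hi
    cases μ <;> simp [redSrc, hi, hz]

/-- A wrong bit makes the fourth tape empty if `μ` is `true`, and flags one cell too many if `μ` is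
`false`. The empty tape has the wrong length because of `hm`. -/
theorem length_readTape_redSrc_three (hm : 0 < m₀.length) (z : Outcome A)
    (hz : z (.inr β) ≠ μ) :
    m₀.length ≠ (readTape fun c => (Sum.elim z id ∘ redSrc A m₀ m₁ β μ) (3, c)).length := by
  obtain ⟨-, h₁, h₂⟩ := readTape_spec fun c => (Sum.elim z id ∘ redSrc A m₀ m₁ β μ) (3, c)
  intro h
  rw [← h] at h₁ h₂
  cases μ
  · have := h₂ ⟨m₀.length, by omega⟩ rfl
    simp [redSrc] at this hz
    simp [this] at hz
  · have := (h₁ ⟨0, by omega⟩ hm).1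
    simp [redSrc, hm] at this hz
    simp [this] at hz

theorem avg_congr {n : ℕ} {f g : List Bool → ℝ} (h : ∀ r, f r = g r) : avg n f = avg n g :=
  congrArg (avg n) (funext h)

/-- The abort on unequal lengths implements the restriction to outcomes whose message bit `β` is
`μ`. On all other outcomes the two messages are the constants `m₀` and `m₁`. -/
theorem prob_reduction (hχ : normSq χ = 1) (hm : m₁.length = m₀.length) (hm₀ : 0 < m₀.length)
    (b : Bool) :
    (reduction A Q δ q₀ acc ref χ D res m₀ m₁ β μ hχ).prob E R lam b =
      gameProb A R E χ (if b then m₁ else m₀) β μ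
        (fun y => acc (autState δ q₀ (fun i => ref i ^^ y i) (S.certLen lam))) D res := by
  classical
  unfold WE.Adversary.prob
  simp only [Circuit.apply_pureState, collapse_pureState, basisState_eq, tensor_pureState,
    probOne_pureState]
  have key := sum_projVec_comp (redSrc A m₀ m₁ β μ) (redPlace A Q)
    (fun s => tensVec (A.choose.run A.advice) (redAnc Q q₀ ref χ) (s ∘ redEquiv A Q))
    ?_ (exists_redSrc A m₀ m₁ β μ)
    (fun Z φ =>
      if inLanguage R (readTape fun c => Z (0, c)) (readTape fun c => Z (1, c)) ∨
        (readTape fun c => Z (2, c)).length ≠ (readTape fun c => Z (3, c)).length then 0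
      else avg (E.encCoins lam (readTape fun c => Z (0, c)) (readTape fun c => Z (1, c))
        (if b then readTape fun c => Z (3, c) else readTape fun c => Z (2, c)).length) fun r =>
        probVec (redAll A Q (.inl res)) (((redGuess A Q δ acc D).map (redAll A Q).toEmbedding).run
          (tensVec φ (basisVec (writeTape A.ctCells (E.enc lam (readTape fun c => Z (0, c))
            (readTape fun c => Z (1, c)) (if b then readTape fun c => Z (3, c)
              else readTape fun c => Z (2, c)) r))))))
    ?_
  · have hchoose : (reduction A Q δ q₀ acc ref χ D res m₀ m₁ β μ hχ).choose.run
        (reduction A Q δ q₀ acc ref χ D res m₀ m₁ β μ hχ).advice =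
        fun s => tensVec (A.choose.run A.advice) (redAnc Q q₀ ref χ) (s ∘ redEquiv A Q) := by
      refine (Circuit.run_map_comp (redEquiv A Q).toEmbedding (A.choose.map .inl)
        (tensVec A.advice (redAnc Q q₀ ref χ))).trans ?_
      rw [Circuit.run_map_inl]
      rfl
    rw [hchoose]
    refine key.trans ?_
    unfold gameProb
    refine Finset.sum_congr rfl fun z _ => ?_
    simp only [readTape_redSrc_zero, readTape_redSrc_one, readTape_redSrc_two]
    by_cases hz : z (.inr β) = μ
    · rw [readTape_redSrc_three A m₀ m₁ β μ hm z hz]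
      by_cases h : inLanguage R (langOf A z) (stmtOf A z)
      · rw [if_pos (Or.inl h), if_pos (Or.inl h)]
      · rw [if_neg (not_or.2 ⟨h, by simp [hm]⟩), if_neg (not_or.2 ⟨h, by simp [hz]⟩)]
        refine avg_congr fun r => ?_
        have hp : projVec (redPlace A Q ∘ .inl) z (fun s => tensVec (A.choose.run A.advice)
            (redAnc Q q₀ ref χ) (s ∘ redEquiv A Q)) =
            fun s => tensVec (branchVec A z) (redAnc Q q₀ ref χ) (s ∘ redEquiv A Q) := by
          funext s
          simp only [branchVec, projVec, tensVec, ite_mul, zero_mul]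
          rfl
        rw [hp, probVec_redGuess]
        rfl
    · rw [if_pos (Or.inr (length_readTape_redSrc_three A m₀ m₁ β μ hm₀ z hz)),
        if_pos (Or.inr hz)]
  -- The ancillas contain the constants in a basis state, so their factor vanishes on assignments
  -- with a wrong constant.
  · intro s b hb
    have h : basisVec (ancInit q₀ ref) ((s ∘ redEquiv A Q) ∘ Sum.inr ∘ Sum.inr ∘ Sum.inr) = 0 := by
      refine Pi.single_eq_of_ne (fun h => hb ?_) _
      exact congrFun h (.inl b)
    change _ * (_ * (_ * basisVec (ancInit q₀ ref)
      ((s ∘ redEquiv A Q) ∘ Sum.inr ∘ Sum.inr ∘ Sum.inr))) = 0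
    rw [h, mul_zero, mul_zero, mul_zero]
  · intro Z
    have h : ∀ w : Fin A.ctCells × Bool → Bool,
        tensVec (0 : Vec (Fin (Fintype.card (RedWork A Q)))) (basisVec w) = 0 := fun w => by
      funext s; simp [tensVec]
    simp only [h, Circuit.run_zero]
    simp [probVec, avg_zero]

theorem size_reduction_le (hχ : normSq χ = 1) :
    (reduction A Q δ q₀ acc ref χ D res m₀ m₁ β μ hχ).size ≤
      A.size + A.size + S.qubits lam + 10 * (S.certLen lam + 1) * (Fintype.card Q + 1) + D.length +
        m₀.length := by
  have hw : Fintype.card (RedWork A Q) = A.work + (S.qubits lam + (1 + (2 + (S.certLen lam +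
      (S.certLen lam + 1) * Fintype.card Q)))) := by simp
  have hg : (redGuess A Q δ acc D).length ≤ A.delete.length + (S.certLen lam + (S.certLen lam *
      (3 * Fintype.card Q) + Fintype.card Q) + D.length) := by
    refine List.length_append.trans_le (add_le_add ?_ (List.length_append.trans_le
      (add_le_add (length_autCircuit_le _ _ _) ?_)))
    · rw [Circuit.length_map, Circuit.length_map]
    · rw [Circuit.length_map]
  simp only [WE.Adversary.size, reduction, Circuit.length_map, hw, CDWE.Adversary.size]
  nlinarith

end

/-! ### Negligible functions -/

theorem Negligible.of_le {f g : ℕ → ℝ} (hg : Negligible g) (h₀ : ∀ n, 0 ≤ f n)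
    (h : ∀ n, f n ≤ g n) : Negligible f :=
  Asymptotics.SuperpolynomialDecay.trans_abs_le hg fun n => by
    rw [abs_of_nonneg (h₀ n)]; exact (h n).trans (le_abs_self _)

theorem Negligible.add {f g : ℕ → ℝ} (hf : Negligible f) (hg : Negligible g) :
    Negligible fun n => f n + g n := Asymptotics.SuperpolynomialDecay.add hf hg

theorem Negligible.const_mul {f : ℕ → ℝ} (hf : Negligible f) (c : ℝ) :
    Negligible fun n => c * f n := Asymptotics.SuperpolynomialDecay.const_mul hf c

theorem Negligible.zero : Negligible fun _ => 0 :=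
  Asymptotics.superpolynomialDecay_zero Filter.atTop fun n : ℕ => (n : ℝ)

/-- Decay of `f` against the power `2 * z` gives decay of its root against the power `z`. -/
theorem Negligible.sqrt {f : ℕ → ℝ} (hf : Negligible f) :
    Negligible fun n => √(f n) := by
  intro z
  have h := (hf (2 * z)).sqrt
  rw [Real.sqrt_zero] at h
  refine h.congr fun n => ?_
  rw [Real.sqrt_mul (by positivity), mul_comm 2, pow_mul, Real.sqrt_sq (by positivity)]

theorem negligible_geometric {r : ℝ} (h₀ : 0 ≤ r) (h₁ : r < 1) : Negligible fun n => r ^ n :=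
  fun z => tendsto_pow_const_mul_const_pow_of_lt_one z h₀ h₁

/-- Negligible functions are uniformly negligible over finite choices. -/
theorem exists_negligible_bound {T : ℕ → Type} [∀ n, Finite (T n)] [∀ n, Nonempty (T n)]
    (g : (n : ℕ) → T n → ℝ) (hg : ∀ t : (n : ℕ) → T n, Negligible fun n => g n (t n)) :
    ∃ ν, Negligible ν ∧ ∀ n t, g n t ≤ ν n := by
  -- The maximisers for all `n` form one family `t`, to which `hg` applies.
  choose t ht using fun n => Finite.exists_max (g n)
  exact ⟨_, hg t, ht⟩

theorem PolyBounded.of_le {f g : ℕ → ℕ} (hg : PolyBounded g) (h : ∀ n, f n ≤ g n) :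
    PolyBounded f := by
  obtain ⟨P, hP⟩ := hg
  exact ⟨P, fun n => (h n).trans (hP n)⟩

theorem PolyBounded.add {f g : ℕ → ℕ} (hf : PolyBounded f) (hg : PolyBounded g) :
    PolyBounded fun n => f n + g n := by
  obtain ⟨P, hP⟩ := hf
  obtain ⟨P', hP'⟩ := hg
  exact ⟨P + P', fun n => by rw [Polynomial.eval_add]; exact add_le_add (hP n) (hP' n)⟩

theorem PolyBounded.mul {f g : ℕ → ℕ} (hf : PolyBounded f) (hg : PolyBounded g) :
    PolyBounded fun n => f n * g n := by
  obtain ⟨P, hP⟩ := hf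
  obtain ⟨P', hP'⟩ := hg
  exact ⟨P * P', fun n => by rw [Polynomial.eval_mul]; exact Nat.mul_le_mul (hP n) (hP' n)⟩

theorem PolyBounded.const (c : ℕ) : PolyBounded fun _ => c := ⟨Polynomial.C c, by simp⟩

theorem PolyBounded.id : PolyBounded fun n => n := ⟨Polynomial.X, by simp⟩

/-! ### An automaton that tests zeros and counts ones -/

section
variable {n : ℕ} (θ : Fin n → Bool)

/-- Count the ones, and remember whether there was one at a position in `θ`. -/
def countStep (i : Fin n) (q : Fin (n + 1) × Bool) (b : Bool) : Fin (n + 1) × Bool :=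
  (q.1 + if b then 1 else 0, q.2 && !(θ i && b))

theorem autState_countStep (e : Fin n → Bool) (m : ℕ) :
    autState (countStep θ) (0, true) e m =
      (Fin.ofNat (n + 1) (∑ j ∈ Finset.range m, if h : j < n then (e ⟨j, h⟩).toNat else 0),
        decide (∀ i : Fin n, (i : ℕ) < m → θ i = true → e i = false)) := by
  induction m with
  | zero => simp [autState]
  | succ m ih =>
    rw [autState, ih, Finset.sum_range_succ]
    split_ifs with h
    · refine Prod.ext ?_ ?_
      · refine Fin.ext ?_
        cases e ⟨m, h⟩ <;> simp [countStep, Fin.ofNat, Fin.val_add]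
      · simp only [countStep]
        rw [Bool.eq_iff_iff]
        simp only [Bool.and_eq_true, decide_eq_true_eq, Bool.not_eq_true', Bool.and_eq_false_iff]
        constructor
        · rintro ⟨h₁, h₂⟩ i hi hθ
          rcases (Nat.lt_succ_iff_lt_or_eq.1 hi) with hi | hi
          · exact h₁ i hi hθ
          · have : i = ⟨m, h⟩ := Fin.ext hi
            subst this
            simpa [hθ] using h₂
        · intro h₁
          refine ⟨fun i hi => h₁ i (by omega), ?_⟩
          have := h₁ ⟨m, h⟩ (by simp)
          cases hθ : θ ⟨m, h⟩
          · simp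
          · simp [this hθ]
    · refine Prod.ext (by simp) ?_
      simp only [decide_eq_decide]
      exact forall_congr' fun i => by simp [show (i : ℕ) < m by omega, show (i : ℕ) < m + 1 by omega]

/-- Accept if there was no one at a position in `θ` and the number of ones is in `G`. -/
def countAcc (G : ℕ → Bool) (q : Fin (n + 1) × Bool) : Bool := q.2 && G q.1

theorem countAcc_autState (G : ℕ → Bool) (e : Fin n → Bool) :
    countAcc G (autState (countStep θ) (0, true) e n) =
      (decide (∀ i, θ i = true → e i = false) &&
        G (Finset.univ.filter fun i => e i = true).card) := by
  have h : (∑ j ∈ Finset.range n, if h : j < n then (e ⟨j, h⟩).toNat else 0) =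
      (Finset.univ.filter fun i => e i = true).card := by
    rw [← Fin.sum_univ_eq_sum_range (fun j => if h : j < n then (e ⟨j, h⟩).toNat else 0),
      Finset.card_filter]
    refine Finset.sum_congr rfl fun i _ => ?_
    cases h : e i <;> simp [h]
  -- The automaton counts modulo `n + 1`; with at most `n` ones the counter never wraps around.
  have h' : (Finset.univ.filter fun i => e i = true).card < n + 1 :=
    Nat.lt_succ_of_le ((Finset.card_le_univ _).trans (by simp))
  rw [autState_countStep, h, countAcc]
  congr 1
  · simp
  · simp only [Fin.ofNat, Nat.mod_eq_of_lt h']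

/-- The test of a certificate `y`: it agrees with `ref` at the positions in `θ`, and the number of
disagreements is in `G`. -/
def certTest (ref : Fin n → Bool) (G : ℕ → Bool) (y : Fin n → Bool) : Bool :=
  decide (∀ i, θ i = true → ref i = y i) && G (Finset.univ.filter fun i => ref i ≠ y i).card

theorem countAcc_eq_certTest (ref : Fin n → Bool) (G : ℕ → Bool) (y : Fin n → Bool) :
    countAcc G (autState (countStep θ) (0, true) (fun i => ref i ^^ y i) n) =
      certTest θ ref G y := by
  rw [countAcc_autState, certTest]
  simp

end

/-! ### Replacing the encrypted message -/

/-- The only use of semantic security. A parameter in `T lam` collects what the reduction receives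
as advice or as constants, so the worst parameter may be inserted. The counting automaton has `2 *
(certLen + 1)` states, which keeps the reduction polynomial for every set `G`, computable or not. -/
theorem exists_gameProb_bound {S : CDWE} (hq : PolyBounded S.qubits) (hc : PolyBounded S.certLen)
    {R : List Bool → List Bool → List Bool → Prop} {E : WE} (hE : E.PostQuantumSecure R)
    (A : (lam : ℕ) → S.Adversary lam) (hA : PolyBounded fun lam => (A lam).size)
    (D : (lam : ℕ) → Circuit ((A lam).Residual ⊕ Unit)) (hD : PolyBounded fun lam => (D lam).length)
    (res : (lam : ℕ) → (A lam).Residual ⊕ Unit)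
    {T : ℕ → Type} [∀ n, Finite (T n)] [∀ n, Nonempty (T n)]
    (χ : (lam : ℕ) → T lam → Vec (Fin (S.qubits lam))) (hχ : ∀ lam t, normSq (χ lam t) = 1)
    (θ ref : (lam : ℕ) → T lam → Fin (S.certLen lam) → Bool) (G : (lam : ℕ) → T lam → ℕ → Bool)
    (m₀ m₁ : (lam : ℕ) → T lam → List Bool) (L : ℕ → ℕ) (hL : PolyBounded L) (hL₀ : ∀ lam, 0 < L lam)
    (hm₀ : ∀ lam t, (m₀ lam t).length = L lam) (hm₁ : ∀ lam t, (m₁ lam t).length = L lam)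
    (β μ : (lam : ℕ) → T lam → Bool) :
    ∃ ν, Negligible ν ∧ ∀ lam t,
      |gameProb (A lam) R E (χ lam t) (m₀ lam t) (β lam t) (μ lam t)
          (certTest (θ lam t) (ref lam t) (G lam t)) (D lam) (res lam) -
        gameProb (A lam) R E (χ lam t) (m₁ lam t) (β lam t) (μ lam t)
          (certTest (θ lam t) (ref lam t) (G lam t)) (D lam) (res lam)| ≤ ν lam := by
  refine exists_negligible_bound _ fun t => ?_
  have h := hE (fun lam => reduction (A lam) (Fin (S.certLen lam + 1) × Bool)
    (countStep (θ lam (t lam))) (0, true) (countAcc (G lam (t lam))) (ref lam (t lam))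
    (χ lam (t lam)) (D lam) (res lam) (m₀ lam (t lam)) (m₁ lam (t lam)) (β lam (t lam))
    (μ lam (t lam)) (hχ lam (t lam))) ?_
  · simpa only [prob_reduction _ R E _ _ _ _ _ _ _ _ _ _ _ _ (hχ _ _)
      ((hm₁ _ _).trans (hm₀ _ _).symm) ((hL₀ _).trans_eq (hm₀ _ _).symm), countAcc_eq_certTest,
      if_true, if_false, Bool.false_eq_true] using h
  · refine PolyBounded.of_le ((((hA.add hA).add hq).add ((((PolyBounded.const 10).mul
      (hc.add (.const 1))).mul (((hc.add (.const 1)).mul (.const 2)).add (.const 1))))).add hD |>.add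
      hL) fun lam => ?_
    refine (size_reduction_le _ _ _ _ _ _ _ _ _ _ _ _ _ (hχ _ _)).trans_eq ?_
    rw [hm₀]
    simp

/-! ### Product vectors and conjugate coding -/

section
variable {n : ℕ}

/-- Product vectors. -/
def prodVec (a : Fin n → Bool → ℂ) : Vec (Fin n) := fun s => ∏ i, a i (s i)

/-- The Hadamard gate on one qubit. -/
def hadOp (g : Bool → ℂ) : Bool → ℂ := fun b =>
  (g false + (if b then -1 else 1) * g true) / (Real.sqrt 2 : ℂ)

theorem sqrt_two_sq : (Real.sqrt 2 : ℂ) ^ 2 = 2 := by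
  rw [← Complex.ofReal_pow, Real.sq_sqrt (by norm_num)]
  norm_num

theorem sqrt_two_ne_zero : (Real.sqrt 2 : ℂ) ≠ 0 := by
  intro h
  have := sqrt_two_sq
  rw [h] at this
  norm_num at this

theorem hadOp_hadOp (g : Bool → ℂ) : hadOp (hadOp g) = g := by
  have h := sqrt_two_sq
  have h₀ := sqrt_two_ne_zero
  funext b
  cases b <;> simp only [hadOp, if_true, if_false, Bool.false_eq_true] <;> field_simp <;>
    rw [h] <;> ring

theorem prodVec_update (a : Fin n → Bool → ℂ) (i : Fin n) (s : Fin n → Bool) (b : Bool) :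
    prodVec a (Function.update s i b) = a i b * ∏ j ∈ Finset.univ.erase i, a j (s j) := by
  rw [prodVec, ← Finset.mul_prod_erase _ _ (Finset.mem_univ i), Function.update_self]
  congr 1
  refine Finset.prod_congr rfl fun j hj => ?_
  rw [Function.update_of_ne (Finset.ne_of_mem_erase hj)]

theorem prodVec_update_left (a : Fin n → Bool → ℂ) (i : Fin n) (s : Fin n → Bool)
    (g : Bool → ℂ) :
    prodVec (Function.update a i g) s = g (s i) * ∏ j ∈ Finset.univ.erase i, a j (s j) := by
  rw [prodVec, ← Finset.mul_prod_erase _ _ (Finset.mem_univ i), Function.update_self]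
  congr 1
  refine Finset.prod_congr rfl fun j hj => ?_
  rw [Function.update_of_ne (Finset.ne_of_mem_erase hj)]

theorem act_H_prodVec (i : Fin n) (a : Fin n → Bool → ℂ) :
    (Gate.H i).act (prodVec a) = prodVec (Function.update a i (hadOp (a i))) := by
  funext s
  simp only [Gate.act, prodVec_update, prodVec_update_left, hadOp]
  ring

theorem act_X_prodVec (i : Fin n) (a : Fin n → Bool → ℂ) :
    (Gate.X i).act (prodVec a) = prodVec (Function.update a i fun b => a i (!b)) := by
  funext s
  simp only [Gate.act, prodVec_update, prodVec_update_left]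

theorem run_map_prodVec (g : Fin n → Gate (Fin n)) (f : (Bool → ℂ) → Bool → ℂ)
    (h : ∀ i a, (g i).act (prodVec a) = prodVec (Function.update a i (f (a i))))
    {l : List (Fin n)} (hl : l.Nodup) (a : Fin n → Bool → ℂ) :
    Circuit.run (l.map g) (prodVec a) = prodVec fun i => if i ∈ l then f (a i) else a i := by
  induction l generalizing a with
  | nil => simp [Circuit.run]
  | cons i l ih =>
    rw [List.nodup_cons] at hl
    rw [List.map_cons, Circuit.run, h, ih hl.2]
    congr 1
    funext j
    by_cases hj : j = i
    · subst hj; simp [hl.1]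
    · simp [hj]

theorem run_basisChange (θ : Fin n → Bool) (a : Fin n → Bool → ℂ) :
    (basisChange θ).run (prodVec a) = prodVec fun i => if θ i then hadOp (a i) else a i := by
  rw [basisChange, run_map_prodVec _ hadOp act_H_prodVec ((List.nodup_finRange n).filter _)]
  simp

/-- The amplitudes of a basis vector of one qubit. -/
def bitVec (x : Bool) : Bool → ℂ := fun s => if s = x then 1 else 0

theorem basisVec_eq_prodVec (x : Fin n → Bool) : basisVec x = prodVec fun i => bitVec (x i) := by
  funext s
  rw [basisVec, Pi.single_apply, prodVec]
  simp only [bitVec, Finset.prod_ite_zero, Finset.prod_const_one, funext_iff, Finset.mem_univ,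
    true_imp_iff]

/-- The vector `|x⟩_θ`. -/
def bb84 (x θ : Fin n → Bool) : Vec (Fin n) :=
  prodVec fun i => if θ i then hadOp (bitVec (x i)) else bitVec (x i)

theorem run_prepareBB84 (x θ : Fin n → Bool) :
    (prepareBB84 x θ).run (basisVec fun _ => false) = bb84 x θ := by
  rw [prepareBB84, Circuit.run_append, basisVec_eq_prodVec,
    run_map_prodVec _ (fun a b => a (!b)) act_X_prodVec ((List.nodup_finRange n).filter _),
    run_basisChange]
  unfold bb84
  congr 1
  funext i
  have : (if i ∈ (List.finRange n).filter fun i => x i then fun b => bitVec false (!b)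
      else bitVec false) = bitVec (x i) := by
    cases hx : x i
    · simp [hx]
    · funext b; simp [hx, bitVec]
  rw [this]

theorem normSq_bb84 (x θ : Fin n → Bool) : normSq (bb84 x θ) = 1 := by
  rw [← run_prepareBB84, Circuit.normSq_run, normSq_basisVec]

theorem basisChange_bb84 (x θ : Fin n → Bool) : (basisChange θ).run (bb84 x θ) = basisVec x := by
  rw [bb84, run_basisChange, basisVec_eq_prodVec]
  congr 1
  funext i
  split_ifs <;> simp [hadOp_hadOp]

/-- On a qubit with `θ i = 1` the two Hadamard gates cancel, so the outcome is `x i` with certainty.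
-/
theorem hadamard_bb84_apply_eq_zero (x θ y : Fin n → Bool) (i : Fin n) (hθ : θ i = true)
    (hi : x i ≠ y i) : (basisChange fun _ => true).run (bb84 x θ) y = 0 := by
  rw [bb84, run_basisChange, prodVec]
  refine Finset.prod_eq_zero (Finset.mem_univ i) ?_
  simp [hθ, hadOp_hadOp, bitVec, hi.symm]

/-! ### Averages -/

theorem avg_add {M : Type*} [AddCommMonoid M] [Module ℝ M] (a b : ℕ) (f : List Bool → M) :
    avg (a + b) f = avg a fun u => avg b fun v => f (u ++ v) := by
  unfold avg
  rw [← Equiv.sum_comp (Fin.appendEquiv a b), Fintype.sum_prod_type, pow_add, mul_inv, mul_smul,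
    Finset.smul_sum]
  simp only [Fin.appendEquiv, Equiv.coe_fn_mk, List.ofFn_fin_append]

theorem avg_const {M : Type*} [AddCommMonoid M] [Module ℝ M] (n : ℕ) (c : M) :
    avg n (fun _ => c) = c := by
  rw [avg, Finset.sum_const, Finset.card_univ, Fintype.card_fun, Fintype.card_bool,
    Fintype.card_fin, ← Nat.cast_smul_eq_nsmul ℝ, smul_smul]
  push_cast
  rw [inv_mul_cancel₀ (by positivity), one_smul]

theorem avg_le_avg {n : ℕ} {f g : List Bool → ℝ} (h : ∀ r, f r ≤ g r) : avg n f ≤ avg n g :=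
  mul_le_mul_of_nonneg_left (Finset.sum_le_sum fun _ _ => h _) (by positivity)

theorem segment_append (x : Fin n → Bool) (l : List Bool) :
    segment n 0 (List.ofFn x ++ l) = x := by
  funext i
  simp [segment, List.getElem?_append_left]

theorem segment_append_append (x θ : Fin n → Bool) (l : List Bool) :
    segment n n (List.ofFn x ++ (List.ofFn θ ++ l)) = θ := by
  funext i
  simp [segment, List.getElem?_append_right, List.getElem?_append_left]

/-- Averages over the coins of the encryption with certified deletion. -/
theorem avg_coins {M : Type*} [AddCommMonoid M] [Module ℝ M] (k : ℕ)
    (f : (Fin n → Bool) → (Fin n → Bool) → List Bool → M) :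
    (avg (n + n + k) fun r => f (segment n 0 r) (segment n n r) (r.drop (n + n))) =
      ((2 : ℝ) ^ n)⁻¹ • ∑ x, ((2 : ℝ) ^ n)⁻¹ • ∑ θ, avg k (f x θ) := by
  rw [avg_add, avg_add, avg]
  congr 1
  refine Finset.sum_congr rfl fun x _ => ?_
  rw [avg]
  congr 1
  refine Finset.sum_congr rfl fun θ _ => ?_
  refine congrArg (avg k) (funext fun r => ?_)
  rw [List.append_assoc, segment_append, segment_append_append]
  congr 1
  rw [← List.append_assoc, List.drop_left' (by simp)]

end

/-! ### Correctness of the compiled scheme -/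

section
variable (E : WE) (lam : ℕ)

theorem encState_compile (ℓ X : List Bool) (b : Bool) (r : List Bool) :
    (compile E).encState lam ℓ X b r =
      pureState (bb84 (segment lam 0 r) (segment lam lam r)) := by
  refine (congrArg _ (basisState_eq _)).trans ((Circuit.apply_pureState _ _).trans ?_)
  exact congrArg pureState (run_prepareBB84 _ _)

theorem pureState_apply_self_re {ι : Type} (φ : Vec ι) (s : ι → Bool) :
    (pureState φ s s).re = ‖φ s‖ ^ 2 := by
  rw [pureState, Matrix.vecMulVec_apply, Pi.star_apply, Complex.star_def, Complex.mul_conj,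
    Complex.ofReal_re, Complex.normSq_eq_norm_sq]

theorem apply_pureState_self_re_nonneg {ι : Type} [Fintype ι] [DecidableEq ι] (c : Circuit ι)
    (φ : Vec ι) (s : ι → Bool) : 0 ≤ (c.apply (pureState φ) s s).re := by
  rw [Circuit.apply_pureState, pureState_apply_self_re]
  positivity

theorem parsePair_append (θ : Fin lam → Bool) (b : Bool) :
    parsePair lam (some (List.ofFn θ ++ [b])) = some (θ, b) := by
  simp [parsePair, segment_append]

theorem certTest_all {n : ℕ} {θ x y : Fin n → Bool} :
    certTest θ x (fun _ => true) y = true ↔ ∀ i, θ i = true → x i = y i := by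
  simp [certTest]

theorem xor_xor_cancel (a b : Bool) : (a ^^ b ^^ b) = a := by simp

theorem ver_compile (ℓ X : List Bool) (b : Bool) (r : List Bool) (y : Fin lam → Bool) :
    (compile E).ver lam ((compile E).encVk lam ℓ X b r) y =
      certTest (segment lam lam r) (segment lam 0 r) (fun _ => true) y := by
  have h := segment_append_append (segment lam 0 r) (segment lam lam r) []
  rw [List.append_nil] at h
  change decide (∀ i : Fin lam, segment lam lam (List.ofFn (segment lam 0 r) ++
    List.ofFn (segment lam lam r)) i = true → segment lam 0 (List.ofFn (segment lam 0 r) ++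
      List.ofFn (segment lam lam r)) i = y i) = _
  rw [certTest, Bool.and_true, segment_append]
  simp only [h]

theorem delProb_compile (ℓ X : List Bool) (b : Bool) : (compile E).delProb lam ℓ X b = 1 := by
  unfold CDWE.delProb
  rw [← avg_const ((compile E).encCoins lam ℓ X) (1 : ℝ)]
  refine avg_congr fun r => ?_
  rw [← normSq_bb84 (segment lam 0 r) (segment lam lam r),
    ← Circuit.normSq_run (basisChange fun _ => true)]
  refine Finset.sum_congr rfl fun y _ => ?_
  rw [encState_compile]
  split_ifs with h
  · refine Eq.trans ?_ (pureState_apply_self_re _ y)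
    exact congrArg (fun ρ : Op (Fin lam) => (ρ y y).re) (Circuit.apply_pureState _ _)
  · have h' : ∃ i, segment lam lam r i = true ∧ segment lam 0 r i ≠ y i := by
      by_contra! hc
      refine h ((ver_compile E lam ℓ X b r y).trans ?_)
      exact certTest_all.2 hc
    obtain ⟨i, hi, hi'⟩ := h'
    rw [hadamard_bb84_apply_eq_zero _ _ _ i hi hi']
    simp

theorem deletionCorrect_compile : (compile E).DeletionCorrect :=
  ⟨fun _ => 0, .zero, fun lam ℓ X b => by rw [delProb_compile, sub_zero]⟩

theorem correct_compile (R : List Bool → List Bool → List Bool → Prop) (hE : E.Correct R) :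
    (compile E).Correct R := by
  intro P
  -- The encrypted string adds `lam + 1` to the total length.
  obtain ⟨ν, hν, h⟩ := hE (P + Polynomial.X + 1)
  refine ⟨ν, hν, fun lam ℓ X W b hR hP => ?_⟩
  let F : (Fin lam → Bool) → (Fin lam → Bool) → List Bool → ℝ := fun x θ r =>
    avg (E.decCoins lam W (E.enc lam ℓ X (List.ofFn θ ++ [b ^^ mask x θ]) r)) fun r' =>
      if E.dec lam W (E.enc lam ℓ X (List.ofFn θ ++ [b ^^ mask x θ]) r) r' =
        some (List.ofFn θ ++ [b ^^ mask x θ]) then (1 : ℝ) else 0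
  have h₁ : (avg (lam + lam + E.encCoins lam ℓ X (lam + 1)) fun r =>
      F (segment lam 0 r) (segment lam lam r) (r.drop (lam + lam))) ≤
      (compile E).decProb lam ℓ X W b := by
    -- For each choice of coins: whenever the underlying decryption is right, measuring in the basis
    -- `θ` gives `x` and the output is `b` with certainty.
    refine avg_le_avg fun r => avg_le_avg fun r' => ?_
    split_ifs with hd
    · have hd' : parsePair lam (E.dec lam W ((compile E).encCt lam ℓ X b r) r') =
          some (segment lam lam r, b ^^ mask (segment lam 0 r) (segment lam lam r)) := by
        rw [← parsePair_append, ← hd]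
        rfl
      have hprep : (compile E).decPrep lam W ((compile E).encCt lam ℓ X b r) r' =
          basisChange (segment lam lam r) := by
        simp only [compile] at hd' ⊢
        rw [hd']
      have hout : ∀ y, (compile E).decOut lam W ((compile E).encCt lam ℓ X b r) r' y =
          some ((b ^^ mask (segment lam 0 r) (segment lam lam r)) ^^
            mask y (segment lam lam r)) := by
        intro y
        simp only [compile] at hd' ⊢
        rw [hd']
      rw [hprep, encState_compile]
      have hs : (basisChange (segment lam lam r)).apply
          (pureState (bb84 (segment lam 0 r) (segment lam lam r))) =
          pureState (basisVec (segment lam 0 r)) := by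
        rw [Circuit.apply_pureState, basisChange_bb84]
      refine le_of_eq ?_
      symm
      refine (Finset.sum_eq_single (segment lam 0 r) ?_ ?_).trans ?_
      · intro y _ hy
        have : (((basisChange (segment lam lam r)).apply
          (pureState (bb84 (segment lam 0 r) (segment lam lam r)))) y y).re = 0 := by
          rw [hs, pureState_apply_self_re, basisVec, Pi.single_eq_of_ne hy]
          simp
        split_ifs
        · exact this
        · rfl
      · exact fun hc => (hc (Finset.mem_univ _)).elim
      · refine (if_pos ((hout _).trans (congrArg some (xor_xor_cancel _ _)))).trans ?_
        refine (congrArg (fun ρ : Op (Fin lam) => (ρ _ _).re) hs).trans ?_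
        rw [pureState_apply_self_re, basisVec, Pi.single_eq_same]
        simp
    · refine Finset.sum_nonneg fun y _ => ?_
      split_ifs
      · rw [encState_compile]
        exact apply_pureState_self_re_nonneg _ _ _
      · exact le_rfl
  refine le_trans ?_ h₁
  rw [avg_coins]
  have h₂ : ∀ x θ : Fin lam → Bool, 1 - ν lam ≤ avg (E.encCoins lam ℓ X (lam + 1)) (F x θ) := by
    intro x θ
    have := h lam ℓ X W (List.ofFn θ ++ [b ^^ mask x θ]) hR (by
      simp only [Polynomial.eval_add, Polynomial.eval_X, Polynomial.eval_one, List.length_append,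
        List.length_ofFn, List.length_singleton]
      omega)
    refine this.trans_eq ?_
    rw [WE.decProb]
    simp only [List.length_append, List.length_ofFn, List.length_singleton]
    rfl
  calc 1 - ν lam = avg lam fun _ => avg lam fun _ => 1 - ν lam := by rw [avg_const, avg_const]
    _ ≤ _ := mul_le_mul_of_nonneg_left (Finset.sum_le_sum fun x _ =>
        mul_le_mul_of_nonneg_left (Finset.sum_le_sum fun θ _ => h₂ x θ) (by positivity))
        (by positivity)

end

/-! ### The computational experiment -/

section
variable {ρ κ : Type} [Fintype ρ] [DecidableEq ρ] [Fintype κ] [DecidableEq κ]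

/-- The probability of the result `1`, as a linear functional of the state before the bit `v` is
added as a qubit. -/
def endMap (D : Circuit (ρ ⊕ Unit)) (res : ρ ⊕ Unit) (v : Bool) : Op ρ →ₗ[ℝ] ℝ where
  toFun M := probOne res (D.apply (tensor M (basisState fun _ : Unit => v)))
  map_add' M N := by
    have h : tensor (M + N) (basisState fun _ : Unit => v) =
        tensor M (basisState fun _ : Unit => v) + tensor N (basisState fun _ : Unit => v) := by
      ext s t; simp [tensor, add_mul]
    have h' : ∀ M N : Op (ρ ⊕ Unit), probOne res (M + N) = probOne res M + probOne res N := by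
      intro M N
      have : collapse (fun _ : Unit => res) (fun _ => true) (M + N) =
          collapse (fun _ : Unit => res) (fun _ => true) M +
            collapse (fun _ : Unit => res) (fun _ => true) N := by
        ext s t
        simp only [collapse, Matrix.of_apply, Matrix.add_apply]
        split_ifs <;> simp
      rw [probOne, this, Matrix.trace_add, Complex.add_re]
      rfl
    rw [h, Circuit.apply, Matrix.mul_add, Matrix.add_mul, h']
    rfl
  map_smul' a M := by
    have h : tensor (a • M) (basisState fun _ : Unit => v) =
        a • tensor M (basisState fun _ : Unit => v) := by
      ext s t; simp [tensor]
      ring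
    have h' : ∀ M : Op (ρ ⊕ Unit), probOne res (a • M) = a • probOne res M := by
      intro M
      have : collapse (fun _ : Unit => res) (fun _ => true) (a • M) =
          a • collapse (fun _ : Unit => res) (fun _ => true) M := by
        ext s t
        simp only [collapse, Matrix.of_apply, Matrix.smul_apply]
        split_ifs <;> simp
      rw [probOne, this, Matrix.trace_smul, Complex.smul_re]
      rfl
    rw [h, Circuit.apply, Matrix.mul_smul, Matrix.smul_mul, h']
    rfl

theorem endMap_pureState (D : Circuit (ρ ⊕ Unit)) (res : ρ ⊕ Unit) (v : Bool) (φ : Vec ρ) :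
    endMap D res v (pureState φ) =
      probVec res (D.run (tensVec φ (basisVec fun _ : Unit => v))) := by
  change probOne res (D.apply (tensor (pureState φ) (basisState fun _ : Unit => v))) = _
  rw [basisState_eq, tensor_pureState, Circuit.apply_pureState, probOne_pureState]

theorem map_avg {M N : Type*} [AddCommMonoid M] [Module ℝ M] [AddCommMonoid N] [Module ℝ N]
    (T : M →ₗ[ℝ] N) (n : ℕ) (f : List Bool → M) : T (avg n f) = avg n fun r => T (f r) := by
  simp only [avg, map_smul, map_sum]

theorem avg_sum {M α : Type*} [AddCommMonoid M] [Module ℝ M] (n : ℕ) (s : Finset α)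
    (f : α → List Bool → M) : avg n (fun r => ∑ a ∈ s, f a r) = ∑ a ∈ s, avg n (f a) := by
  simp only [avg, Finset.smul_sum]
  exact Finset.sum_comm

end

/-! ### Summing the games over the message bit -/

section
variable {S : CDWE} {lam : ℕ} (A : S.Adversary lam)
  (R : List Bool → List Bool → List Bool → Prop) (E : WE)

open Classical in
/-- The probability that the attack, continued as in `endProb`, gives the result `1`, if the
ciphertext consists of the state `χ` and an encryption of `m`. -/
def totalProb (χ : Vec (Fin (S.qubits lam))) (m : List Bool)
    (f : (Fin (S.certLen lam) → Bool) → Bool) (D : Circuit (A.Residual ⊕ Unit))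
    (res : A.Residual ⊕ Unit) : ℝ :=
  ∑ z : Outcome A, if inLanguage R (langOf A z) (stmtOf A z) then 0
    else avg (E.encCoins lam (langOf A z) (stmtOf A z) m.length) fun r =>
      endProb A f D res (midVec A z χ (E.enc lam (langOf A z) (stmtOf A z) m r))

-- The events that the message bit is `μ` partition the outcomes. So the encrypted string may depend
-- on the chosen bit, although each single game has a constant one.
open Classical in
theorem sum_gameProb (χ : Vec (Fin (S.qubits lam))) (m : Bool → List Bool) (β : Bool)
    (f : (Fin (S.certLen lam) → Bool) → Bool) (D : Circuit (A.Residual ⊕ Unit))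
    (res : A.Residual ⊕ Unit) :
    ∑ μ, gameProb A R E χ (m μ) β μ f D res =
      ∑ z : Outcome A, if inLanguage R (langOf A z) (stmtOf A z) then 0
        else avg (E.encCoins lam (langOf A z) (stmtOf A z) (m (z (.inr β))).length) fun r =>
          endProb A f D res
            (midVec A z χ (E.enc lam (langOf A z) (stmtOf A z) (m (z (.inr β))) r)) := by
  unfold gameProb
  rw [Finset.sum_comm]
  refine Finset.sum_congr rfl fun z _ => ?_
  rw [Finset.sum_eq_single (z (.inr β))]
  · simp
  · intro μ _ hμ
    rw [if_pos (Or.inr hμ.symm)]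
  · simp

/-- The right side does not mention `β`: with a constant message the challenge bit has no influence.
-/
theorem sum_gameProb_const (χ : Vec (Fin (S.qubits lam))) (m : List Bool) (β : Bool)
    (f : (Fin (S.certLen lam) → Bool) → Bool) (D : Circuit (A.Residual ⊕ Unit))
    (res : A.Residual ⊕ Unit) :
    ∑ μ, gameProb A R E χ m β μ f D res = totalProb A R E χ m f D res :=
  sum_gameProb A R E χ (fun _ => m) β f D res

end

section
variable {E : WE} {lam : ℕ} (A : (compile E).Adversary lam)
  (R : List Bool → List Bool → List Bool → Prop)

/-- The message that is encrypted classically. -/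
def keyMsg {n : ℕ} (θ : Fin n → Bool) (b : Bool) : List Bool := List.ofFn θ ++ [b]

theorem length_keyMsg {n : ℕ} (θ : Fin n → Bool) (b : Bool) : (keyMsg θ b).length = n + 1 := by
  simp [keyMsg]

theorem afterDeletion_state (z : Outcome A) (b : Bool) (r : List Bool) :
    A.delete.apply (tensor (collapse (Sum.elim A.out A.msg) z (A.choose.apply
      (pureState A.advice))) (tensor ((compile E).encState lam (langOf A z) (stmtOf A z) b r)
        (basisState (writeTape A.ctCells
          ((compile E).encCt lam (langOf A z) (stmtOf A z) b r))))) =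
    pureState (midVec A z (bb84 (segment lam 0 r) (segment lam lam r))
      (E.enc lam (langOf A z) (stmtOf A z) (keyMsg (segment lam lam r)
        (b ^^ mask (segment lam 0 r) (segment lam lam r))) (r.drop (lam + lam)))) := by
  rw [encState_compile, Circuit.apply_pureState, collapse_pureState, basisState_eq]
  refine (congrArg (fun M => A.delete.apply (tensor _ M)) (tensor_pureState _ _)).trans ?_
  rw [tensor_pureState, Circuit.apply_pureState]
  rfl

theorem cProb_eq (b : Bool) : A.cProb R b =
    ((2 : ℝ) ^ lam)⁻¹ • ∑ x : Fin lam → Bool, ((2 : ℝ) ^ lam)⁻¹ • ∑ θ : Fin lam → Bool,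
      ∑ μ, gameProb A R E (bb84 x θ) (keyMsg θ (μ ^^ mask x θ)) b μ
        (certTest θ x fun _ => true) A.distinguish A.result := by
  classical
  have h₁ : A.cProb R b = ∑ z : Outcome A,
      if inLanguage R (langOf A z) (stmtOf A z) then 0
      else avg (lam + lam + E.encCoins lam (langOf A z) (stmtOf A z) (lam + 1)) fun r =>
        endProb A (certTest (segment lam lam r) (segment lam 0 r) fun _ => true) A.distinguish
          A.result (midVec A z (bb84 (segment lam 0 r) (segment lam lam r))
            (E.enc lam (langOf A z) (stmtOf A z) (keyMsg (segment lam lam r)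
              (z (.inr b) ^^ mask (segment lam 0 r) (segment lam lam r))) (r.drop (lam + lam)))) := by
    change ∑ v, endMap A.distinguish A.result v (A.afterDeletion R b v) = _
    unfold CDWE.Adversary.afterDeletion
    simp only [map_sum]
    rw [Finset.sum_comm]
    refine Finset.sum_congr rfl fun z _ => ?_
    by_cases hz : inLanguage R (langOf A z) (stmtOf A z)
    · rw [if_pos hz]
      refine Finset.sum_eq_zero fun v _ => ?_
      refine (congrArg _ (if_pos hz)).trans (map_zero _)
    · rw [if_neg hz]
      refine (Finset.sum_congr rfl fun v _ => (congrArg _ (if_neg hz)).trans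
        (map_avg _ _ _)).trans ?_
      rw [← avg_sum]
      refine avg_congr fun r => ?_
      refine (Finset.sum_congr rfl fun v _ => congrArg _ (Finset.sum_congr rfl fun y _ =>
        (if_congr (iff_of_eq (congrArg (· = v) (ver_compile E lam _ _ _ r y))) (congrArg (collapse A.cert y)
          (afterDeletion_state A z (z (.inr b)) r)) rfl))).trans ?_
      refine (Finset.sum_congr rfl fun v _ => map_sum _ _ _).trans ?_
      refine Finset.sum_comm.trans ?_
      refine Finset.sum_congr rfl fun y _ => ?_
      rw [Finset.sum_eq_single (certTest (segment lam lam r) (segment lam 0 r) (fun _ => true) y)]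
      · rw [if_pos rfl, collapse_pureState, endMap_pureState]
        rfl
      · intro v _ hv
        rw [if_neg hv.symm, map_zero]
      · simp
  rw [h₁]
  simp only [sum_gameProb, length_keyMsg]
  rw [Finset.smul_sum]
  simp only [Finset.smul_sum]
  -- The outcome `z` goes to the outside, since the number of encryption coins depends on it.
  rw [Finset.sum_congr rfl fun x _ => Finset.sum_comm, Finset.sum_comm]
  refine Finset.sum_congr rfl fun z _ => ?_
  by_cases hz : inLanguage R (langOf A z) (stmtOf A z)
  · simp [hz]
  · simp only [if_neg hz]
    refine (avg_coins (n := lam) _ fun x θ r => endProb A (certTest θ x fun _ => true)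
      A.distinguish A.result (midVec A z (bb84 x θ) (E.enc lam (langOf A z) (stmtOf A z)
        (keyMsg θ (z (.inr b) ^^ mask x θ)) r))).trans ?_
    simp only [Finset.smul_sum]

end

/-- The message that replaces the one that is encrypted. -/
def zeroMsg (n : ℕ) : List Bool := List.replicate (n + 1) false

theorem abs_average_sub_le {ι κ : Type} [Fintype ι] [Fintype κ] {c : ℝ} {a b : ℝ}
    (hι : a * Fintype.card ι = 1) (hκ : b * Fintype.card κ = 1) (f g : ι → κ → ℝ)
    (h : ∀ i j, |f i j - g i j| ≤ c) :
    |a • ∑ i, b • ∑ j, f i j - a • ∑ i, b • ∑ j, g i j| ≤ c := by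
  have ha : 0 < a := by
    by_contra! h
    have := mul_nonpos_of_nonpos_of_nonneg h (Nat.cast_nonneg (Fintype.card ι) (α := ℝ))
    linarith
  have hb : 0 < b := by
    by_contra! h
    have := mul_nonpos_of_nonpos_of_nonneg h (Nat.cast_nonneg (Fintype.card κ) (α := ℝ))
    linarith
  rw [← smul_sub, ← Finset.sum_sub_distrib]
  simp only [smul_eq_mul, ← mul_sub, ← Finset.sum_sub_distrib]
  rw [abs_mul, abs_of_pos ha]
  have h₁ : ∀ i, |b * ∑ j, (f i j - g i j)| ≤ c := by
    intro i
    rw [abs_mul, abs_of_pos hb]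
    calc b * |∑ j, (f i j - g i j)| ≤ b * ∑ _j : κ, c := by
          gcongr
          exact (Finset.abs_sum_le_sum_abs _ _).trans (Finset.sum_le_sum fun j _ => h i j)
      _ = b * Fintype.card κ * c := by simp [mul_assoc]
      _ = c := by rw [hκ, one_mul]
  calc a * |∑ i, b * ∑ j, (f i j - g i j)| ≤ a * ∑ _i : ι, c := by
        gcongr
        exact (Finset.abs_sum_le_sum_abs _ _).trans (Finset.sum_le_sum fun i _ => h₁ i)
    _ = a * Fintype.card ι * c := by simp [mul_assoc]
    _ = c := by rw [hι, one_mul]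

theorem inv_two_pow_mul_card (n : ℕ) : ((2 : ℝ) ^ n)⁻¹ * Fintype.card (Fin n → Bool) = 1 := by
  rw [Fintype.card_fun, Fintype.card_bool, Fintype.card_fin]
  push_cast
  exact inv_mul_cancel₀ (by positivity)

theorem cExp_secure {E : WE} {R : List Bool → List Bool → List Bool → Prop}
    (hE : E.PostQuantumSecure R) (A : (lam : ℕ) → (compile E).Adversary lam)
    (hA : PolyBounded fun lam => (A lam).size) :
    Negligible fun lam => |(A lam).cProb R false - (A lam).cProb R true| := by
  obtain ⟨ν, hν, h⟩ := exists_gameProb_bound (S := compile E) PolyBounded.id PolyBounded.id hE A hA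
    (fun lam => (A lam).distinguish)
    (hA.of_le fun lam => by simp only [CDWE.Adversary.size]; omega)
    (fun lam => (A lam).result)
    (T := fun lam => (Fin lam → Bool) × (Fin lam → Bool) × Bool × Bool × Bool)
    (fun lam t => bb84 t.1 t.2.1) (fun lam t => normSq_bb84 _ _)
    (fun lam t => t.2.1) (fun lam t => t.1) (fun _ _ _ => true)
    (fun lam t => keyMsg t.2.1 t.2.2.1) (fun lam _ => zeroMsg lam) (fun lam => lam + 1)
    (PolyBounded.id.add (.const 1)) (fun lam => Nat.succ_pos _) (fun lam t => length_keyMsg _ _)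
    (fun lam t => by simp [zeroMsg]) (fun lam t => t.2.2.2.1) (fun lam t => t.2.2.2.2)
  -- Both values of `μ` cost `ν lam`. The comparison value is the same for both `b`, which gives `4
  -- * ν lam` in the end.
  have key : ∀ lam b, |(A lam).cProb R b -
      ((2 : ℝ) ^ lam)⁻¹ • ∑ x : Fin lam → Bool, ((2 : ℝ) ^ lam)⁻¹ • ∑ θ : Fin lam → Bool,
        totalProb (A lam) R E (bb84 x θ) (zeroMsg lam) (certTest θ x fun _ => true)
          (A lam).distinguish (A lam).result| ≤ 2 * ν lam := by
    intro lam b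
    rw [cProb_eq]
    refine abs_average_sub_le (inv_two_pow_mul_card lam) (inv_two_pow_mul_card lam) _ _ fun x θ => ?_
    rw [← sum_gameProb_const (A lam) R E _ _ b, Fintype.sum_bool, Fintype.sum_bool]
    have h₁ := h lam (x, θ, true ^^ mask x θ, b, true)
    have h₂ := h lam (x, θ, false ^^ mask x θ, b, false)
    dsimp only at h₁ h₂
    rw [abs_le] at h₁ h₂ ⊢
    constructor <;> linarith [h₁.1, h₁.2, h₂.1, h₂.2]
  refine (hν.const_mul 4).of_le (fun _ => abs_nonneg _) fun lam => ?_
  have h₁ := key lam false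
  have h₂ := key lam true
  rw [abs_le] at h₁ h₂ ⊢
  constructor <;> linarith [h₁.1, h₁.2, h₂.1, h₂.2]

/-! ### The trace norm of a sum of rank-one matrices -/

section
variable {n : Type} [Fintype n] [DecidableEq n]

theorem inner_toLp (a b : n → ℂ) :
    inner ℂ (WithLp.toLp 2 a : EuclideanSpace ℂ n) (WithLp.toLp 2 b) = star a ⬝ᵥ b := by
  rw [EuclideanSpace.inner_eq_star_dotProduct, dotProduct_comm]

theorem norm_toLp (a : n → ℂ) :
    ‖(WithLp.toLp 2 a : EuclideanSpace ℂ n)‖ = √(∑ i, ‖a i‖ ^ 2) := by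
  rw [EuclideanSpace.norm_eq]

/-- With right singular vectors `u i` and left ones `w i`, a non-zero singular value is `⟨w i, A u
i⟩`, which is the sum over `k` of `⟨w i, a k⟩⟨b k, u i⟩`. For each `k`, Cauchy–Schwarz in `i` and
Bessel's inequality for both systems give the product of norms. -/
theorem traceNorm_sum_vecMulVec_le {α : Type*} (s : Finset α) (a b : α → n → ℂ) :
    traceNorm (∑ k ∈ s, vecMulVec (a k) (star (b k))) ≤
      ∑ k ∈ s, √(∑ i, ‖a k i‖ ^ 2) * √(∑ i, ‖b k i‖ ^ 2) := by
  set A : Matrix n n ℂ := ∑ k ∈ s, vecMulVec (a k) (star (b k)) with hA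
  let hH := Matrix.isHermitian_conjTranspose_mul_self A
  let u : OrthonormalBasis n ℂ (EuclideanSpace ℂ n) := hH.eigenvectorBasis
  let ev : n → ℝ := hH.eigenvalues
  let Au : n → EuclideanSpace ℂ n := fun i => WithLp.toLp 2 (A *ᵥ (u i).ofLp)
  have hin : ∀ i j, inner ℂ (Au i) (Au j) = if i = j then (ev j : ℂ) else 0 := by
    intro i j
    have h₁ : inner ℂ (Au i) (Au j) = star (u i).ofLp ⬝ᵥ ((Aᴴ * A) *ᵥ (u j).ofLp) := by
      rw [inner_toLp, Matrix.star_mulVec, ← Matrix.dotProduct_mulVec, Matrix.mulVec_mulVec]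
    have h₂ : (Aᴴ * A) *ᵥ (u j).ofLp = ev j • (u j).ofLp := hH.mulVec_eigenvectorBasis j
    have h₃ := orthonormal_iff_ite.1 u.orthonormal i j
    have h₄ : inner ℂ (u i) (u j) = star (u i).ofLp ⬝ᵥ (u j).ofLp := inner_toLp _ _
    rw [h₁, h₂, dotProduct_smul, ← h₄, h₃]
    split_ifs <;> simp
  have hev : ∀ i, 0 ≤ ev i := fun i => by
    have h := hin i i
    rw [if_pos rfl, inner_self_eq_norm_sq_to_K] at h
    have : ‖Au i‖ ^ 2 = ev i := Complex.ofReal_injective (by rw [← h]; push_cast; rfl)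
    rw [← this]
    positivity
  have hAu : ∀ i, inner ℂ (Au i) (Au i) = ∑ k ∈ s,
      inner ℂ (Au i) (WithLp.toLp 2 (a k) : EuclideanSpace ℂ n) *
        inner ℂ (WithLp.toLp 2 (b k)) (u i) := by
    intro i
    have h : Au i = ∑ k ∈ s, inner ℂ (WithLp.toLp 2 (b k)) (u i) •
        (WithLp.toLp 2 (a k) : EuclideanSpace ℂ n) := by
      have h₀ : A *ᵥ (u i).ofLp = ∑ k ∈ s, (star (b k) ⬝ᵥ (u i).ofLp) • a k := by
        rw [hA, Matrix.sum_mulVec]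
        refine Finset.sum_congr rfl fun k _ => ?_
        rw [Matrix.vecMulVec_mulVec]
        simp
      simp only [Au, h₀, WithLp.toLp_sum, WithLp.toLp_smul]
      exact Finset.sum_congr rfl fun k _ => by rw [← inner_toLp]
    conv_lhs => rw [h, inner_sum]
    rw [← h]
    refine Finset.sum_congr rfl fun k _ => ?_
    rw [inner_smul_right, mul_comm]
  -- The left singular vectors exist only for non-zero singular values; the others do not contribute
  -- to the trace norm.
  let w : {i // ev i ≠ 0} → EuclideanSpace ℂ n := fun i => ((√(ev i))⁻¹ : ℂ) • Au i
  have hw : Orthonormal ℂ w := by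
    rw [orthonormal_iff_ite]
    intro i j
    rw [inner_smul_left, inner_smul_right, hin]
    by_cases hij : i = j
    · subst hij
      have h := Real.mul_self_sqrt (hev i)
      have h₀ : √(ev i) ≠ 0 := (Real.sqrt_ne_zero (hev i)).2 i.2
      rw [if_pos rfl, if_pos rfl]
      simp only [map_inv₀, Complex.conj_ofReal]
      rw [← Complex.ofReal_inv, ← Complex.ofReal_mul, ← Complex.ofReal_mul, ← Complex.ofReal_one]
      congr 1
      field_simp
      rw [pow_two, h]
    · rw [if_neg fun h => hij (Subtype.ext h), if_neg hij, mul_zero, mul_zero]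
  have hsq : ∀ i : {i // ev i ≠ 0}, √(ev i) ≤ ∑ k ∈ s,
      ‖inner ℂ (w i) (WithLp.toLp 2 (a k) : EuclideanSpace ℂ n)‖ *
        ‖inner ℂ (u i) (WithLp.toLp 2 (b k) : EuclideanSpace ℂ n)‖ := by
    intro i
    have h₀ : √(ev i) ≠ 0 := (Real.sqrt_ne_zero (hev i)).2 i.2
    have h : ((√(ev i) : ℝ) : ℂ) = ∑ k ∈ s,
        inner ℂ (w i) (WithLp.toLp 2 (a k) : EuclideanSpace ℂ n) *
          inner ℂ (WithLp.toLp 2 (b k)) (u i) := by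
      simp only [w, inner_smul_left, mul_assoc]
      rw [← Finset.mul_sum, ← hAu, hin, if_pos rfl]
      have h := Real.mul_self_sqrt (hev i)
      simp only [map_inv₀, Complex.conj_ofReal]
      rw [← Complex.ofReal_inv, ← Complex.ofReal_mul]
      congr 1
      field_simp
      rw [pow_two, h]
    have h' : √(ev i) = ‖((√(ev i) : ℝ) : ℂ)‖ := by
      rw [Complex.norm_real, Real.norm_eq_abs, abs_of_nonneg (Real.sqrt_nonneg _)]
    rw [h', h]
    refine (norm_sum_le _ _).trans (Finset.sum_le_sum fun k _ => ?_)
    rw [norm_mul, norm_inner_symm (WithLp.toLp 2 (b k))]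
  have htr : traceNorm A = ∑ i : {i // ev i ≠ 0}, √(ev i) := by
    rw [traceNorm]
    change ∑ i, √(ev i) = _
    symm
    refine Fintype.sum_of_injective (fun i : {i // ev i ≠ 0} => (i : n)) Subtype.val_injective _ _ (fun i hi => ?_)
      fun i => rfl
    by_cases h : ev i = 0
    · rw [h, Real.sqrt_zero]
    · exact (hi ⟨⟨i, h⟩, rfl⟩).elim
  rw [htr]
  refine (Finset.sum_le_sum fun i _ => hsq i).trans ?_
  rw [Finset.sum_comm]
  refine Finset.sum_le_sum fun k _ => ?_
  refine (Real.sum_mul_le_sqrt_mul_sqrt _ _ _).trans ?_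
  rw [← norm_toLp (a k), ← norm_toLp (b k)]
  refine mul_le_mul ?_ ?_ (Real.sqrt_nonneg _) (norm_nonneg _)
  · exact Real.sqrt_le_iff.2 ⟨norm_nonneg _, hw.sum_inner_products_le _⟩
  · refine Real.sqrt_le_iff.2 ⟨norm_nonneg _, ?_⟩
    exact (u.orthonormal.comp (fun i : {i // ev i ≠ 0} => (i : n))
      Subtype.val_injective).sum_inner_products_le _

end

/-- The entry at `⊥` of the difference is minus the trace of `ρ - σ`, a sum of inner products `-⟨b
k, a k⟩`. By Cauchy–Schwarz it at most doubles the bound, which the factor `1/2` of the trace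
distance makes up for. -/
theorem traceDist_withBot_le {ι α : Type} [Fintype ι] [DecidableEq ι] (ρ σ : Op ι)
    (s : Finset α) (a b : α → Vec ι) (h : ρ - σ = ∑ k ∈ s, vecMulVec (a k) (star (b k))) :
    traceDist (withBot ρ) (withBot σ) ≤ ∑ k ∈ s, √(normSq (a k)) * √(normSq (b k)) := by
  let ext : Vec ι → Option (ι → Bool) → ℂ := fun φ t => t.elim 0 φ
  let bot : ℂ → Option (ι → Bool) → ℂ := fun c t => t.elim c fun _ => 0
  have hext : ∀ φ, ∑ i, ‖ext φ i‖ ^ 2 = normSq φ := fun φ => by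
    simp [ext, Fintype.sum_option, normSq]
  have hbot : ∀ c, ∑ i, ‖bot c i‖ ^ 2 = ‖c‖ ^ 2 := fun c => by
    simp [bot, Fintype.sum_option]
  have key : withBot ρ - withBot σ = ∑ k ∈ s.disjSum s, vecMulVec
      (Sum.elim (fun k => ext (a k)) (fun k => bot (-(star (b k) ⬝ᵥ a k))) k)
      (star (Sum.elim (fun k => ext (b k)) (fun _ => bot 1) k)) := by
    rw [Finset.sum_disjSum]
    simp only [Sum.elim_inl, Sum.elim_inr]
    ext i j
    rw [Matrix.add_apply, Matrix.sum_apply, Matrix.sum_apply, Matrix.sub_apply]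
    rcases i with _ | i <;> rcases j with _ | j
    · have ht := congrArg Matrix.trace h
      rw [Matrix.trace_sub, Matrix.trace_sum] at ht
      simp only [withBot, Matrix.of_apply, Matrix.vecMulVec_apply, ext, bot, Option.elim_none,
        zero_mul, Finset.sum_const_zero, zero_add, Pi.star_apply, star_one, mul_one]
      rw [Finset.sum_neg_distrib]
      have : ∀ k, (vecMulVec (a k) (star (b k))).trace = star (b k) ⬝ᵥ a k := fun k => by
        rw [Matrix.trace_vecMulVec, dotProduct_comm]
      simp only [this] at ht
      rw [← ht]
      ring
    · simp [withBot, Matrix.vecMulVec_apply, ext, bot]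
    · simp [withBot, Matrix.vecMulVec_apply, ext, bot]
    · have ht := congrFun (congrFun h i) j
      rw [Matrix.sub_apply, Matrix.sum_apply] at ht
      simp [withBot, Matrix.vecMulVec_apply, ext, bot] at ht ⊢
      exact ht
  rw [traceDist, key]
  have h₁ := traceNorm_sum_vecMulVec_le (s.disjSum s)
    (Sum.elim (fun k => ext (a k)) (fun k => bot (-(star (b k) ⬝ᵥ a k))))
    (Sum.elim (fun k => ext (b k)) (fun _ => bot 1))
  rw [Finset.sum_disjSum _ _ fun k => √_ * √_] at h₁
  simp only [Sum.elim_inl, Sum.elim_inr, hext, hbot] at h₁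
  have h₂ : ∑ k ∈ s, √(‖-(star (b k) ⬝ᵥ a k)‖ ^ 2) * √(‖(1 : ℂ)‖ ^ 2) ≤
      ∑ k ∈ s, √(normSq (a k)) * √(normSq (b k)) := by
    refine Finset.sum_le_sum fun k _ => ?_
    rw [Real.sqrt_sq (norm_nonneg _), norm_neg, ← inner_toLp, norm_one, one_pow, Real.sqrt_one,
      mul_one, mul_comm]
    refine (norm_inner_le_norm _ _).trans_eq ?_
    rw [norm_toLp, norm_toLp]
    rfl
  linarith

/-! ### Sums of rank-one operators -/

/-- `M` is a sum of rank-one operators of total trace norm at most `c`. -/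
def RankOneBound {ι : Type} [Fintype ι] [DecidableEq ι] (M : Op ι) (c : ℝ) : Prop :=
  ∃ (α : Type) (s : Finset α) (a b : α → Vec ι),
    M = ∑ k ∈ s, vecMulVec (a k) (star (b k)) ∧ ∑ k ∈ s, √(normSq (a k)) * √(normSq (b k)) ≤ c

section
variable {ι : Type} [Fintype ι] [DecidableEq ι]

theorem RankOneBound.vecMulVec (a b : Vec ι) :
    RankOneBound (vecMulVec a (star b)) (√(normSq a) * √(normSq b)) :=
  ⟨Unit, Finset.univ, fun _ => a, fun _ => b, by simp, by simp⟩

theorem RankOneBound.zero : RankOneBound (0 : Op ι) 0 :=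
  ⟨Unit, ∅, fun _ => 0, fun _ => 0, by simp, by simp⟩

theorem RankOneBound.add {M N : Op ι} {c d : ℝ} (hM : RankOneBound M c) (hN : RankOneBound N d) :
    RankOneBound (M + N) (c + d) := by
  obtain ⟨α, s, a, b, rfl, h⟩ := hM
  obtain ⟨α', s', a', b', rfl, h'⟩ := hN
  refine ⟨α ⊕ α', s.disjSum s', Sum.elim a a', Sum.elim b b', ?_, ?_⟩
  · rw [Finset.sum_disjSum]; rfl
  · rw [Finset.sum_disjSum]; exact add_le_add h h'

theorem RankOneBound.sum {α : Type} {s : Finset α} {M : α → Op ι} {c : α → ℝ}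
    (h : ∀ k ∈ s, RankOneBound (M k) (c k)) : RankOneBound (∑ k ∈ s, M k) (∑ k ∈ s, c k) := by
  classical
  induction s using Finset.induction_on with
  | empty => exact .zero
  | insert k s hk ih =>
    rw [Finset.sum_insert hk, Finset.sum_insert hk]
    exact (h k (by simp)).add (ih fun k hk => h k (by simp [hk]))

theorem normSq_smul (r : ℝ) (φ : Vec ι) : normSq (r • φ) = r ^ 2 * normSq φ := by
  simp only [normSq, Pi.smul_apply, norm_smul, mul_pow, Real.norm_eq_abs, sq_abs, Finset.mul_sum]

theorem RankOneBound.smul {M : Op ι} {c : ℝ} (h : RankOneBound M c) (r : ℝ) :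
    RankOneBound (r • M) (|r| * c) := by
  obtain ⟨α, s, a, b, rfl, h⟩ := h
  refine ⟨α, s, fun k => r • a k, b, ?_, ?_⟩
  · simp only [Finset.smul_sum, Matrix.smul_vecMulVec]
  · simp only [normSq_smul, Real.sqrt_mul (sq_nonneg r), Real.sqrt_sq_eq_abs, mul_assoc,
      ← Finset.mul_sum]
    gcongr

theorem RankOneBound.smul_of_nonneg {M : Op ι} {c r : ℝ} (h : RankOneBound M c) (hr : 0 ≤ r) :
    RankOneBound (r • M) (r * c) := by
  simpa only [abs_of_nonneg hr] using h.smul r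

theorem RankOneBound.avg {n : ℕ} {M : List Bool → Op ι} {c : List Bool → ℝ}
    (h : ∀ r, RankOneBound (M r) (c r)) : RankOneBound (avg n M) (avg n c) :=
  .smul_of_nonneg (.sum fun r _ => h (List.ofFn r)) (by positivity)

theorem RankOneBound.mono {M : Op ι} {c d : ℝ} (h : RankOneBound M c) (hcd : c ≤ d) :
    RankOneBound M d := by
  obtain ⟨α, s, a, b, hM, h⟩ := h
  exact ⟨α, s, a, b, hM, h.trans hcd⟩

theorem RankOneBound.traceDist_le {ρ σ : Op ι} {c : ℝ} (h : RankOneBound (ρ - σ) c) :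
    traceDist (withBot ρ) (withBot σ) ≤ c := by
  obtain ⟨α, s, a, b, hM, h⟩ := h
  exact (traceDist_withBot_le ρ σ s a b hM).trans h

end

/-! ### Masked sums of conjugate coding states in the Hadamard basis -/

section
variable {n : ℕ}

/-- The sign `(-1) ^ b`. -/
def sgn (b : Bool) : ℝ := if b then -1 else 1

/-- Flip the bits `v i` with `θ i = 0`. -/
def flipOff (θ v : Fin n → Bool) : Fin n → Bool := fun i => v i ^^ !θ i

/-- The vector `H|v⟩` on all qubits. -/
def hadVec (v : Fin n → Bool) : Vec (Fin n) := bb84 v fun _ => true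

theorem hadVec_apply (v s : Fin n → Bool) : hadVec v s = ∏ i, hadOp (bitVec (v i)) (s i) := by
  simp [hadVec, bb84, prodVec]

theorem sgn_mask (x θ : Fin n → Bool) :
    (sgn (mask x θ) : ℂ) = ∏ i, if θ i = false ∧ x i = true then (-1 : ℂ) else 1 := by
  have h : ∀ k : ℕ, ((sgn k.bodd : ℝ) : ℂ) = (-1) ^ k := by
    intro k
    induction k with
    | zero => simp [sgn]
    | succ k ih =>
      rw [pow_succ, ← ih, Nat.bodd_succ]
      cases k.bodd <;> simp [sgn]
  rw [mask, h, Finset.prod_ite]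
  simp

theorem prod_sum_bool {M : Type*} [CommRing M] (f : Fin n → Bool → M) :
    ∏ i, ∑ b, f i b = ∑ x : Fin n → Bool, ∏ i, f i (x i) := by
  rw [Finset.prod_univ_sum, Fintype.piFinset_univ]

theorem ite_forall_eq_prod {M : Type*} [CommRing M] (p : Fin n → Prop) [DecidablePred p] :
    (if ∀ i, p i then (1 : M) else 0) = ∏ i, if p i then (1 : M) else 0 := by
  rw [Finset.prod_ite_zero]
  simp

/-- Both sides factor over the qubits. If `θ i = 1`, the bit is forced to be `y i` and the factors
agree. If `θ i = 0`, the factors are the two sides of `|0⟩⟨0| - |1⟩⟨1| = |+⟩⟨-| + |-⟩⟨+|`. -/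
theorem sum_masked_pureState (θ y : Fin n → Bool) :
    ∑ x : Fin n → Bool, (if ∀ i, θ i = true → x i = y i then
        sgn (mask x θ) • vecMulVec (bb84 x θ) (star (bb84 x θ)) else 0) =
      ∑ v : Fin n → Bool, if ∀ i, θ i = true → v i = y i then
        vecMulVec (hadVec v) (star (hadVec (flipOff θ v))) else 0 := by
  ext s t
  simp only [Matrix.sum_apply]
  have hl : ∀ x : Fin n → Bool, (if ∀ i, θ i = true → x i = y i then
        sgn (mask x θ) • vecMulVec (bb84 x θ) (star (bb84 x θ)) else 0 : Op (Fin n)) s t =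
      ∏ i, (if θ i = true → x i = y i then (1 : ℂ) else 0) *
        ((if θ i = false ∧ x i = true then (-1 : ℂ) else 1) *
        ((if θ i then hadOp (bitVec (x i)) else bitVec (x i)) (s i) *
        star ((if θ i then hadOp (bitVec (x i)) else bitVec (x i)) (t i)))) := by
    intro x
    rw [Finset.prod_mul_distrib, ← ite_forall_eq_prod, Finset.prod_mul_distrib, ← sgn_mask,
      Finset.prod_mul_distrib, ← star_prod]
    split_ifs
    · rw [Matrix.smul_apply, Matrix.vecMulVec_apply, Complex.real_smul, one_mul]
      rfl
    · simp
  have hr : ∀ x : Fin n → Bool, (if ∀ i, θ i = true → x i = y i then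
        vecMulVec (hadVec x) (star (hadVec (flipOff θ x))) else 0 : Op (Fin n)) s t =
      ∏ i, (if θ i = true → x i = y i then (1 : ℂ) else 0) *
        (hadOp (bitVec (x i)) (s i) * star (hadOp (bitVec (x i ^^ !θ i)) (t i))) := by
    intro x
    rw [Finset.prod_mul_distrib, ← ite_forall_eq_prod, Finset.prod_mul_distrib, ← star_prod]
    split_ifs
    · rw [Matrix.vecMulVec_apply, Pi.star_apply, hadVec_apply, hadVec_apply, one_mul]
      rfl
    · simp
  simp only [hl, hr]
  rw [← prod_sum_bool fun i b => (if θ i = true → b = y i then (1 : ℂ) else 0) *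
        ((if θ i = false ∧ b = true then (-1 : ℂ) else 1) *
        ((if θ i then hadOp (bitVec b) else bitVec b) (s i) *
        star ((if θ i then hadOp (bitVec b) else bitVec b) (t i)))),
    ← prod_sum_bool fun i b => (if θ i = true → b = y i then (1 : ℂ) else 0) *
        (hadOp (bitVec b) (s i) * star (hadOp (bitVec (b ^^ !θ i)) (t i)))]
  refine Finset.prod_congr rfl fun i _ => ?_
  have h2 := sqrt_two_sq
  have h0 := sqrt_two_ne_zero
  cases θ i
  · rw [Fintype.sum_bool, Fintype.sum_bool]
    cases s i <;> cases t i <;> simp [bitVec, hadOp] <;> field_simp <;> rw [h2] <;> norm_num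
  · simp

/-- The threshold for the number of disagreements. -/
def threshold (θ : Fin n → Bool) (w : ℕ) : Bool :=
  decide ((Finset.univ.filter fun i => θ i = false).card ≤ 2 * w)

theorem flipOff_flipOff (θ v : Fin n → Bool) : flipOff θ (flipOff θ v) = v := by
  funext i
  simp [flipOff]

theorem certTest_flipOff (θ v y : Fin n → Bool) :
    certTest θ (flipOff θ v) (fun _ => true) y = certTest θ v (fun _ => true) y := by
  rw [Bool.eq_iff_iff, certTest_all, certTest_all]
  refine forall_congr' fun i => ?_
  refine imp_congr_right fun h => ?_
  simp [flipOff, h]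

/-- At each position with `θ i = 0` exactly one of `v` and `flipOff θ v` disagrees with `y`. So the
two numbers of disagreements add up to the number of these positions, and one is at least half of
it. -/
theorem certTest_threshold_or {θ v y : Fin n → Bool}
    (h : certTest θ v (fun _ => true) y = true) :
    certTest θ v (threshold θ) y = true ∨ certTest θ (flipOff θ v) (threshold θ) y = true := by
  have h' : certTest θ (flipOff θ v) (fun _ => true) y = true := by rwa [certTest_flipOff]
  rw [certTest_all] at h h'
  have hc : (Finset.univ.filter fun i => v i ≠ y i).card +
      (Finset.univ.filter fun i => flipOff θ v i ≠ y i).card =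
      (Finset.univ.filter fun i => θ i = false).card := by
    rw [Finset.card_filter, Finset.card_filter, Finset.card_filter, ← Finset.sum_add_distrib]
    refine Finset.sum_congr rfl fun i _ => ?_
    have hi := h i
    cases hθ : θ i
    · cases hv : v i <;> cases hy : y i <;> simp [flipOff, hθ, hv]
    · simp [flipOff, hθ, hi hθ]
  simp only [certTest, Bool.and_eq_true, decide_eq_true_eq, threshold]
  by_cases hw : (Finset.univ.filter fun i => θ i = false).card ≤
      2 * (Finset.univ.filter fun i => v i ≠ y i).card
  · exact Or.inl ⟨h, hw⟩
  · exact Or.inr ⟨h', by omega⟩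

theorem sqrt_mul_sqrt_le {a b t : ℝ} (ha : 0 ≤ a) (hb : 0 ≤ b) (ht : 0 < t) :
    √a * √b ≤ (t⁻¹ * a + t * b) / 2 := by
  have h := sq_nonneg (√a - t * √b)
  have h₁ := Real.sq_sqrt ha
  have h₂ := Real.sq_sqrt hb
  have h₃ : t * (t⁻¹ * a) = a := mul_inv_cancel_left₀ ht.ne' a
  have h₄ : 0 ≤ t * ((t⁻¹ * a + t * b) / 2 - √a * √b) := by
    have : t * ((t⁻¹ * a + t * b) / 2 - √a * √b) = (√a - t * √b) ^ 2 / 2 := by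
      rw [mul_sub, mul_div_assoc', mul_add, h₃]
      linear_combination -(1 / 2) * h₁ - t ^ 2 / 2 * h₂
    rw [this]
    positivity
  linarith [nonneg_of_mul_nonneg_right h₄ ht]

/-- In the weighted inequality of the means, the large weight `t⁻¹` goes to the one of `v` and
`flipOff θ v` that passes the threshold test, whose total mass will be small. Reindexing by the
involution `flipOff θ` merges the halves. -/
theorem sum_sqrt_mul_sqrt_flipOff_le (θ y : Fin n → Bool) (N : (Fin n → Bool) → ℝ)
    (hN : ∀ v, 0 ≤ N v) {t : ℝ} (ht : 0 < t) :
    (∑ v, if ∀ i, θ i = true → v i = y i then √(N v) * √(N (flipOff θ v)) else 0) ≤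
      t⁻¹ * (∑ v, if certTest θ v (threshold θ) y then N v else 0) +
        t * ∑ v, if certTest θ v (fun _ => true) y then N v else 0 := by
  have hre : ∀ f : (Fin n → Bool) → ℝ, ∑ v, f (flipOff θ v) = ∑ v, f v := fun f =>
    Equiv.sum_comp (Function.Involutive.toPerm (flipOff θ) (flipOff_flipOff θ)) f
  have ht' : 0 < t⁻¹ := inv_pos.2 ht
  have h₁ : ∀ v, (if ∀ i, θ i = true → v i = y i then √(N v) * √(N (flipOff θ v)) else 0) ≤
      (t⁻¹ * (if certTest θ v (threshold θ) y then N v else 0) +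
      t⁻¹ * (if certTest θ (flipOff θ v) (threshold θ) y then N (flipOff θ v) else 0) +
      t * (if certTest θ v (fun _ => true) y then N v else 0) +
      t * (if certTest θ (flipOff θ v) (fun _ => true) y then N (flipOff θ v) else 0)) / 2 := by
    intro v
    have ha := hN v
    have hb := hN (flipOff θ v)
    have ha' := mul_nonneg ht.le ha
    have hb' := mul_nonneg ht.le hb
    have ha'' := mul_nonneg ht'.le ha
    have hb'' := mul_nonneg ht'.le hb
    by_cases h : certTest θ v (fun _ => true) y = true
    · have hf : certTest θ (flipOff θ v) (fun _ => true) y = true := by rwa [certTest_flipOff]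
      rw [if_pos (certTest_all.1 h), if_pos h, if_pos hf]
      rcases certTest_threshold_or h with hv | hv
      · rw [if_pos hv]
        refine (sqrt_mul_sqrt_le ha hb ht).trans ?_
        have : 0 ≤ t⁻¹ * (if certTest θ (flipOff θ v) (threshold θ) y then N (flipOff θ v)
            else 0) := by split_ifs <;> simp [hb'']
        linarith
      · rw [if_pos hv, mul_comm]
        refine (sqrt_mul_sqrt_le hb ha ht).trans ?_
        have : 0 ≤ t⁻¹ * (if certTest θ v (threshold θ) y then N v else 0) := by
          split_ifs <;> simp [ha'']
        linarith
    · rw [if_neg fun h' => h (certTest_all.2 h')]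
      split_ifs <;> simp <;> linarith
  refine (Finset.sum_le_sum fun v _ => h₁ v).trans_eq ?_
  rw [← Finset.sum_div, Finset.sum_add_distrib, Finset.sum_add_distrib, Finset.sum_add_distrib,
    ← Finset.mul_sum, ← Finset.mul_sum, ← Finset.mul_sum, ← Finset.mul_sum,
    hre fun v => if certTest θ v (threshold θ) y then N v else 0,
    hre fun v => if certTest θ v (fun _ => true) y then N v else 0]
  ring

/-- An exponential-weight bound. Let `w` be the number of disagreements. A counted `θ` vanishes on
all of them and has at most `2w` zeros, so its weight `(2/3)^zeros * (3/2)^(2w)` is at least `1`.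
The weights factor over the positions: a disagreement contributes `2/3 * 9/4 = 3/2`, an agreement `1
+ 2/3 = 5/3`. -/
theorem sum_certTest_threshold_le (v y : Fin n → Bool) :
    (∑ θ, if certTest θ v (threshold θ) y then (1 : ℝ) else 0) ≤ (5 / 3) ^ n := by
  have h₁ : ∀ θ, (if certTest θ v (threshold θ) y then (1 : ℝ) else 0) ≤
      ∏ i, if θ i = true ∧ v i ≠ y i then (0 : ℝ)
        else (if θ i = false then 2 / 3 else 1) * (if v i ≠ y i then (3 / 2) ^ 2 else 1) := by
    intro θ
    split_ifs with h
    · simp only [certTest, Bool.and_eq_true, decide_eq_true_eq, threshold] at h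
      rw [Finset.prod_congr rfl fun i _ => if_neg (not_and.2 fun hi => not_not.2 (h.1 i hi)),
        Finset.prod_mul_distrib, Finset.prod_ite, Finset.prod_ite]
      simp only [Finset.prod_const, one_pow, mul_one]
      rw [← pow_mul]
      calc (1 : ℝ) = (2 / 3) ^ (Finset.univ.filter fun i => θ i = false).card *
          (3 / 2) ^ (Finset.univ.filter fun i => θ i = false).card := by
            rw [← mul_pow]; norm_num
        _ ≤ _ := by
          gcongr
          · norm_num
          · exact h.2
    · refine Finset.prod_nonneg fun i _ => ?_
      split_ifs <;> norm_num
  refine (Finset.sum_le_sum fun θ _ => h₁ θ).trans ?_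
  rw [← prod_sum_bool fun i b => if b = true ∧ v i ≠ y i then (0 : ℝ)
        else (if b = false then 2 / 3 else 1) * (if v i ≠ y i then (3 / 2) ^ 2 else 1)]
  refine (Finset.prod_le_prod (fun i _ => Finset.sum_nonneg fun b _ => ?_) (fun i _ => ?_) :
    _ ≤ ∏ _i : Fin n, (5 / 3 : ℝ)).trans_eq (by rw [Finset.prod_const, Finset.card_univ, Fintype.card_fin])
  · split_ifs <;> norm_num
  · rw [Fintype.sum_bool]
    by_cases h : v i = y i <;> simp [h] <;> norm_num

end

/-! ### The experiment with the residual state -/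

theorem avg_smul {M : Type*} [AddCommMonoid M] [Module ℝ M] (n : ℕ) (c : ℝ) (f : List Bool → M) :
    avg n (fun r => c • f r) = c • avg n f := by
  simp only [avg, ← Finset.smul_sum, smul_comm c]

section
variable {S : CDWE} {lam : ℕ} (A : S.Adversary lam)
  (R : List Bool → List Bool → List Bool → Prop) (E : WE)

theorem endProb_nil (f : (Fin (S.certLen lam) → Bool) → Bool) (Ψ : Vec A.Residual) :
    endProb A f [] (.inr ()) Ψ = ∑ y, if f y then normSq (projVec A.cert y Ψ) else 0 := by
  refine Finset.sum_congr rfl fun y _ => ?_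
  rw [Circuit.run, probVec, ← Equiv.sum_comp (Equiv.sumArrowEquivProdArrow _ _ Bool).symm,
    Fintype.sum_prod_type]
  have h : ∀ (u : A.Residual → Bool) (w : Unit → Bool),
      (if (Equiv.sumArrowEquivProdArrow A.Residual Unit Bool).symm (u, w) (.inr ()) then
        ‖tensVec (projVec A.cert y Ψ) (basisVec fun _ => f y)
          ((Equiv.sumArrowEquivProdArrow A.Residual Unit Bool).symm (u, w))‖ ^ 2 else 0) =
      if w = fun _ => f y then (if f y then ‖projVec A.cert y Ψ u‖ ^ 2 else 0) else 0 := by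
    intro u w
    change (if w () then ‖projVec A.cert y Ψ u * basisVec (fun _ => f y) w‖ ^ 2 else 0) = _
    by_cases hw : w = fun _ => f y
    · subst hw
      simp [basisVec]
    · simp [basisVec, hw]
  simp only [h]
  split_ifs <;> simp [normSq]

theorem endProb_nil_le (f : (Fin (S.certLen lam) → Bool) → Bool) (Ψ : Vec A.Residual) :
    endProb A f [] (.inr ()) Ψ ≤ normSq Ψ := by
  rw [endProb_nil, ← sum_normSq_projVec A.cert Ψ]
  refine Finset.sum_le_sum fun y _ => ?_
  split_ifs
  · exact le_rfl
  · exact normSq_nonneg _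

theorem normSq_midVec (z : Outcome A) (χ : Vec (Fin (S.qubits lam))) (ct : List Bool) :
    normSq (midVec A z χ ct) = normSq (branchVec A z) * normSq χ := by
  rw [midVec, Circuit.normSq_run, normSq_tensVec, normSq_tensVec, normSq_basisVec, mul_one]

theorem sum_normSq_branchVec : ∑ z, normSq (branchVec A z) = 1 := by
  refine (sum_normSq_projVec _ _).trans ?_
  rw [Circuit.normSq_run]
  exact A.advice_unit

open Classical in
theorem sum_outcome_le {c : ℝ} (hc : 0 ≤ c) (f : Outcome A → ℝ)
    (h : ∀ z, f z ≤ c * normSq (branchVec A z)) :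
    (∑ z : Outcome A, if inLanguage R (langOf A z) (stmtOf A z) then 0 else f z) ≤ c := by
  calc _ ≤ ∑ z, c * normSq (branchVec A z) := by
        refine Finset.sum_le_sum fun z _ => ?_
        split_ifs
        · exact mul_nonneg hc (normSq_nonneg _)
        · exact h z
    _ = c := by rw [← Finset.mul_sum, sum_normSq_branchVec, mul_one]

theorem totalProb_nil_le (χ : Vec (Fin (S.qubits lam))) (hχ : normSq χ = 1) (m : List Bool)
    (f : (Fin (S.certLen lam) → Bool) → Bool) : totalProb A R E χ m f [] (.inr ()) ≤ 1 := by
  classical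
  refine sum_outcome_le A R zero_le_one _ fun z => ?_
  refine (avg_le_avg fun r => (endProb_nil_le A f _).trans_eq ?_).trans_eq (avg_const _ _)
  rw [normSq_midVec, hχ, mul_one, one_mul]

/-- For a fixed outcome, classical ciphertext and certificate, the attack is linear in the quantum
ciphertext, so identities between operators on that register carry over to the residual register. -/
theorem exists_matrix_midVec (z : Outcome A) (ct : List Bool) (y : Fin (S.certLen lam) → Bool) :
    ∃ M : Matrix (A.Residual → Bool) (Fin (S.qubits lam) → Bool) ℂ,
      ∀ χ, projVec A.cert y (midVec A z χ ct) = M *ᵥ χ := by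
  let T : Vec (Fin (S.qubits lam)) →ₗ[ℂ] Vec A.Residual :=
    { toFun := fun χ => projVec A.cert y (midVec A z χ ct)
      map_add' := fun χ χ' => by
        have h : tensVec (branchVec A z)
            (tensVec (χ + χ') (basisVec (writeTape A.ctCells ct))) =
            tensVec (branchVec A z) (tensVec χ (basisVec (writeTape A.ctCells ct))) +
            tensVec (branchVec A z) (tensVec χ' (basisVec (writeTape A.ctCells ct))) := by
          funext s; simp [tensVec, add_mul, mul_add]
        rw [midVec, h, ← Circuit.matrix_mulVec, Matrix.mulVec_add, Circuit.matrix_mulVec,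
          Circuit.matrix_mulVec]
        funext s
        simp only [projVec, Pi.add_apply]
        split_ifs
        · rfl
        · simp
      map_smul' := fun a χ => by
        have h : tensVec (branchVec A z)
            (tensVec (a • χ) (basisVec (writeTape A.ctCells ct))) =
            a • tensVec (branchVec A z) (tensVec χ (basisVec (writeTape A.ctCells ct))) := by
          funext s; simp [tensVec]; ring
        rw [midVec, h, Circuit.run_smul]
        funext s
        simp only [projVec, Pi.smul_apply]
        split_ifs
        · rfl
        · simp }
  exact ⟨LinearMap.toMatrix' T, fun χ => (LinearMap.toMatrix'_mulVec T χ).symm⟩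

end

/-! ### The difference of the residual states as a masked sum -/

section
variable {E : WE} {lam : ℕ} (A : (compile E).Adversary lam)
  (R : List Bool → List Bool → List Bool → Prop)

/-- The vector after the certificate `y`, if the ciphertext consists of `χ` and an encryption of
`(θ, c)` with coins `r`. -/
def certVec (z : Outcome A) (r : List Bool) (θ : Fin lam → Bool) (c : Bool) (y : Fin lam → Bool)
    (χ : Vec (Fin lam)) : Vec A.Residual :=
  projVec A.cert y (midVec A z χ (E.enc lam (langOf A z) (stmtOf A z) (keyMsg θ c) r))

open Classical in
theorem afterDeletion_eq (b : Bool) : A.afterDeletion R b true =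
    ∑ z : Outcome A, if inLanguage R (langOf A z) (stmtOf A z) then 0
      else avg (E.encCoins lam (langOf A z) (stmtOf A z) (lam + 1)) fun r =>
        ((2 : ℝ) ^ lam)⁻¹ • ∑ θ : Fin lam → Bool, ((2 : ℝ) ^ lam)⁻¹ • ∑ y : Fin lam → Bool,
          ∑ x : Fin lam → Bool, if ∀ i, θ i = true → x i = y i then
            pureState (certVec A z r θ (z (.inr b) ^^ mask x θ) y (bb84 x θ)) else 0 := by
  unfold CDWE.Adversary.afterDeletion
  refine Finset.sum_congr rfl fun z _ => ?_
  by_cases hz : inLanguage R (langOf A z) (stmtOf A z)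
  · rw [if_pos hz]
    exact if_pos hz
  · rw [if_neg hz]
    refine (if_neg hz).trans ?_
    have h₁ : ∀ r, (∑ y : Fin lam → Bool,
        if (compile E).ver lam ((compile E).encVk lam (langOf A z) (stmtOf A z) (z (.inr b)) r) y =
          true then collapse A.cert y (A.delete.apply (tensor (collapse (Sum.elim A.out A.msg) z
            (A.choose.apply (pureState A.advice))) (tensor ((compile E).encState lam (langOf A z)
              (stmtOf A z) (z (.inr b)) r) (basisState (writeTape A.ctCells
                ((compile E).encCt lam (langOf A z) (stmtOf A z) (z (.inr b)) r)))))) else 0) =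
        ∑ y : Fin lam → Bool, if ∀ i, segment lam lam r i = true → segment lam 0 r i = y i then
          pureState (certVec A z (r.drop (lam + lam)) (segment lam lam r)
            (z (.inr b) ^^ mask (segment lam 0 r) (segment lam lam r)) y
            (bb84 (segment lam 0 r) (segment lam lam r))) else 0 := by
      intro r
      refine Finset.sum_congr rfl fun y _ => if_congr ?_ ?_ rfl
      · exact (iff_of_eq (congrArg (· = true) (ver_compile E lam _ _ _ r y))).trans certTest_all
      · exact (congrArg (collapse A.cert y) (afterDeletion_state A z (z (.inr b)) r)).trans
          (collapse_pureState A.cert y _)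
    refine (congrArg (avg _) (funext h₁)).trans ?_
    refine (avg_coins (n := lam) _ fun x θ r => ∑ y : Fin lam → Bool,
      if ∀ i, θ i = true → x i = y i then
        pureState (certVec A z r θ (z (.inr b) ^^ mask x θ) y (bb84 x θ)) else 0).trans ?_
    rw [avg_smul, avg_sum]
    simp only [avg_smul, avg_sum, ← Finset.smul_sum]
    congr 2
    rw [Finset.sum_comm]
    refine Finset.sum_congr rfl fun θ _ => Finset.sum_comm

/-- The coefficient of the masked sum in the difference of the two experiments. -/
def diffCoeff (m₀ m₁ c : Bool) : ℝ := if m₀ = m₁ then 0 else sgn (m₀ ^^ c)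

/-- The bit `c` that is actually encrypted becomes the summation variable. The mask `μ` and the two
messages survive only in scalar coefficients. -/
theorem sub_eq_sum_diffCoeff {M : Type*} [AddCommGroup M] [Module ℝ M] (f : Bool → M)
    (m₀ m₁ μ : Bool) :
    f (m₀ ^^ μ) - f (m₁ ^^ μ) = ∑ c, diffCoeff m₀ m₁ c • (sgn μ • f c) := by
  rw [Fintype.sum_bool]
  cases m₀ <;> cases m₁ <;> cases μ <;> simp [diffCoeff, sgn] <;> abel

theorem abs_diffCoeff_le (m₀ m₁ c : Bool) : |diffCoeff m₀ m₁ c| ≤ 1 := by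
  unfold diffCoeff sgn
  split_ifs <;> norm_num

-- With `c` and `θ` fixed, the classical ciphertext does not depend on `x`, so the inner sum acts on
-- the quantum register alone.
open Classical in
theorem afterDeletion_sub_eq : A.afterDeletion R false true - A.afterDeletion R true true =
    ∑ z : Outcome A, if inLanguage R (langOf A z) (stmtOf A z) then 0
      else avg (E.encCoins lam (langOf A z) (stmtOf A z) (lam + 1)) fun r =>
        ((2 : ℝ) ^ lam)⁻¹ • ∑ θ : Fin lam → Bool, ((2 : ℝ) ^ lam)⁻¹ • ∑ y : Fin lam → Bool,
          ∑ c, diffCoeff (z (.inr false)) (z (.inr true)) c •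
            ∑ x : Fin lam → Bool, if ∀ i, θ i = true → x i = y i then
              sgn (mask x θ) • pureState (certVec A z r θ c y (bb84 x θ)) else 0 := by
  rw [afterDeletion_eq, afterDeletion_eq, ← Finset.sum_sub_distrib]
  refine Finset.sum_congr rfl fun z _ => ?_
  split_ifs
  · exact sub_self _
  · rw [avg, avg, ← smul_sub, ← Finset.sum_sub_distrib, avg]
    congr 1
    refine Finset.sum_congr rfl fun r _ => ?_
    rw [← smul_sub, ← Finset.sum_sub_distrib]
    congr 1
    refine Finset.sum_congr rfl fun θ _ => ?_
    rw [← smul_sub, ← Finset.sum_sub_distrib]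
    congr 1
    refine Finset.sum_congr rfl fun y _ => ?_
    rw [← Finset.sum_sub_distrib]
    simp only [Finset.smul_sum]
    rw [Finset.sum_comm]
    refine Finset.sum_congr rfl fun x _ => ?_
    split_ifs
    · exact sub_eq_sum_diffCoeff (fun c => pureState (certVec A z (List.ofFn r) θ c y (bb84 x θ)))
        _ _ _
    · simp

theorem rankOneBound_masked (z : Outcome A) (r : List Bool) (θ : Fin lam → Bool) (c : Bool)
    (y : Fin lam → Bool) :
    RankOneBound (∑ x : Fin lam → Bool, if ∀ i, θ i = true → x i = y i then
        sgn (mask x θ) • pureState (certVec A z r θ c y (bb84 x θ)) else 0)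
      (∑ v : Fin lam → Bool, if ∀ i, θ i = true → v i = y i then
        √(normSq (certVec A z r θ c y (hadVec v))) *
          √(normSq (certVec A z r θ c y (hadVec (flipOff θ v)))) else 0) := by
  obtain ⟨M, hM⟩ : ∃ M : Matrix (A.Residual → Bool) (Fin lam → Bool) ℂ,
      ∀ χ : Vec (Fin lam), certVec A z r θ c y χ = M *ᵥ χ := exists_matrix_midVec A z
    (E.enc lam (langOf A z) (stmtOf A z) (keyMsg θ c) r) y
  have hv : ∀ a b : Vec (Fin lam), vecMulVec (M *ᵥ a) (star (M *ᵥ b)) =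
      M * vecMulVec a (star b) * Mᴴ := by
    intro a b
    rw [Matrix.mul_vecMulVec, Matrix.vecMulVec_mul, Matrix.star_mulVec]
  have h : (∑ x : Fin lam → Bool, if ∀ i, θ i = true → x i = y i then
        sgn (mask x θ) • pureState (certVec A z r θ c y (bb84 x θ)) else 0) =
      ∑ v : Fin lam → Bool, if ∀ i, θ i = true → v i = y i then
        vecMulVec (certVec A z r θ c y (hadVec v))
          (star (certVec A z r θ c y (hadVec (flipOff θ v)))) else 0 := by
    have h₀ := congrArg (fun X => M * X * Mᴴ) (sum_masked_pureState θ y)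
    simp only [pureState, hM, hv]
    refine Eq.trans ?_ (h₀.trans ?_)
    · rw [Matrix.mul_sum, Matrix.sum_mul]
      refine Finset.sum_congr rfl fun x _ => ?_
      split_ifs <;> simp
    · rw [Matrix.mul_sum, Matrix.sum_mul]
      refine Finset.sum_congr rfl fun x _ => ?_
      split_ifs <;> simp
  rw [h]
  refine RankOneBound.sum fun v _ => ?_
  split_ifs
  · exact .vecMulVec _ _
  · exact .zero

end

/-! ### From game probabilities to the trace distance -/

section
variable {S : CDWE} {lam : ℕ} (A : S.Adversary lam)
  (R : List Bool → List Bool → List Bool → Prop) (E : WE)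

open Classical in
/-- The expectation over the first measurement and the coins of an encryption of a message of length
`k`, restricted to the event that the experiment is not aborted. -/
def outAvg (k : ℕ) : (Outcome A → List Bool → ℝ) →ₗ[ℝ] ℝ where
  toFun w := ∑ z : Outcome A, if inLanguage R (langOf A z) (stmtOf A z) then 0
    else avg (E.encCoins lam (langOf A z) (stmtOf A z) k) (w z)
  map_add' w w' := by
    rw [← Finset.sum_add_distrib]
    refine Finset.sum_congr rfl fun z _ => ?_
    split_ifs
    · rw [add_zero]
    · simp only [avg, Pi.add_apply, Finset.sum_add_distrib, smul_add]
  map_smul' a w := by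
    rw [Finset.smul_sum]
    refine Finset.sum_congr rfl fun z _ => ?_
    split_ifs
    · rw [smul_zero]
    · exact avg_smul _ _ _

theorem outAvg_mono {k : ℕ} {w w' : Outcome A → List Bool → ℝ} (h : ∀ z r, w z r ≤ w' z r) :
    outAvg A R E k w ≤ outAvg A R E k w' := by
  refine Finset.sum_le_sum fun z _ => ?_
  split_ifs
  · exact le_rfl
  · exact avg_le_avg (h z)

theorem outAvg_le {k : ℕ} {w : Outcome A → List Bool → ℝ} {c : ℝ} (hc : 0 ≤ c)
    (h : ∀ z r, w z r ≤ c * normSq (branchVec A z)) : outAvg A R E k w ≤ c :=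
  sum_outcome_le A R hc _ fun z => (avg_le_avg (h z)).trans_eq (avg_const _ _)

theorem totalProb_eq_outAvg (χ : Vec (Fin (S.qubits lam))) (m : List Bool)
    (f : (Fin (S.certLen lam) → Bool) → Bool) (D : Circuit (A.Residual ⊕ Unit))
    (res : A.Residual ⊕ Unit) : totalProb A R E χ m f D res = outAvg A R E m.length fun z r =>
      endProb A f D res (midVec A z χ (E.enc lam (langOf A z) (stmtOf A z) m r)) := rfl

end

section
variable {E : WE} {lam : ℕ} (A : (compile E).Adversary lam)
  (R : List Bool → List Bool → List Bool → Prop)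

/-- The term with `t⁻¹` is the probability that the certificate is accepted and yet wrong on at
least half of the positions with `θ = 0`, for a register holding `v` in the Hadamard basis. The term
with `t` will only be bounded by `1`. The coefficient `diffCoeff` has absolute value at most `1`, so
the chosen messages play no further role. -/
theorem traceDist_evExp_le {t : ℝ} (ht : 0 < t) :
    traceDist (A.evExp R false) (A.evExp R true) ≤
      ((2 : ℝ) ^ lam)⁻¹ * ∑ θ : Fin lam → Bool, ((2 : ℝ) ^ lam)⁻¹ * ∑ v : Fin lam → Bool, ∑ c,
        (t⁻¹ * totalProb A R E (hadVec v) (keyMsg θ c) (certTest θ v (threshold θ)) [] (.inr ()) +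
          t * totalProb A R E (hadVec v) (keyMsg θ c) (certTest θ v fun _ => true) []
            (.inr ())) := by
  classical
  have h₁ : RankOneBound (A.afterDeletion R false true - A.afterDeletion R true true)
      (outAvg A R E (lam + 1) fun z r => ((2 : ℝ) ^ lam)⁻¹ * ∑ θ : Fin lam → Bool,
        ((2 : ℝ) ^ lam)⁻¹ * ∑ y : Fin lam → Bool, ∑ c, ∑ v : Fin lam → Bool,
          if ∀ i, θ i = true → v i = y i then
            √(normSq (certVec A z r θ c y (hadVec v))) *
              √(normSq (certVec A z r θ c y (hadVec (flipOff θ v)))) else 0) := by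
    rw [afterDeletion_sub_eq]
    refine RankOneBound.sum fun z _ => ?_
    split_ifs
    · exact .zero
    · refine RankOneBound.avg fun r => ?_
      refine RankOneBound.smul_of_nonneg (RankOneBound.sum fun θ _ => ?_) (by positivity)
      refine RankOneBound.smul_of_nonneg (RankOneBound.sum fun y _ => ?_) (by positivity)
      refine RankOneBound.sum fun c _ => ?_
      refine ((rankOneBound_masked A z r θ c y).smul _).mono ?_
      refine mul_le_of_le_one_left (Finset.sum_nonneg fun v _ => ?_) (abs_diffCoeff_le _ _ _)
      split_ifs <;> positivity
  refine h₁.traceDist_le.trans ?_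
  have h₂ : ∀ (z : Outcome A) (r : List Bool), (((2 : ℝ) ^ lam)⁻¹ * ∑ θ : Fin lam → Bool,
        ((2 : ℝ) ^ lam)⁻¹ * ∑ y : Fin lam → Bool, ∑ c, ∑ v : Fin lam → Bool,
          if ∀ i, θ i = true → v i = y i then
            √(normSq (certVec A z r θ c y (hadVec v))) *
              √(normSq (certVec A z r θ c y (hadVec (flipOff θ v)))) else 0) ≤
      (((2 : ℝ) ^ lam)⁻¹ • ∑ θ : Fin lam → Bool, ((2 : ℝ) ^ lam)⁻¹ • ∑ v : Fin lam → Bool, ∑ c,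
        (t⁻¹ • (fun z r => endProb A (certTest θ v (threshold θ)) [] (.inr ())
            (midVec A z (hadVec v) (E.enc lam (langOf A z) (stmtOf A z) (keyMsg θ c) r))) +
          t • fun z r => endProb A (certTest θ v fun _ => true) [] (.inr ())
            (midVec A z (hadVec v) (E.enc lam (langOf A z) (stmtOf A z) (keyMsg θ c) r)))) z r := by
    intro z r
    simp only [Pi.smul_apply, Finset.sum_apply, smul_eq_mul, Pi.add_apply]
    refine mul_le_mul_of_nonneg_left (Finset.sum_le_sum fun θ _ =>
      mul_le_mul_of_nonneg_left ?_ (by positivity)) (by positivity)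
    refine (Finset.sum_le_sum fun y _ => Finset.sum_le_sum fun c _ =>
      sum_sqrt_mul_sqrt_flipOff_le θ y (fun v => normSq (certVec A z r θ c y (hadVec v)))
        (fun v => normSq_nonneg _) ht).trans_eq ?_
    rw [Finset.sum_comm, Finset.sum_comm (s := (Finset.univ : Finset (Fin lam → Bool)))]
    refine Finset.sum_congr rfl fun c _ => ?_
    simp only [Finset.mul_sum, Finset.sum_add_distrib]
    congr 1
    · rw [Finset.sum_comm]
      refine Finset.sum_congr rfl fun v _ => ?_
      rw [← Finset.mul_sum]
      exact congrArg _ (endProb_nil A (certTest θ v (threshold θ)) _).symm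
    · rw [Finset.sum_comm]
      refine Finset.sum_congr rfl fun v _ => ?_
      rw [← Finset.mul_sum]
      exact congrArg _ (endProb_nil A (certTest θ v fun _ => true) _).symm
  refine (outAvg_mono A R E h₂).trans_eq ?_
  simp only [map_smul, map_sum, map_add, smul_eq_mul]
  simp only [totalProb_eq_outAvg, length_keyMsg]

/-- Neither the quantum nor the classical part of the ciphertext depends on `θ` here, so `θ` may be
drawn after the certificate. For each `v` and `y` the fraction of bad `θ` is at most `2⁻ⁿ (5/3)ⁿ`.
-/
theorem average_totalProb_zeroMsg_le :
    ((2 : ℝ) ^ lam)⁻¹ * ∑ θ : Fin lam → Bool, ((2 : ℝ) ^ lam)⁻¹ * ∑ v : Fin lam → Bool,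
      totalProb A R E (hadVec v) (zeroMsg lam) (certTest θ v (threshold θ)) [] (.inr ()) ≤
      (5 / 6) ^ lam := by
  have h₁ : ∀ v : Fin lam → Bool, ((2 : ℝ) ^ lam)⁻¹ * ∑ θ : Fin lam → Bool,
      totalProb A R E (hadVec v) (zeroMsg lam) (certTest θ v (threshold θ)) [] (.inr ()) ≤
      (5 / 6) ^ lam := by
    intro v
    have h := outAvg_le A R E (k := (zeroMsg lam).length)
      (w := ((2 : ℝ) ^ lam)⁻¹ • ∑ θ : Fin lam → Bool, fun z r =>
        endProb A (certTest θ v (threshold θ)) [] (.inr ())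
          (midVec A z (hadVec v) (E.enc lam (langOf A z) (stmtOf A z) (zeroMsg lam) r)))
      (c := (5 / 6) ^ lam) (by positivity) ?_
    · rw [map_smul, map_sum] at h
      exact h
    · intro z r
      simp only [Pi.smul_apply, Finset.sum_apply, smul_eq_mul]
      have hone : normSq (hadVec v) = 1 := normSq_bb84 _ _
      have hmid := (normSq_midVec A z (hadVec v) (E.enc lam (langOf A z) (stmtOf A z)
        (zeroMsg lam) r)).trans ((congrArg (normSq (branchVec A z) * ·) hone).trans (mul_one _))
      rw [← hmid, ← sum_normSq_projVec A.cert]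
      refine (congrArg (((2 : ℝ) ^ lam)⁻¹ * ·) ((Finset.sum_congr rfl fun θ _ =>
        endProb_nil A (certTest θ v (threshold θ)) _).trans Finset.sum_comm)).trans_le ?_
      rw [Finset.mul_sum, Finset.mul_sum]
      refine Finset.sum_le_sum fun y _ => ?_
      have hy := sum_certTest_threshold_le v y
      have hN := normSq_nonneg (projVec A.cert y (midVec A z (hadVec v)
        (E.enc lam (langOf A z) (stmtOf A z) (zeroMsg lam) r)))
      calc _ = (((2 : ℝ) ^ lam)⁻¹ * ∑ θ : Fin lam → Bool,
            if certTest θ v (threshold θ) y then (1 : ℝ) else 0) *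
              normSq (projVec A.cert y (midVec A z (hadVec v)
                (E.enc lam (langOf A z) (stmtOf A z) (zeroMsg lam) r))) := by
            rw [mul_assoc, Finset.sum_mul]
            simp only [ite_mul, one_mul, zero_mul]
            rfl
        _ ≤ (((2 : ℝ) ^ lam)⁻¹ * (5 / 3) ^ lam) * _ := by gcongr
        _ = _ := by
            congr 1
            rw [← inv_pow, ← mul_pow]
            norm_num
  calc _ = ((2 : ℝ) ^ lam)⁻¹ * ∑ v : Fin lam → Bool, ((2 : ℝ) ^ lam)⁻¹ * ∑ θ : Fin lam → Bool,
      totalProb A R E (hadVec v) (zeroMsg lam) (certTest θ v (threshold θ)) [] (.inr ()) := by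
        simp only [← Finset.mul_sum]
        rw [Finset.sum_comm]
    _ ≤ ((2 : ℝ) ^ lam)⁻¹ * ∑ _v : Fin lam → Bool, (5 / 6) ^ lam := by
        gcongr with v
        exact h₁ v
    _ = ((2 : ℝ) ^ lam)⁻¹ * Fintype.card (Fin lam → Bool) * (5 / 6) ^ lam := by
        simp
    _ = _ := by rw [inv_two_pow_mul_card, one_mul]

end

theorem evExp_secure {E : WE} {R : List Bool → List Bool → List Bool → Prop}
    (hE : E.PostQuantumSecure R) (A : (lam : ℕ) → (compile E).Adversary lam)
    (hA : PolyBounded fun lam => (A lam).size) :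
    Negligible fun lam => traceDist ((A lam).evExp R false) ((A lam).evExp R true) := by
  obtain ⟨ν, hν, h⟩ := exists_gameProb_bound (S := compile E) PolyBounded.id PolyBounded.id hE A hA
    (fun lam => []) (PolyBounded.const 0) (fun lam => .inr ())
    (T := fun lam => (Fin lam → Bool) × (Fin lam → Bool) × Bool × Bool)
    (fun lam t => hadVec t.1) (fun lam t => normSq_bb84 _ _)
    (fun lam t => t.2.1) (fun lam t => t.1) (fun _ t => threshold t.2.1)
    (fun lam t => keyMsg t.2.1 t.2.2.1) (fun lam _ => zeroMsg lam) (fun lam => lam + 1)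
    (PolyBounded.id.add (.const 1)) (fun lam => Nat.succ_pos _) (fun lam t => length_keyMsg _ _)
    -- The encrypted string is a constant, so the choice of the challenge bit, here `true`, is
    -- arbitrary; only its value `μ` varies.
    (fun lam t => by simp [zeroMsg]) (fun lam t => true) (fun lam t => t.2.2.2)
  have hν₀ : ∀ lam, 0 ≤ ν lam := fun lam =>
    (abs_nonneg _).trans (h lam (fun _ => false, fun _ => false, false, false))
  have htot : ∀ lam (v θ : Fin lam → Bool) (c : Bool),
      totalProb (A lam) R E (hadVec v) (keyMsg θ c) (certTest θ v (threshold θ)) [] (.inr ()) ≤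
      totalProb (A lam) R E (hadVec v) (zeroMsg lam) (certTest θ v (threshold θ)) [] (.inr ()) +
        2 * ν lam := by
    intro lam v θ c
    rw [← sum_gameProb_const _ R E _ _ true, ← sum_gameProb_const _ R E _ _ true,
      Fintype.sum_bool, Fintype.sum_bool]
    have h₁ := (abs_le.1 (h lam (v, θ, c, true))).2
    have h₂ := (abs_le.1 (h lam (v, θ, c, false))).2
    dsimp only at h₁ h₂
    linarith
  have key : ∀ lam, traceDist ((A lam).evExp R false) ((A lam).evExp R true) ≤
      4 * √((5 / 6) ^ lam + 2 * ν lam) := by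
    intro lam
    -- A bound for the averaged bad probability. With the weight `t = √η`, the terms `2 * t⁻¹ * η`
    -- and `2 * t` are both `2 * √η`; the factors `2` come from the two values of `c`.
    set η : ℝ := (5 / 6) ^ lam + 2 * ν lam with hη
    have hη₀ : 0 < η := add_pos_of_pos_of_nonneg (by positivity) (by linarith [hν₀ lam])
    have ht : 0 < √η := Real.sqrt_pos.2 hη₀
    refine (traceDist_evExp_le (A lam) R ht).trans ?_
    have hsum : ((2 : ℝ) ^ lam)⁻¹ * ∑ θ : Fin lam → Bool, ((2 : ℝ) ^ lam)⁻¹ *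
        ∑ v : Fin lam → Bool, ∑ _c : Bool, ((√η)⁻¹ * (totalProb (A lam) R E (hadVec v)
          (zeroMsg lam) (certTest θ v (threshold θ)) [] (.inr ()) + 2 * ν lam) + √η) =
        2 * (√η)⁻¹ * (((2 : ℝ) ^ lam)⁻¹ * ∑ θ : Fin lam → Bool, ((2 : ℝ) ^ lam)⁻¹ *
          ∑ v : Fin lam → Bool, totalProb (A lam) R E (hadVec v) (zeroMsg lam)
            (certTest θ v (threshold θ)) [] (.inr ())) + (4 * (√η)⁻¹ * ν lam + 2 * √η) := by
      have hc := inv_two_pow_mul_card lam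
      have e : ∀ X : ℝ, ∑ _c : Bool, ((√η)⁻¹ * (X + 2 * ν lam) + √η) =
          2 * (√η)⁻¹ * X + (4 * (√η)⁻¹ * ν lam + 2 * √η) := by
        intro X
        rw [Fintype.sum_bool]
        ring
      simp only [e]
      simp only [Finset.sum_add_distrib, ← Finset.mul_sum, Finset.sum_const, Finset.card_univ,
        nsmul_eq_mul, mul_add]
      generalize ((2 : ℝ) ^ lam)⁻¹ = a at hc ⊢
      generalize (Fintype.card (Fin lam → Bool) : ℝ) = k at hc ⊢
      linear_combination (4 * (√η)⁻¹ * ν lam + 2 * √η) * (a * k + 1) * hc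
    refine (mul_le_mul_of_nonneg_left (Finset.sum_le_sum fun θ _ => mul_le_mul_of_nonneg_left
      (Finset.sum_le_sum fun v _ => Finset.sum_le_sum fun c _ => add_le_add
        (mul_le_mul_of_nonneg_left (htot lam v θ c) (by positivity))
        (mul_le_of_le_one_right ht.le (totalProb_nil_le _ R E _ (normSq_bb84 _ _) _ _)))
      (by positivity)) (by positivity)).trans ?_
    rw [hsum]
    have hz := average_totalProb_zeroMsg_le (A lam) R
    have h₁ := mul_le_mul_of_nonneg_left hz (by positivity : 0 ≤ 2 * (√η)⁻¹)
    have h₂ : (√η)⁻¹ * η = √η := by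
      have := Real.mul_self_sqrt hη₀.le
      field_simp
      rw [pow_two, this]
    have h₃ : 2 * (√η)⁻¹ * (5 / 6) ^ lam + 4 * (√η)⁻¹ * ν lam = 2 * √η := by
      linear_combination 2 * h₂ - 2 * (√η)⁻¹ * hη
    linarith
  refine Negligible.of_le ?_ (fun lam => ?_) key
  · exact (((negligible_geometric (by norm_num) (by norm_num)).add (hν.const_mul 2)).sqrt).const_mul 4
  · exact div_nonneg (Finset.sum_nonneg fun _ _ => Real.sqrt_nonneg _) zero_le_two

end CertDel
end

theorem mainTheorem4 (R : List Bool → List Bool → List Bool → Prop) (E : CertDel.WE)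
    (hE : E.IsPostQuantumWE R) : (CertDel.compile E).IsCDWE R :=
  ⟨CertDel.compile_isQPT hE.ppt, CertDel.correct_compile E R hE.correct,
    CertDel.deletionCorrect_compile E,
    fun A hA => ⟨CertDel.evExp_secure hE.secure A hA, CertDel.cExp_secure hE.secure A hA⟩⟩
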